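/- Let $q$ be a real-valued $C^\infty$ function on $[0,\infty)$ such that $-\frac{d^2}{dx^2}+q$ is in the limit point case at infinity, let $\mathcal H=L_2(0,\infty)$ (complex-valued), and let $L_0y=-y''+qy$ with domain $$\{y\in\mathcal H\cap H^2_{\rm loc}([0,\infty)) : y(0)=y'(0)=0,\ -y''+qy\in\mathcal H\}.$$ Assume that $L_0$ is positive definite: it is symmetric and $(L_0y,y)\ge\varkappa\|y\|^2$ on its domain for some $\varkappa>0$. Let $L$ be the Friedrichs extension of $L_0$. *Reachable subspaces.* For $T\ge 0$ let $\mathcal U^T=\{u^h(T)\}$, where $h$ runs over the smooth functions $h:[0,\infty)\to\operatorname{Ker}L_0^*$ vanishing near $t=0$ and $u^h\in C^\infty([0,\infty);\mathcal H)$ is the classical solution of $u_{tt}+L_0^*u=0$ $(t>0)$, $u(0)=u_t(0)=0$, $(L^{-1}L_0^*-\mathbb I)u(t)=h(t)$ $(t\ge0)$. *Wave isotony.* For a closed subspace $\mathcal G\subseteq\mathcal H$ put $I^0\mathcal G=\mathcal G$, and for $t>0$ let $I^t\mathcal G$ be the closure of $$\Big\{\int_0^tL^{-1/2}\sin[(t-s)L^{1/2}]\,g(s)\,ds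 : g\in L_2^{\rm loc}([0,\infty);\mathcal G)\Big\}.$$ *Wave spectrum.* Let $\mathfrak L$ be the smallest family of closed subspaces of $\mathcal H$ that contains $\{0\}$, $\mathcal H$ and all $\overline{\mathcal U^T}$ $(T\ge0)$ and is stable under $A\vee B=\overline{A+B}$, $A\cap B$, $A^\perp$ and all $I^t$. Let $\mathcal F$ be the set of all pointwise (in $t$) limits of sequences of functions $t\mapsto I^tA_n$, $A_n\in\mathfrak L$, where convergence of subspaces is strong convergence of the orthogonal projections $P_A$; order $\mathcal F$ by pointwise inclusion. The wave spectrum $\Omega$ is the set of atoms (minimal nonzero elements) of $\mathcal F$. For $\omega,\omega'\in\Omega$ and $r>0$ put $$B_r[\omega]=\{\omega'\in\Omega : \exists\,t>0,\ \{0\}\ne\omega'(t)\subseteq\omega(r)\},\qquad \tau_\omega=\int_{[0,\infty)}t\,dP_{\omega(t)},\qquad \tau(\omega,\omega')=\|\tau_\omega-\tau_{\omega'}\|,$$ $$\partial\Omega=\{\omega\in\Omega : \omega(t)\subseteq\overline{\mathcal U^t}\ \ \forall t>0\}.$$ The ball topology on $\Omega$ is the topology generated by the sets $B_r[\omega]$.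 For $x\ge0$ let $\{x\}^t=\{y\ge0 : |y-x|<t\}$, let $\omega_x(t)$ be the subspace $L_2(\{x\}^t)$ of the functions in $\mathcal H$ vanishing a.e. outside $\{x\}^t$, and let $m$ be Lebesgue measure. **Proposition.** The map $x\mapsto\omega_x$ is a bijection of $[0,\infty)$ onto $\Omega$. Write $x_\omega$ for the point with $\omega=\omega_{x_\omega}$. Then: 1. $\tau$ is a metric on $\Omega$. For all $\omega\in\Omega$ and $r>0$ with $r\neq x_\omega$ one has $B_r[\omega]=\{\omega'\in\Omega : \tau(\omega,\omega')<r\}$, while for $r=x_\omega>0$ one has $B_r[\omega]=\{\omega'\in\Omega : \tau(\omega,\omega')<r\}\cup\{\omega_0\}$. The sets $B_r[\omega]$ form a base of the ball topology, and the ball topology coincides with the topology of the metric $\tau$. 2. There is a unique Borel measure $\nu$ on $\Omega$ such that $\nu(B_r[\omega])=m(\{x_\omega\}^r)=r+\min\{r,x_\omega\}$ for all $\omega\in\Omega$, $r>0$. 3. $\partial\Omega=\{\omega_0\}$. 4. $\tau(\omega):=\tau(\omega,\omega_0)=x_\omega$ for all $\omega\in\Omega$, and $\omega\mapsto\tau(\omega)$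 is a global coordinate on $\Omega$: a homeomorphism, indeed an isometry for the metric $\tau$, of $\Omega$ onto $[0,\infty)$. -/

import Mathlib

open MeasureTheory Set Filter Topology
open scoped NNReal ENNReal

namespace WaveSpectrum

/-! ### Semibounded operators, the Friedrichs extension and its functional calculus -/

section General

variable {H : Type*} [NormedAddCommGroup H] [InnerProductSpace ℂ H]

/-- A symmetric operator with `(L₀ y, y) ≥ ϰ ‖y‖²` on its domain for some `ϰ > 0`. -/
def IsPositiveDefinite (L₀ : H →ₗ.[ℂ] H) : Prop :=
  L₀.IsFormalAdjoint L₀ ∧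
    ∃ ϰ : ℝ, 0 < ϰ ∧ ∀ y : L₀.domain, ϰ * ‖(y : H)‖ ^ 2 ≤ (inner ℂ (L₀ y) (y : H)).re

/-- The energy space of `L₀`: limits in `H` of sequences from `Dom L₀` that are Cauchy with respect
to the quadratic form `(L₀ y, y)`. For a positive `L₀` the set under the span is already a linear
subspace. -/
def formDomain (L₀ : H →ₗ.[ℂ] H) : Submodule ℂ H :=
  Submodule.span ℂ {y | ∃ u : ℕ → L₀.domain,
    Tendsto (fun n => (u n : H)) atTop (𝓝 y) ∧
    Tendsto (fun p : ℕ × ℕ => inner ℂ (L₀ (u p.1 - u p.2)) ((u p.1 - u p.2 : L₀.domain) : H))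
      atTop (𝓝 0)}

/-- The closed linear span of a set of vectors. -/
def closedSpan (S : Set H) : ClosedSubmodule ℂ H := (Submodule.span ℂ S).closure

variable [CompleteSpace H]

/-- The Friedrichs extension `L` of `L₀`: the restriction of `L₀*` to those elements of its domain
which lie in the energy space of `L₀`. -/
noncomputable def friedrichs (L₀ : H →ₗ.[ℂ] H) : H →ₗ.[ℂ] H :=
  L₀.adjoint.domRestrict (formDomain L₀)

/-- `B` is the bounded everywhere defined inverse of `L`. -/
def IsBoundedInverse (L : H →ₗ.[ℂ] H) (B : H →L[ℂ] H) : Prop :=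
  (∀ y : H, (B y, y) ∈ L.graph) ∧ ∀ y : L.domain, B (L y) = y

open scoped Classical in
/-- The bounded inverse `L⁻¹` (zero if there is none). -/
noncomputable def boundedInverse (L : H →ₗ.[ℂ] H) : H →L[ℂ] H :=
  if h : ∃ B, IsBoundedInverse L B then h.choose else 0

/-- The operator `L^{-1/2} sin (t L^{1/2})`, written as the continuous function
`s ↦ √s sin (t / √s)` (equal to `0` at `s = 0`) of the bounded self-adjoint operator `L⁻¹`. -/
noncomputable def sineOp (L : H →ₗ.[ℂ] H) (t : ℝ) : H →L[ℂ] H :=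
  cfc (fun s : ℝ => √s * Real.sin (t / √s)) (boundedInverse L)

/-! ### The dynamical system with boundary control and its reachable subspaces -/

/-- The boundary operator `Γ₁ = L⁻¹ L₀* - 𝕀` on `Dom L₀*`, with `L` the Friedrichs extension. -/
noncomputable def boundaryOp (L₀ : H →ₗ.[ℂ] H) (y : L₀.adjoint.domain) : H :=
  boundedInverse (friedrichs L₀) (L₀.adjoint y) - y

/-- Smooth controls on `[0, ∞)` with values in `Ker L₀*` that vanish near `t = 0`. -/
def IsControl (L₀ : H →ₗ.[ℂ] H) (h : ℝ → H) : Prop :=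
  ContDiffOn ℝ (⊤ : ℕ∞) h (Ici 0) ∧ (∀ t, 0 ≤ t → (h t, 0) ∈ L₀.adjoint.graph) ∧
    ∃ ε : ℝ, 0 < ε ∧ ∀ t ∈ Icc 0 ε, h t = 0

/-- `u` is the classical (smooth) solution of `u_tt + L₀* u = 0` for `t > 0`,
`u(0) = u_t(0) = 0`, `Γ₁ u(t) = h(t)` for `t ≥ 0`. -/
structure IsWave (L₀ : H →ₗ.[ℂ] H) (h u : ℝ → H) : Prop where
  smooth : ContDiffOn ℝ (⊤ : ℕ∞) u (Ici 0)
  init : u 0 = 0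
  init_deriv : derivWithin u (Ici 0) 0 = 0
  equation : ∀ t, 0 < t → (u t, -iteratedDerivWithin 2 u (Ici 0) t) ∈ L₀.adjoint.graph
  boundary : ∀ t, 0 ≤ t → ∃ ht : u t ∈ L₀.adjoint.domain, boundaryOp L₀ ⟨u t, ht⟩ = h t

/-- The reachable set `𝓤^T` of the system with boundary control. -/
def reachableSet (L₀ : H →ₗ.[ℂ] H) (T : ℝ≥0) : Set H :=
  {y | ∃ h u : ℝ → H, IsControl L₀ h ∧ IsWave L₀ h u ∧ y = u T}

/-- The reachable subspace, i.e. the closure of `𝓤^T` (which is a linear set). -/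
def reachableSubspace (L₀ : H →ₗ.[ℂ] H) (T : ℝ≥0) : ClosedSubmodule ℂ H :=
  closedSpan (reachableSet L₀ T)

/-! ### The wave isotony -/

/-- The states at time `t` of the system `v_tt + L v = g`, `v(0) = v_t(0) = 0`, given by the
Duhamel formula, for all controls `g ∈ L₂^loc([0, ∞); G)`. -/
def sourceReachableSet (L : H →ₗ.[ℂ] H) (G : ClosedSubmodule ℂ H) (t : ℝ) : Set H :=
  {v | ∃ g : ℝ → H, (∀ s, g s ∈ G) ∧ (∀ R : ℝ, MemLp g 2 (volume.restrict (Ioc 0 R))) ∧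
    v = ∫ s in (0 : ℝ)..t, sineOp L (t - s) (g s)}

open scoped Classical in
/-- The wave isotony: `I⁰ = id`, and `I^t G` is the closure of the (linear) set of reachable states
with `G`-valued controls for `t > 0`. -/
noncomputable def waveIsotony (L₀ : H →ₗ.[ℂ] H) (t : ℝ≥0) (G : ClosedSubmodule ℂ H) :
    ClosedSubmodule ℂ H :=
  if t = 0 then G else closedSpan (sourceReachableSet (friedrichs L₀) G t)

/-! ### Lattices, atoms, the wave spectrum -/

/-- A family of closed subspaces that is invariant under the lattice operations and complements. -/
structure IsSubspaceLattice (𝔏 : Set (ClosedSubmodule ℂ H)) : Prop where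
  bot_mem : ⊥ ∈ 𝔏
  top_mem : ⊤ ∈ 𝔏
  sup_mem : ∀ A ∈ 𝔏, ∀ B ∈ 𝔏, A ⊔ B ∈ 𝔏
  inf_mem : ∀ A ∈ 𝔏, ∀ B ∈ 𝔏, A ⊓ B ∈ 𝔏
  compl_mem : ∀ A ∈ 𝔏, A.orthogonal ∈ 𝔏

/-- The minimal lattice that contains all reachable subspaces and is invariant under the wave
isotony. -/
def waveLattice (L₀ : H →ₗ.[ℂ] H) : Set (ClosedSubmodule ℂ H) :=
  ⋂₀ {𝔏 | IsSubspaceLattice 𝔏 ∧ (∀ t, ∀ A ∈ 𝔏, waveIsotony L₀ t A ∈ 𝔏) ∧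
    ∀ T, reachableSubspace L₀ T ∈ 𝔏}

/-- The functions `t ↦ I^t A` with `A` in the lattice, completed by the limits of all sequences that
converge pointwise in `t` (in the sense of strong convergence of the orthogonal projections). -/
def waveFunctions (L₀ : H →ₗ.[ℂ] H) : Set (ℝ≥0 → ClosedSubmodule ℂ H) :=
  {f | ∃ A : ℕ → ClosedSubmodule ℂ H, (∀ n, A n ∈ waveLattice L₀) ∧
    ∀ (t : ℝ≥0) (y : H), Tendsto (fun n => (waveIsotony L₀ t (A n)).toSubmodule.starProjection y)
      atTop (𝓝 ((f t).toSubmodule.starProjection y))}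

/-- The wave spectrum: the set of atoms, i.e. of minimal nonzero elements. -/
def waveSpectrum (L₀ : H →ₗ.[ℂ] H) : Set (ℝ≥0 → ClosedSubmodule ℂ H) :=
  {ω | Minimal (fun f => f ∈ waveFunctions L₀ ∧ f ≠ ⊥) ω}

/-! ### Balls, the eikonal distance, the boundary -/

/-- The ball `B_r[ω]` in the wave spectrum. -/
def waveBall (L₀ : H →ₗ.[ℂ] H) (r : ℝ≥0) (ω : waveSpectrum L₀) : Set (waveSpectrum L₀) :=
  {ω' | ∃ t : ℝ≥0, 0 < t ∧ ω'.1 t ≠ ⊥ ∧ ω'.1 t ≤ ω.1 r}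

/-- The system of all balls of positive radius. -/
def waveBalls (L₀ : H →ₗ.[ℂ] H) : Set (Set (waveSpectrum L₀)) :=
  {B | ∃ (ω : waveSpectrum L₀) (r : ℝ≥0), 0 < r ∧ B = waveBall L₀ r ω}

/-- The ball topology, generated by the balls. -/
abbrev ballTopology (L₀ : H →ₗ.[ℂ] H) : TopologicalSpace (waveSpectrum L₀) :=
  TopologicalSpace.generateFrom (waveBalls L₀)

/-- `z = ∫_{[0,T]} t dP_{ω(t)} y` as a limit in `H` of Riemann-Stieltjes sums over tagged partitions
`0 = t 0 ≤ ⋯ ≤ t n = T` with tags `ξ i ∈ [t i, t (i + 1)]`, as the rank tends to zero. -/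
def HasStieltjesIntegral (ω : ℝ≥0 → ClosedSubmodule ℂ H) (T : ℝ≥0) (y z : H) : Prop :=
  ∀ ε : ℝ, 0 < ε → ∃ δ : ℝ, 0 < δ ∧ ∀ (n : ℕ) (t ξ : ℕ → ℝ≥0), t 0 = 0 → t n = T →
    (∀ i < n, t i ≤ ξ i ∧ ξ i ≤ t (i + 1) ∧ (t (i + 1) : ℝ) - t i < δ) →
    ‖(∑ i ∈ Finset.range n, ((ξ i : ℝ) : ℂ) • ((ω (t (i + 1))).toSubmodule.starProjection y -
      (ω (t i)).toSubmodule.starProjection y)) - z‖ < ε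

theorem HasStieltjesIntegral.add {ω : ℝ≥0 → ClosedSubmodule ℂ H} {T : ℝ≥0} {y z y' z' : H}
    (h : HasStieltjesIntegral ω T y z) (h' : HasStieltjesIntegral ω T y' z') :
    HasStieltjesIntegral ω T (y + y') (z + z') := by
  intro ε hε
  obtain ⟨δ, hδ, H1⟩ := h (ε / 2) (half_pos hε)
  obtain ⟨δ', hδ', H2⟩ := h' (ε / 2) (half_pos hε)
  refine ⟨min δ δ', lt_min hδ hδ', fun n t ξ h0 hn ht => ?_⟩
  have e1 := H1 n t ξ h0 hn fun i hi =>
    ⟨(ht i hi).1, (ht i hi).2.1, (ht i hi).2.2.trans_le (min_le_left _ _)⟩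
  have e2 := H2 n t ξ h0 hn fun i hi =>
    ⟨(ht i hi).1, (ht i hi).2.1, (ht i hi).2.2.trans_le (min_le_right _ _)⟩
  refine lt_of_eq_of_lt ?_ ((norm_add_le _ _).trans_lt ((add_lt_add e1 e2).trans_eq
    (add_halves ε)))
  congr 1
  rw [sub_add_sub_comm, ← Finset.sum_add_distrib]
  congr 1
  refine Finset.sum_congr rfl fun i _ => ?_
  rw [map_add, map_add, ← smul_add, add_sub_add_comm]

theorem HasStieltjesIntegral.smul {ω : ℝ≥0 → ClosedSubmodule ℂ H} {T : ℝ≥0} {y z : H} (c : ℂ)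
    (h : HasStieltjesIntegral ω T y z) : HasStieltjesIntegral ω T (c • y) (c • z) := by
  intro ε hε
  obtain ⟨δ, hδ, H1⟩ := h (ε / (‖c‖ + 1)) (by positivity)
  refine ⟨δ, hδ, fun n t ξ h0 hn ht => ?_⟩
  have e1 := H1 n t ξ h0 hn ht
  have e2 : ‖c‖ * ‖(∑ i ∈ Finset.range n, ((ξ i : ℝ) : ℂ) •
      ((ω (t (i + 1))).toSubmodule.starProjection y -
        (ω (t i)).toSubmodule.starProjection y)) - z‖ < ε := by
    rw [lt_div_iff₀ (by positivity)] at e1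
    nlinarith [norm_nonneg ((∑ i ∈ Finset.range n, ((ξ i : ℝ) : ℂ) •
      ((ω (t (i + 1))).toSubmodule.starProjection y -
        (ω (t i)).toSubmodule.starProjection y)) - z), norm_nonneg c]
  refine lt_of_eq_of_lt ?_ e2
  rw [← norm_smul, smul_sub, Finset.smul_sum]
  congr 2
  refine Finset.sum_congr rfl fun i _ => ?_
  rw [map_smul, map_smul, ← smul_sub, smul_comm]

/-- The graph of the eikonal: pairs `(y, z)` such that `z = lim_{T → ∞} ∫_{[0,T]} t dP_{ω(t)} y`. -/
def eikonalGraph (ω : ℝ≥0 → ClosedSubmodule ℂ H) : Submodule ℂ (H × H) where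
  carrier := {p | ∃ Z : ℝ≥0 → H, (∀ T, HasStieltjesIntegral ω T p.1 (Z T)) ∧
    Tendsto Z atTop (𝓝 p.2)}
  add_mem' := by
    rintro p p' ⟨Z, hZ, hl⟩ ⟨Z', hZ', hl'⟩
    exact ⟨fun T => Z T + Z' T, fun T => (hZ T).add (hZ' T), hl.add hl'⟩
  zero_mem' := by
    refine ⟨fun _ => 0, fun T ε hε => ⟨1, one_pos, fun n t ξ _ _ _ => ?_⟩, tendsto_const_nhds⟩
    simpa using hε
  smul_mem' := by
    rintro c p ⟨Z, hZ, hl⟩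
    exact ⟨fun T => c • Z T, fun T => (hZ T).smul c, hl.const_smul c⟩

/-- The eikonal `τ_ω = ∫_{[0,∞)} t dP_{ω(t)}`, with its maximal domain. -/
noncomputable def eikonal (ω : ℝ≥0 → ClosedSubmodule ℂ H) : H →ₗ.[ℂ] H :=
  (eikonalGraph ω).toLinearPMap

/-- The operator norm of a possibly unbounded operator, with values in `[0, ∞]`. -/
noncomputable def opNorm (A : H →ₗ.[ℂ] H) : ℝ≥0∞ :=
  ⨆ y : A.domain, ⨆ _ : ‖(y : H)‖ ≤ 1, ‖A y‖ₑ

/-- The distance `τ(ω, ω') = ‖τ_ω - τ_ω'‖`; the difference is taken on the common domain. -/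
noncomputable def eikonalDist (ω ω' : ℝ≥0 → ClosedSubmodule ℂ H) : ℝ≥0∞ :=
  opNorm (eikonal ω - eikonal ω')

/-- The boundary of the wave spectrum. -/
def waveBoundary (L₀ : H →ₗ.[ℂ] H) : Set (waveSpectrum L₀) :=
  {ω | ∀ t : ℝ≥0, 0 < t → ω.1 t ≤ reachableSubspace L₀ t}

end General

/-! ### Sturm-Liouville operators on the half-line -/

/-- The space `L₂(ℝ₊)` of complex-valued functions. -/
abbrev HalfLineL2 : Type := Lp ℂ 2 (volume.restrict (Ioi (0 : ℝ)))

/-- `f ∈ H²_loc([0, ∞))` with first and second derivatives `f'` and `f''`. -/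
structure IsH2Loc (f f' f'' : ℝ → ℂ) : Prop where
  memLp : ∀ R : ℝ, MemLp f'' 2 (volume.restrict (Ioc 0 R))
  eq_integral : ∀ x, 0 ≤ x → f x = f 0 + ∫ s in (0 : ℝ)..x, f' s
  deriv_eq_integral : ∀ x, 0 ≤ x → f' x = f' 0 + ∫ s in (0 : ℝ)..x, f'' s

theorem IsH2Loc.intervalIntegrable {f f' f'' : ℝ → ℂ} (h : IsH2Loc f f' f'') {x : ℝ}
    (hx : 0 ≤ x) : IntervalIntegrable f'' volume 0 x := by
  rw [intervalIntegrable_iff_integrableOn_Ioc_of_le hx]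
  exact (h.memLp x).integrable (by norm_num)

theorem IsH2Loc.intervalIntegrable_deriv {f f' f'' : ℝ → ℂ} (h : IsH2Loc f f' f'') {x : ℝ}
    (hx : 0 ≤ x) : IntervalIntegrable f' volume 0 x := by
  have hi := h.intervalIntegrable hx
  have hc : ContinuousOn (fun y => f' 0 + ∫ s in (0 : ℝ)..y, f'' s) (uIcc 0 x) :=
    continuousOn_const.add (intervalIntegral.continuousOn_primitive_interval
      (by rwa [← intervalIntegrable_iff'] ))
  refine (hc.congr fun y hy => ?_).intervalIntegrable
  rw [uIcc_of_le hx] at hy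
  exact h.deriv_eq_integral y hy.1

theorem IsH2Loc.add {f f' f'' g g' g'' : ℝ → ℂ} (hf : IsH2Loc f f' f'') (hg : IsH2Loc g g' g'') :
    IsH2Loc (f + g) (f' + g') (f'' + g'') where
  memLp R := (hf.memLp R).add (hg.memLp R)
  eq_integral x hx := by
    simp only [Pi.add_apply]
    rw [intervalIntegral.integral_add (hf.intervalIntegrable_deriv hx)
      (hg.intervalIntegrable_deriv hx), hf.eq_integral x hx, hg.eq_integral x hx]
    ring
  deriv_eq_integral x hx := by
    simp only [Pi.add_apply]
    rw [intervalIntegral.integral_add (hf.intervalIntegrable hx) (hg.intervalIntegrable hx),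
      hf.deriv_eq_integral x hx, hg.deriv_eq_integral x hx]
    ring

theorem IsH2Loc.smul {f f' f'' : ℝ → ℂ} (c : ℂ) (hf : IsH2Loc f f' f'') :
    IsH2Loc (c • f) (c • f') (c • f'') where
  memLp R := (hf.memLp R).const_smul c
  eq_integral x hx := by
    simp only [Pi.smul_apply]
    rw [intervalIntegral.integral_smul, hf.eq_integral x hx, smul_add]
  deriv_eq_integral x hx := by
    simp only [Pi.smul_apply]
    rw [intervalIntegral.integral_smul, hf.deriv_eq_integral x hx, smul_add]

theorem IsH2Loc.zero : IsH2Loc 0 0 0 := ⟨fun _ => MemLp.zero, by simp, by simp⟩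

/-- The graph of the minimal Sturm-Liouville operator: pairs `(y, z)` of elements of `L₂(ℝ₊)` with
`y ∈ H²_loc([0, ∞))`, `y(0) = y'(0) = 0` and `z = -y'' + q y`. -/
def sturmLiouvilleGraph (q : ℝ → ℝ) : Submodule ℂ (HalfLineL2 × HalfLineL2) where
  carrier := {p | ∃ f f' f'' : ℝ → ℂ, IsH2Loc f f' f'' ∧ f 0 = 0 ∧ f' 0 = 0 ∧
    p.1 =ᵐ[volume.restrict (Ioi 0)] f ∧
    p.2 =ᵐ[volume.restrict (Ioi 0)] fun x => -f'' x + (q x : ℂ) * f x}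
  add_mem' := by
    rintro p p' ⟨f, f', f'', hf, h0, h0', e, e'⟩ ⟨g, g', g'', hg, k0, k0', d, d'⟩
    refine ⟨f + g, f' + g', f'' + g'', hf.add hg, by simp [h0, k0], by simp [h0', k0'], ?_, ?_⟩
    · exact (Lp.coeFn_add _ _).trans (e.add d)
    · refine (Lp.coeFn_add _ _).trans ((e'.add d').trans (Eventually.of_forall fun x => ?_))
      simp only [Pi.add_apply]
      ring
  zero_mem' := by
    refine ⟨0, 0, 0, IsH2Loc.zero, rfl, rfl, Lp.coeFn_zero _ _ _, ?_⟩
    exact (Lp.coeFn_zero _ _ _).trans (Eventually.of_forall fun x => by simp)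
  smul_mem' := by
    rintro c p ⟨f, f', f'', hf, h0, h0', e, e'⟩
    refine ⟨c • f, c • f', c • f'', hf.smul c, by simp [h0], by simp [h0'], ?_, ?_⟩
    · exact (Lp.coeFn_smul _ _).trans (e.const_smul c)
    · refine (Lp.coeFn_smul _ _).trans ((e'.const_smul c).trans (Eventually.of_forall fun x => ?_))
      simp only [Pi.smul_apply, smul_eq_mul]
      ring

/-- The minimal Sturm-Liouville operator `L₀ y = -y'' + q y` in `L₂(ℝ₊)`. -/
noncomputable def sturmLiouvilleOp (q : ℝ → ℝ) : HalfLineL2 →ₗ.[ℂ] HalfLineL2 :=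
  (sturmLiouvilleGraph q).toLinearPMap

/-- The limit point case at infinity: it is not true that for every `c ∈ ℂ` all solutions of
`-u'' + q u = c u` on `[0, ∞)` are square integrable. -/
def IsLimitPoint (q : ℝ → ℝ) : Prop :=
  ∃ (c : ℂ) (u u' : ℝ → ℂ), (∀ x ∈ Ici (0 : ℝ), HasDerivWithinAt u (u' x) (Ici 0) x) ∧
    (∀ x ∈ Ici (0 : ℝ), HasDerivWithinAt u' (((q x : ℂ) - c) * u x) (Ici 0) x) ∧
    ¬ MemLp u 2 (volume.restrict (Ioi 0))

/-- The subspace `L₂(E)` of functions from `L₂(ℝ₊)` that vanish almost everywhere outside `E`. -/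
def L2On (E : Set ℝ) : ClosedSubmodule ℂ HalfLineL2 where
  carrier := {y | y =ᵐ[(volume.restrict (Ioi 0)).restrict Eᶜ] (0 : ℝ → ℂ)}
  add_mem' {y y'} hy hy' := by
    rw [mem_ofPred_eq] at hy hy' ⊢
    have h := EventuallyEq.trans (ae_restrict_of_ae (s := Eᶜ) (Lp.coeFn_add y y'))
      (EventuallyEq.add hy hy')
    simpa only [add_zero] using h
  zero_mem' := ae_restrict_of_ae (Lp.coeFn_zero _ _ _)
  smul_mem' c y hy := by
    rw [mem_ofPred_eq] at hy ⊢
    have h := EventuallyEq.trans (ae_restrict_of_ae (s := Eᶜ) (Lp.coeFn_smul c y))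
      (EventuallyEq.const_smul hy c)
    simpa only [smul_zero] using h
  isClosed' := by
    have h : IsClosed ((LpToLpRestrictCLM ℝ ℂ ℂ (volume.restrict (Ioi (0 : ℝ))) 2 Eᶜ) ⁻¹' {0}) :=
      isClosed_singleton.preimage (ContinuousLinearMap.continuous _)
    convert h using 1
    ext y
    have e := LpToLpRestrictCLM_coeFn (μ := volume.restrict (Ioi (0 : ℝ))) (p := 2) ℂ Eᶜ y
    simp only [mem_preimage, mem_singleton_iff]
    rw [Lp.eq_zero_iff_ae_eq_zero]
    exact ⟨fun h => e.trans h, fun h => e.symm.trans h⟩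

/-- The neighborhood `{x}^r` of a point in the half-line `[0, ∞)`. -/
def halfLineBall (x r : ℝ≥0) : Set ℝ := {y | 0 ≤ y ∧ |y - x| < r}

/-- The function `ω_x : t ↦ L₂({x}^t)`. -/
def pointAtom (x : ℝ≥0) : ℝ≥0 → ClosedSubmodule ℂ HalfLineL2 := fun t => L2On (halfLineBall x t)

end WaveSpectrum

/-! The proof translates everything built from the operator into geometry of the half-line. Every
subspace that occurs is `L₂(U)` for an open set `U`, and the two dynamical constructions act on such
sets metrically: the closure of the reachable set at time `T` is `L₂(0, T)`
(`reachableSubspace_eq`), and the wave isotony sends `L₂(U)` to `L₂` of the `t`-neighborhood of `U`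
(`waveIsotony_L2On`).

Each of these equalities has two halves. The inclusion from left to right is finite speed of
propagation. The reverse inclusion is proved on orthogonal complements: a vector orthogonal to all
reachable states is the initial velocity of a wave whose Cauchy data vanish on a segment `{x₀} ×
(-t, t)`. Exchanging the roles of space and time, the wave vanishes in a characteristic rhombus, so
the velocity vanishes on `(x₀ - t, x₀ + t)`. Both halves rest on one uniqueness theorem for systems
in characteristic form, `eq_zero_of_characteristic_system`, proved by Picard iteration.

Waves are given by the functional calculus of `B = L⁻¹`, so pointwise values must be supplied. The
inverse of the Friedrichs extension is `B = J J*` with `J` the map from the energy space to `H`.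
Functions in the range of `B` are locally `H²` and vanish at `0`, so they extend oddly to the line
and the boundary disappears (`exists_isEvaluation`). Waves with initial velocity in the range of
`B²` can then be differentiated pointwise; a general vector is replaced by `ε⁻⁶ (√B sin (ε / √B))⁶`
applied to it, which lies in that range and costs only `6ε` of time.

Since neighborhoods of sets on the line have null boundary, the spaces `L₂(U)` with `U` open and of
null boundary form a lattice stable under complements and isotony, so the wave lattice consists of
such spaces. It contains `L₂(x, x + δ)`, and letting `δ → 0` shows that `ω_x` is a wave function.
Conversely, by compactness every nonzero wave function dominates some `ω_x` (`exists_pointAtom_le`).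
As distinct `ω_x` are incomparable, they are exactly the atoms.

The eikonal of `ω_x` is multiplication by `|ξ - x|`, so the eikonal distance is `|x - x'|`. An
abstract ball is a metric ball, except that for `r = x` the endpoint `0` joins it: a one-sided
neighborhood of `0` fits into the ball up to a null set. Topology, measure, boundary and coordinate
are then transported from the half-line. -/

namespace WaveSpectrum

/-! ### Energy space and inverse of the Friedrichs extension -/

section Friedrichs

/-- A symmetric positive definite pair of linear maps `T, ι : D → H` has an energy space: the
completion of `D` with respect to the form `(T f, ι g)`, which is mapped to `H`. -/
theorem exists_energySpace.{u, v} {D : Type u} {H : Type v}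
    [AddCommGroup D] [Module ℂ D] [NormedAddCommGroup H]
    [InnerProductSpace ℂ H] [CompleteSpace H] (T ι : D →ₗ[ℂ] H)
    (hsymm : ∀ f g, inner ℂ (T f) (ι g) = inner ℂ (ι f) (T g)) {ϰ : ℝ} (hϰ : 0 < ϰ)
    (hpos : ∀ f, ϰ * ‖ι f‖ ^ 2 ≤ (inner ℂ (T f) (ι f)).re) :
    ∃ (V : Type u) (_ : NormedAddCommGroup V) (_ : InnerProductSpace ℂ V) (_ : CompleteSpace V)
      (e : D →ₗ[ℂ] V) (J : V →L[ℂ] H), DenseRange e ∧ (∀ f, J (e f) = ι f) ∧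
        ∀ f g, inner ℂ (e f) (e g) = inner ℂ (T f) (ι g) := by
  let c : PreInnerProductSpace.Core ℂ D :=
    { inner := fun f g => inner ℂ (T f) (ι g)
      conj_inner_symm := fun f g => by rw [inner_conj_symm, hsymm]
      re_inner_nonneg := fun f => le_trans (by positivity) (hpos f)
      add_left := fun f g h => by rw [map_add, inner_add_left]
      smul_left := fun f g r => by rw [map_smul, inner_smul_left] }
  let _ : SeminormedAddCommGroup D := @InnerProductSpace.Core.toSeminormedAddCommGroup ℂ D _ _ _ c
  let _ : InnerProductSpace ℂ D := InnerProductSpace.ofCore c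
  have hin : ∀ f g : D, inner ℂ f g = inner ℂ (T f) (ι g) := fun _ _ => rfl
  let e : D →ₗ[ℂ] UniformSpace.Completion D :=
    (UniformSpace.Completion.toComplₗᵢ : D →ₗᵢ[ℂ] UniformSpace.Completion D).toLinearMap
  have he : ∀ f, e f = (f : UniformSpace.Completion D) := fun _ => rfl
  have hd : DenseRange e := UniformSpace.Completion.denseRange_coe
  have hb : ∃ C, ∀ f, ‖ι f‖ ≤ C * ‖e f‖ := by
    -- Positive definiteness reads `ϰ ‖ι f‖² ≤ ‖e f‖²`, so `ι` is bounded for the form norm and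
    -- extends to the completion.
    refine ⟨√ϰ⁻¹, fun f => ?_⟩
    have h2 : ‖e f‖ = ‖f‖ := UniformSpace.Completion.norm_coe f
    rw [h2, norm_eq_sqrt_re_inner (𝕜 := ℂ) f, ← Real.sqrt_mul (by positivity)]
    refine Real.le_sqrt_of_sq_le ?_
    rw [inv_mul_eq_div, le_div_iff₀ hϰ, mul_comm]
    exact hpos f
  refine ⟨UniformSpace.Completion D, inferInstance, inferInstance, inferInstance, e,
    ι.extendOfNorm e, hd, fun f => LinearMap.extendOfNorm_eq hd hb f, fun f g => ?_⟩
  rw [he, he, UniformSpace.Completion.inner_coe, hin]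

variable {H : Type*} [NormedAddCommGroup H] [InnerProductSpace ℂ H] [CompleteSpace H]

theorem mem_adjoint_graph_iff {L₀ : H →ₗ.[ℂ] H} (hd : Dense (L₀.domain : Set H)) {y z : H} :
    (y, z) ∈ L₀.adjoint.graph ↔ ∀ f : L₀.domain, inner ℂ (L₀ f) y = inner ℂ (f : H) z := by
  rw [LinearPMap.adjoint_graph_eq_graph_adjoint hd, Submodule.mem_adjoint_iff]
  constructor
  · intro h f
    exact sub_eq_zero.1 (h f (L₀ f) (L₀.mem_graph f))
  · intro h a b hab
    obtain ⟨f, rfl, rfl⟩ := (LinearPMap.mem_graph_iff L₀).1 hab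
    exact sub_eq_zero.2 (h f)

theorem mem_friedrichs_graph_iff {L₀ : H →ₗ.[ℂ] H} {y z : H} :
    (y, z) ∈ (friedrichs L₀).graph ↔ (y, z) ∈ L₀.adjoint.graph ∧ y ∈ formDomain L₀ := by
  simp only [LinearPMap.mem_graph_iff]
  constructor
  · rintro ⟨⟨f, hf⟩, rfl, rfl⟩
    exact ⟨⟨⟨f, hf.2⟩, rfl, (LinearPMap.domRestrict_apply rfl).symm⟩, hf.1⟩
  · rintro ⟨⟨f, rfl, rfl⟩, h⟩
    exact ⟨⟨f, h, f.2⟩, rfl, LinearPMap.domRestrict_apply rfl⟩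

/-- The Friedrichs extension of a densely defined positive definite operator is boundedly
invertible, and its inverse is positive. -/
theorem exists_isBoundedInverse_friedrichs {L₀ : H →ₗ.[ℂ] H} (hd : Dense (L₀.domain : Set H))
    (hpos : IsPositiveDefinite L₀) :
    ∃ B : H →L[ℂ] H, 0 ≤ B ∧ (∀ y, (B y, y) ∈ L₀.adjoint.graph ∧ B y ∈ formDomain L₀) ∧
      ∀ y z, (y, z) ∈ L₀.adjoint.graph → y ∈ formDomain L₀ → B z = y := by
  obtain ⟨hsymm, ϰ, hϰ, hp⟩ := hpos
  obtain ⟨V, _, _, _, e, J, he, hJ, hin⟩ := exists_energySpace L₀.toFun L₀.domain.subtype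
    (fun f g => hsymm f g) hϰ hp
  have hin' : ∀ f g : L₀.domain, inner ℂ (e f) (e g) = inner ℂ (L₀ f) (g : H) := hin
  have hJ' : ∀ f : L₀.domain, J (e f) = (f : H) := hJ
  -- pairing with `L₀ f` factors through the energy space
  have hform : ∀ (f : L₀.domain) (ξ : V), inner ℂ (L₀ f) (J ξ) = inner ℂ (e f) ξ := by
    intro f ξ
    refine he.induction_on ξ (isClosed_eq (by fun_prop) (by fun_prop)) fun g => ?_
    rw [hJ', hin']
  -- Together with `hrange'` this identifies the form domain with the range of `J`.
  have hrange : ∀ ξ, J ξ ∈ formDomain L₀ := by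
    intro ξ
    obtain ⟨u, hu⟩ : ∃ u : ℕ → L₀.domain, Tendsto (fun n => e (u n)) atTop (𝓝 ξ) := by
      obtain ⟨x, hx, hx'⟩ := mem_closure_iff_seq_limit.1 (he ξ)
      choose u hu using hx
      exact ⟨u, by simpa only [hu] using hx'⟩
    refine Submodule.subset_span ⟨u, ?_, ?_⟩
    · simpa only [Function.comp_def, hJ'] using (J.continuous.tendsto ξ).comp hu
    · have h1 : Tendsto (fun p : ℕ × ℕ => e (u p.1) - e (u p.2)) atTop (𝓝 (ξ - ξ)) := by
        rw [← prod_atTop_atTop_eq]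
        exact (hu.comp tendsto_fst).sub (hu.comp tendsto_snd)
      rw [sub_self] at h1
      have h2 := h1.inner (𝕜 := ℂ) h1
      rw [inner_zero_left] at h2
      refine h2.congr fun p => ?_
      rw [← map_sub, hin']
  have hrange' : ∀ y ∈ formDomain L₀, ∃ ξ, J ξ = y := by
    intro y hy
    refine (Submodule.span_le (p := LinearMap.range (J : V →ₗ[ℂ] H))).2 ?_ hy
    rintro y ⟨u, hu, hc⟩
    have hcauchy : CauchySeq fun n => e (u n) := by
      rw [Metric.cauchySeq_iff]
      intro ε hε
      have h1 := (Metric.tendsto_nhds.1 hc) (ε ^ 2) (by positivity)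
      obtain ⟨⟨a, b⟩, h⟩ := eventually_atTop.1 h1
      refine ⟨max a b, fun m hm n hn => ?_⟩
      have h2 := h (m, n) ⟨(le_max_left _ _).trans hm, (le_max_right _ _).trans hn⟩
      rw [← hin', map_sub, dist_zero_right, inner_self_eq_norm_sq_to_K] at h2
      rw [dist_eq_norm]
      simp only [norm_pow, Complex.coe_algebraMap, Complex.norm_real, norm_norm] at h2
      exact lt_of_pow_lt_pow_left₀ 2 hε.le h2
    obtain ⟨ξ, hξ⟩ := cauchySeq_tendsto_of_complete hcauchy
    refine ⟨ξ, tendsto_nhds_unique ((J.continuous.tendsto ξ).comp hξ) ?_⟩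
    simpa only [Function.comp_def, hJ'] using hu
  -- One has `(L₀ f, J J* y) = (e f, J* y) = (f, y)`, the middle product being that of the energy
  -- space; so `L₀*` maps `J J* y` to `y`.
  refine ⟨J ∘L J.adjoint, ?_, fun y => ⟨?_, hrange _⟩, fun y z hy hy' => ?_⟩
  · rw [ContinuousLinearMap.nonneg_iff_isPositive]
    exact ContinuousLinearMap.isPositive_self_comp_adjoint J
  · rw [mem_adjoint_graph_iff hd]
    intro f
    rw [ContinuousLinearMap.comp_apply, hform, ContinuousLinearMap.adjoint_inner_right, hJ']
  · obtain ⟨ξ, rfl⟩ := hrange' y hy'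
    rw [mem_adjoint_graph_iff hd] at hy
    rw [ContinuousLinearMap.comp_apply]
    congr 1
    -- If `y = J ξ` and `L₀* y = z`, testing against the dense vectors `e f` gives `J* z = ξ`.
    refine he.eq_of_inner_left (𝕜 := ℂ) fun f => ?_
    rw [← inner_conj_symm, ContinuousLinearMap.adjoint_inner_right, hJ', ← hy f, hform,
      inner_conj_symm]

omit [CompleteSpace H] in
theorem boundedInverse_eq {L : H →ₗ.[ℂ] H} {B : H →L[ℂ] H} (hB : IsBoundedInverse L B) :
    boundedInverse L = B := by
  have h : ∃ B, IsBoundedInverse L B := ⟨B, hB⟩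
  rw [boundedInverse, dif_pos h]
  ext y
  obtain ⟨f, hf, hy⟩ := (LinearPMap.mem_graph_iff L).1 (h.choose_spec.1 y)
  exact hf.symm.trans ((hB.2 f).symm.trans (congrArg B hy))

/-- The characteristic properties of the inverse `B = L⁻¹` of the Friedrichs extension. -/
structure IsFriedrichsInverse (L₀ : H →ₗ.[ℂ] H) (B : H →L[ℂ] H) : Prop where
  dense : Dense (L₀.domain : Set H)
  nonneg : 0 ≤ B
  graph : ∀ y, (B y, y) ∈ L₀.adjoint.graph
  eq : ∀ y z, (y, z) ∈ L₀.adjoint.graph → y ∈ formDomain L₀ → B z = y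
  symm : L₀.IsFormalAdjoint L₀

theorem isFriedrichsInverse {L₀ : H →ₗ.[ℂ] H} (hd : Dense (L₀.domain : Set H))
    (hpos : IsPositiveDefinite L₀) :
    IsFriedrichsInverse L₀ (boundedInverse (friedrichs L₀)) := by
  obtain ⟨B, h0, h1, h2⟩ := exists_isBoundedInverse_friedrichs hd hpos
  have hB : IsBoundedInverse (friedrichs L₀) B := by
    refine ⟨fun y => mem_friedrichs_graph_iff.2 (h1 y), fun y => ?_⟩
    have := mem_friedrichs_graph_iff.1 ((friedrichs L₀).mem_graph y)
    exact h2 _ _ this.1 this.2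
  rw [boundedInverse_eq hB]
  exact ⟨hd, h0, fun y => (h1 y).1, h2, hpos.1⟩

namespace IsFriedrichsInverse

variable {L₀ : H →ₗ.[ℂ] H} {B : H →L[ℂ] H} (hB : IsFriedrichsInverse L₀ B)
include hB

theorem isSelfAdjoint : IsSelfAdjoint B := hB.nonneg.isSelfAdjoint

theorem inner_left_eq (x y : H) : inner ℂ (B x) y = inner ℂ x (B y) := by
  rw [← ContinuousLinearMap.adjoint_inner_right, hB.isSelfAdjoint.adjoint_eq]

theorem mem_adjoint_graph_of_mem {y z : H} (h : (y, z) ∈ L₀.graph) :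
    (y, z) ∈ L₀.adjoint.graph := by
  obtain ⟨f, rfl, rfl⟩ := (LinearPMap.mem_graph_iff L₀).1 h
  exact (mem_adjoint_graph_iff hB.dense).2 fun g => hB.symm g f

theorem eq_of_mem_graph {y z : H} (h : (y, z) ∈ L₀.graph) : B z = y := by
  refine hB.eq y z (hB.mem_adjoint_graph_of_mem h) ?_
  obtain ⟨f, rfl, rfl⟩ := (LinearPMap.mem_graph_iff L₀).1 h
  refine Submodule.subset_span ⟨fun _ => f, tendsto_const_nhds, ?_⟩
  simp

/-- `B` inverts an extension of `L₀`, so its range contains the dense domain of `L₀`. -/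
theorem denseRange : DenseRange B := by
  refine hB.dense.mono ?_
  intro y hy
  exact ⟨L₀ ⟨y, hy⟩, hB.eq_of_mem_graph (L₀.mem_graph ⟨y, hy⟩)⟩

end IsFriedrichsInverse

end Friedrichs

end WaveSpectrum

namespace WaveSpectrum

/-! ### Sine and cosine families in the functional calculus of the inverse -/

section SineCalculus

theorem abs_mul_sin_div_le (t σ : ℝ) : |σ * Real.sin (t / σ)| ≤ |t| := by
  rcases eq_or_ne σ 0 with rfl | h
  · simp
  · rw [abs_mul]
    calc |σ| * |Real.sin (t / σ)| ≤ |σ| * |t / σ| := mul_le_mul_of_nonneg_left Real.abs_sin_le_abs (abs_nonneg _)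
      _ = |t| := by rw [abs_div]; field_simp

/-- The factor `σ` damps the oscillation at `0`, so `cfc` is applied to a genuinely continuous
function and does not take its default value. -/
theorem continuous_mul_sin_div (t : ℝ) : Continuous fun σ : ℝ => σ * Real.sin (t / σ) := by
  rw [continuous_iff_continuousAt]
  intro σ
  rcases eq_or_ne σ 0 with rfl | h
  · have h0 : Tendsto (fun σ : ℝ => σ * Real.sin (t / σ)) (𝓝 0) (𝓝 0) := by
      refine squeeze_zero_norm (a := fun σ : ℝ => |σ|) (fun σ => ?_)
        (by simpa using (continuous_abs (G := ℝ)).tendsto 0)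
      rw [Real.norm_eq_abs, abs_mul]
      exact mul_le_of_le_one_right (abs_nonneg _) (Real.abs_sin_le_one _)
    simpa [ContinuousAt] using h0
  · exact continuousAt_id.mul
      (Real.continuous_sin.continuousAt.comp (continuousAt_const.div continuousAt_id h))

theorem continuous_mul_cos_div (t : ℝ) : Continuous fun σ : ℝ => σ * Real.cos (t / σ) := by
  rw [continuous_iff_continuousAt]
  intro σ
  rcases eq_or_ne σ 0 with rfl | h
  · have h0 : Tendsto (fun σ : ℝ => σ * Real.cos (t / σ)) (𝓝 0) (𝓝 0) := by
      refine squeeze_zero_norm (a := fun σ : ℝ => |σ|) (fun σ => ?_)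
        (by simpa using (continuous_abs (G := ℝ)).tendsto 0)
      rw [Real.norm_eq_abs, abs_mul]
      exact mul_le_of_le_one_right (abs_nonneg _) (Real.abs_cos_le_one _)
    simpa [ContinuousAt] using h0
  · exact continuousAt_id.mul
      (Real.continuous_cos.continuousAt.comp (continuousAt_const.div continuousAt_id h))

/-- A Taylor bound with a crude constant. Since it is global in `b`, it survives the scaling by `√s`
and controls difference quotients uniformly over the spectrum. -/
theorem abs_sin_add_sub_le (a b : ℝ) : |Real.sin (a + b) - Real.sin a - b * Real.cos a| ≤ b ^ 2 := by
  have h1 : Real.sin (a + b) - Real.sin a - b * Real.cos a =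
      Real.sin a * (Real.cos b - 1) + Real.cos a * (Real.sin b - b) := by
    rw [Real.sin_add]; ring
  have hc : |Real.cos b - 1| ≤ b ^ 2 / 2 := by
    rw [abs_le]
    constructor <;> nlinarith [Real.one_sub_sq_div_two_le_cos (x := b), Real.cos_le_one b]
  have hs : |Real.sin b - b| ≤ b ^ 2 / 2 := by
    have key : ∀ x : ℝ, 0 ≤ x → |Real.sin x - x| ≤ x ^ 2 / 2 := by
      intro x hx
      rw [abs_le]
      refine ⟨?_, by nlinarith [Real.sin_le hx]⟩
      rcases le_or_gt x 1 with h | h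
      · rcases hx.eq_or_lt with rfl | hx
        · simp
        · have := Real.sin_gt_sub_cube hx
          nlinarith [mul_nonneg (sq_nonneg x) (sub_nonneg.2 h), sq_nonneg x]
      -- Monotonicity: the derivative `y - 1 + cos y` is nonnegative, by `cos y ≥ 1 - y² / 2` up to
      -- `2` and by `cos y ≥ -1` beyond.
      · have h3 : 0 ≤ x ^ 2 / 2 - x + Real.sin x := by
          have hmono : MonotoneOn (fun y : ℝ => y ^ 2 / 2 - y + Real.sin y) (Ici 0) := by
            refine monotoneOn_of_deriv_nonneg (convex_Ici 0) (by fun_prop) (by fun_prop) ?_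
            intro y hy
            have hd : HasDerivAt (fun y : ℝ => y ^ 2 / 2 - y + Real.sin y) (y - 1 + Real.cos y) y := by
              have := (((hasDerivAt_id y).pow 2).div_const 2 |>.sub (hasDerivAt_id y)).add
                (Real.hasDerivAt_sin y)
              exact this.congr_deriv (by simp)
            rw [hd.deriv]
            rw [interior_Ici] at hy
            have hy' : (0 : ℝ) < y := hy
            rcases le_or_gt y 2 with h2 | h2
            · nlinarith [Real.one_sub_sq_div_two_le_cos (x := y)]
            · nlinarith [Real.neg_one_le_cos y]
          have := hmono (mem_Ici.2 le_rfl) (mem_Ici.2 hx) hx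
          simpa using this
        linarith
    rcases le_total 0 b with h | h
    · exact key b h
    · have := key (-b) (by linarith)
      rw [Real.sin_neg, neg_sq, ← abs_neg] at this
      convert this using 2
      ring
  rw [h1]
  calc _ ≤ |Real.sin a * (Real.cos b - 1)| + |Real.cos a * (Real.sin b - b)| := abs_add_le _ _
    _ ≤ 1 * (b ^ 2 / 2) + 1 * (b ^ 2 / 2) := by
        rw [abs_mul, abs_mul]
        gcongr
        · exact Real.abs_sin_le_one a
        · exact Real.abs_cos_le_one a
    _ = b ^ 2 := by ring

theorem abs_cos_add_sub_le (a b : ℝ) : |Real.cos (a + b) - Real.cos a + b * Real.sin a| ≤ b ^ 2 := by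
  have := abs_sin_add_sub_le (a + Real.pi / 2) b
  rw [show a + Real.pi / 2 + b = a + b + Real.pi / 2 by ring, Real.sin_add_pi_div_two,
    Real.sin_add_pi_div_two, Real.cos_add_pi_div_two] at this
  convert this using 2
  ring

theorem abs_sin_sub_sin_le (a b : ℝ) : |Real.sin a - Real.sin b| ≤ |a - b| := by
  have := Real.abs_sin_le_abs (x := (a - b) / 2)
  rw [Real.sin_sub_sin, abs_mul, abs_mul]
  have h2 := Real.abs_cos_le_one ((a + b) / 2)
  calc |(2 : ℝ)| * |Real.sin ((a - b) / 2)| * |Real.cos ((a + b) / 2)|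
      ≤ 2 * |(a - b) / 2| * 1 := by
        rw [abs_two]; gcongr
    _ = |a - b| := by rw [abs_div, abs_two]; ring

variable {H : Type*} [NormedAddCommGroup H] [InnerProductSpace ℂ H] [CompleteSpace H]

/-- `√B sin (t / √B)` for a positive operator `B`. -/
noncomputable def sineOf (B : H →L[ℂ] H) (t : ℝ) : H →L[ℂ] H :=
  cfc (fun s : ℝ => √s * Real.sin (t / √s)) B

/-- `B cos (t / √B)` for a positive operator `B`. -/
noncomputable def cosineOf (B : H →L[ℂ] H) (t : ℝ) : H →L[ℂ] H :=
  cfc (fun s : ℝ => √s * (√s * Real.cos (t / √s))) B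

theorem sineOp_eq (L : H →ₗ.[ℂ] H) (t : ℝ) : sineOp L t = sineOf (boundedInverse L) t := rfl

theorem continuous_sineFun (t : ℝ) : Continuous fun s : ℝ => √s * Real.sin (t / √s) :=
  (continuous_mul_sin_div t).comp Real.continuous_sqrt

theorem continuous_sqrt_mul_sqrt : Continuous fun s : ℝ => √s * √s :=
  Real.continuous_sqrt.mul Real.continuous_sqrt

theorem continuous_cosineFun (t : ℝ) : Continuous fun s : ℝ => √s * (√s * Real.cos (t / √s)) :=
  Real.continuous_sqrt.mul ((continuous_mul_cos_div t).comp Real.continuous_sqrt)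

variable {B : H →L[ℂ] H} (hB : 0 ≤ B)

theorem isSelfAdjoint_sineOf (t : ℝ) : IsSelfAdjoint (sineOf B t) := cfc_predicate _ _

theorem inner_sineOf (t : ℝ) (x y : H) :
    inner ℂ (sineOf B t x) y = inner ℂ x (sineOf B t y) := by
  rw [← ContinuousLinearMap.adjoint_inner_right, (isSelfAdjoint_sineOf t).adjoint_eq]

theorem sineOf_neg (t : ℝ) : sineOf B (-t) = -sineOf B t := by
  rw [sineOf, sineOf, ← cfc_neg]
  congr 1
  ext s
  rw [neg_div, Real.sin_neg, mul_neg]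

theorem sineOf_zero : sineOf B 0 = 0 := by
  have : (fun s : ℝ => √s * Real.sin (0 / √s)) = fun _ => 0 := by ext; simp
  rw [sineOf, this, cfc_const_zero]

theorem norm_sineOf_le (t : ℝ) : ‖sineOf B t‖ ≤ |t| :=
  norm_cfc_le (abs_nonneg t) fun s _ => abs_mul_sin_div_le t √s

include hB

theorem spectrum_nonneg_of_nonneg' {s : ℝ} (hs : s ∈ spectrum ℝ B) : 0 ≤ s :=
  spectrum_nonneg_of_nonneg hB hs

theorem eq_cfc_sqrt : B = cfc (fun s : ℝ => √s * √s) B := by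
  have hsa : IsSelfAdjoint B := hB.isSelfAdjoint
  conv_lhs => rw [← cfc_id' ℝ B]
  exact cfc_congr fun s hs => (Real.mul_self_sqrt (spectrum_nonneg_of_nonneg' hB hs)).symm

theorem cosineOf_zero : cosineOf B 0 = B := by
  conv_rhs => rw [eq_cfc_sqrt hB]
  rw [cosineOf]
  congr 1
  ext s
  simp

theorem commute_sineOf (t : ℝ) : Commute B (sineOf B t) := by
  have hsa : IsSelfAdjoint B := hB.isSelfAdjoint
  conv => arg 1; rw [← cfc_id' ℝ B]
  exact cfc_commute_cfc _ _ _

theorem apply_sineOf (t : ℝ) (y : H) : B (sineOf B t y) = sineOf B t (B y) :=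
  congrArg (fun A : H →L[ℂ] H => A y) (commute_sineOf hB t).eq

/-- The formula `2 sin a sin b = cos (a - b) - cos (a + b)`, carried through the functional
calculus. It later turns composition with a sine operator into averaging over time. -/
theorem sineOf_mul_sineOf (a b : ℝ) :
    (2 : ℝ) • (sineOf B a * sineOf B b) = cosineOf B (a - b) - cosineOf B (a + b) := by
  have hsa : IsSelfAdjoint B := hB.isSelfAdjoint
  rw [sineOf, sineOf, cosineOf, cosineOf,
    ← cfc_mul _ _ B (continuous_sineFun a).continuousOn (continuous_sineFun b).continuousOn,
    ← cfc_sub _ _ B (continuous_cosineFun _).continuousOn (continuous_cosineFun _).continuousOn,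
    ← cfc_smul (2 : ℝ) (fun s : ℝ => √s * Real.sin (a / √s) * (√s * Real.sin (b / √s))) B
      ((continuous_sineFun a).mul (continuous_sineFun b)).continuousOn]
  congr 1
  ext s
  rw [sub_div, add_div, Real.cos_sub, Real.cos_add, smul_eq_mul]
  ring

theorem norm_sineOf_sub_le (a b : ℝ) : ‖sineOf B a - sineOf B b‖ ≤ |a - b| := by
  have hsa : IsSelfAdjoint B := hB.isSelfAdjoint
  rw [sineOf, sineOf,
    ← cfc_sub _ _ B (continuous_sineFun a).continuousOn (continuous_sineFun b).continuousOn]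
  refine norm_cfc_le (abs_nonneg _) fun s _ => ?_
  rcases eq_or_ne (√s) 0 with h | h
  · simp [h]
  · rw [← mul_sub, norm_mul, Real.norm_eq_abs, Real.norm_eq_abs]
    calc |√s| * |Real.sin (a / √s) - Real.sin (b / √s)| ≤ |√s| * |a / √s - b / √s| := by
          exact mul_le_mul_of_nonneg_left (abs_sin_sub_sin_le _ _) (abs_nonneg _)
      _ = |a - b| := by rw [← sub_div, abs_div]; field_simp

theorem continuous_sineOf : Continuous (sineOf B) := by
  refine (LipschitzWith.of_dist_le_mul (K := 1) fun a b => ?_).continuous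
  rw [dist_eq_norm, Real.dist_eq, NNReal.coe_one, one_mul]
  exact norm_sineOf_sub_le hB a b

omit hB in
theorem hasDerivAt_of_norm_sub_le_sq {E : Type*} [NormedAddCommGroup E] [NormedSpace ℝ E]
    {f : ℝ → E} {f' : E} {x C : ℝ} (h : ∀ k, ‖f (x + k) - f x - k • f'‖ ≤ C * k ^ 2) :
    HasDerivAt f f' x := by
  rw [hasDerivAt_iff_isLittleO_nhds_zero]
  refine (Asymptotics.IsBigO.of_bound C (Eventually.of_forall fun k => ?_)).trans_isLittleO
    (Asymptotics.isLittleO_pow_id (n := 2) (by norm_num))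
  rw [Real.norm_of_nonneg (sq_nonneg k)]
  exact h k

/-- The weight `s` cancels the `(k / √s)²` of the Taylor remainder and leaves `k²` on the whole
spectrum, hence differentiability in operator norm. -/
theorem hasDerivAt_cosineOf (t : ℝ) : HasDerivAt (cosineOf B) (-sineOf B t) t := by
  have hsa : IsSelfAdjoint B := hB.isSelfAdjoint
  refine hasDerivAt_of_norm_sub_le_sq (C := 1) fun k => ?_
  rw [cosineOf, cosineOf, sineOf, ← cfc_neg,
    ← cfc_smul k (fun s : ℝ => -(√s * Real.sin (t / √s))) B
      (continuous_sineFun t).neg.continuousOn,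
    ← cfc_sub _ _ B (continuous_cosineFun _).continuousOn (continuous_cosineFun _).continuousOn,
    ← cfc_sub (fun s : ℝ => √s * (√s * Real.cos ((t + k) / √s)) - √s * (√s * Real.cos (t / √s)))
      (fun s : ℝ => k • -(√s * Real.sin (t / √s))) B
      ((continuous_cosineFun _).sub (continuous_cosineFun _)).continuousOn
      ((continuous_sineFun t).neg.const_smul k).continuousOn]
  refine norm_cfc_le (by positivity) fun s _ => ?_
  rcases eq_or_ne (√s) 0 with h | h
  · simp [h, sq_nonneg]
  · have h2 := abs_cos_add_sub_le (t / √s) (k / √s)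
    have e : √s * (√s * Real.cos ((t + k) / √s)) - √s * (√s * Real.cos (t / √s)) -
        k • -(√s * Real.sin (t / √s)) = (√s * √s) *
          (Real.cos (t / √s + k / √s) - Real.cos (t / √s) + k / √s * Real.sin (t / √s)) := by
      rw [add_div, smul_eq_mul]; field_simp; ring
    rw [e, norm_mul, Real.norm_eq_abs, Real.norm_eq_abs, abs_mul_self]
    calc _ ≤ √s * √s * (k / √s) ^ 2 := by gcongr
      _ = 1 * k ^ 2 := by field_simp

/-- Formally, `√s sin (t / √s)` has the derivative `cos (t / √s)`, which is discontinuous at `s =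
0`. One factor `B` repairs this: the remainder carries the weight `s^(3/2)` and becomes `√s k² ≤
√‖B‖ k²`. -/
theorem hasDerivAt_sineOf_mul (t : ℝ) : HasDerivAt (fun t => sineOf B t * B) (cosineOf B t) t := by
  have hsa : IsSelfAdjoint B := hB.isSelfAdjoint
  have e1 : ∀ t, sineOf B t * B =
      cfc (fun s : ℝ => √s * Real.sin (t / √s) * (√s * √s)) B := by
    intro t
    conv_lhs => rw [eq_cfc_sqrt hB, ← eq_cfc_sqrt hB, sineOf]
    conv_lhs => arg 2; rw [eq_cfc_sqrt hB]
    rw [← cfc_mul _ _ B (continuous_sineFun t).continuousOn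
      continuous_sqrt_mul_sqrt.continuousOn]
  simp only [e1]
  have hc : ∀ t, Continuous fun s : ℝ => √s * Real.sin (t / √s) * (√s * √s) := fun t =>
    (continuous_sineFun t).mul continuous_sqrt_mul_sqrt
  refine hasDerivAt_of_norm_sub_le_sq (C := √‖B‖) fun k => ?_
  rw [cosineOf, ← cfc_smul _ _ B (continuous_cosineFun t).continuousOn,
    ← cfc_sub _ _ B (hc _).continuousOn (hc _).continuousOn,
    ← cfc_sub (fun s : ℝ => √s * Real.sin ((t + k) / √s) * (√s * √s) -
        √s * Real.sin (t / √s) * (√s * √s)) (fun s : ℝ => k • (√s * (√s * Real.cos (t / √s)))) B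
      ((hc _).sub (hc _)).continuousOn ((continuous_cosineFun t).const_smul k).continuousOn]
  refine norm_cfc_le (by positivity) fun s hs => ?_
  rcases eq_or_ne (√s) 0 with h | h
  · simp only [h, zero_mul, sub_zero, smul_zero, norm_zero]; positivity
  · have h2 := abs_sin_add_sub_le (t / √s) (k / √s)
    have e : √s * Real.sin ((t + k) / √s) * (√s * √s) - √s * Real.sin (t / √s) * (√s * √s) -
        k • (√s * (√s * Real.cos (t / √s))) = (√s * √s * √s) *
          (Real.sin (t / √s + k / √s) - Real.sin (t / √s) - k / √s * Real.cos (t / √s)) := by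
      rw [add_div, smul_eq_mul]; field_simp
    have hsB : √s ≤ √‖B‖ := by
      refine Real.sqrt_le_sqrt ?_
      have := norm_apply_le_norm_cfc (fun s : ℝ => s) B hs
      rw [cfc_id' ℝ B] at this
      exact (le_abs_self s).trans this
    rw [e, norm_mul, Real.norm_eq_abs, Real.norm_eq_abs, abs_of_nonneg (by positivity)]
    calc _ ≤ √s * √s * √s * (k / √s) ^ 2 := by gcongr
      _ = √s * k ^ 2 := by field_simp
      _ ≤ √‖B‖ * k ^ 2 := by gcongr

theorem hasDerivAt_cosineOf_apply (t : ℝ) (y : H) :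
    HasDerivAt (fun t => cosineOf B t y) (-sineOf B t y) t :=
  (((ContinuousLinearMap.apply ℂ H y).restrictScalars ℝ).hasFDerivAt.comp_hasDerivAt t (hasDerivAt_cosineOf hB t) :)

theorem hasDerivAt_sineOf_apply (t : ℝ) (y : H) :
    HasDerivAt (fun t => sineOf B t (B y)) (cosineOf B t y) t :=
  (((ContinuousLinearMap.apply ℂ H y).restrictScalars ℝ).hasFDerivAt.comp_hasDerivAt t (hasDerivAt_sineOf_mul hB t) :)

/-- The sixth power of `√s sin (ε / √s)` is `s²` times `(√s sin (ε / √s))² sin⁴ (ε / √s)`. After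
four factors the quotient by `s²` would be the discontinuous `sin⁴`; the two extra factors make it
tend to `0`. -/
theorem exists_sineOf_pow_eq (ε : ℝ) (y : H) : ∃ z, (sineOf B ε ^ 6) y = B (B z) := by
  have hsa : IsSelfAdjoint B := hB.isSelfAdjoint
  have hc := (continuous_sineFun ε)
  have hs := continuous_sqrt_mul_sqrt
  have hsk : ∀ f : ℝ → ℝ, Continuous f → Continuous fun s : ℝ => √s * √s * f s :=
    fun f hf => hs.mul hf
  have hk : Continuous fun s : ℝ => (√s * Real.sin (ε / √s)) ^ 2 * Real.sin (ε / √s) ^ 4 := by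
    have h0 : Continuous fun σ : ℝ => (σ * Real.sin (ε / σ)) ^ 2 * Real.sin (ε / σ) ^ 4 := by
      rw [continuous_iff_continuousAt]
      intro σ
      rcases eq_or_ne σ 0 with rfl | h
      · have h0 : Tendsto (fun σ : ℝ => (σ * Real.sin (ε / σ)) ^ 2 * Real.sin (ε / σ) ^ 4)
            (𝓝 0) (𝓝 0) := by
          refine squeeze_zero_norm (a := fun σ : ℝ => (σ * Real.sin (ε / σ)) ^ 2) (fun σ => ?_) ?_
          · rw [norm_mul, norm_pow, norm_pow, Real.norm_eq_abs, sq_abs]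
            refine mul_le_of_le_one_right (sq_nonneg _) (pow_le_one₀ (abs_nonneg _) ?_)
            exact Real.abs_sin_le_one _
          · have := ((continuous_mul_sin_div ε).tendsto 0).pow 2
            simpa using this
        simpa [ContinuousAt] using h0
      · have : ContinuousAt (fun σ : ℝ => Real.sin (ε / σ)) σ :=
          Real.continuous_sin.continuousAt.comp (continuousAt_const.div continuousAt_id h)
        exact ((continuousAt_id.mul this).pow 2).mul (this.pow 4)
    exact h0.comp Real.continuous_sqrt
  refine ⟨cfc (fun s : ℝ => (√s * Real.sin (ε / √s)) ^ 2 * Real.sin (ε / √s) ^ 4) B y, ?_⟩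
  have e : sineOf B ε ^ 6 =
      B * (B * cfc (fun s : ℝ => (√s * Real.sin (ε / √s)) ^ 2 * Real.sin (ε / √s) ^ 4) B) := by
    have : ∀ A : H →L[ℂ] H, B * (B * A) = cfc (fun s : ℝ => √s * √s) B *
        (cfc (fun s : ℝ => √s * √s) B * A) := fun A => by rw [← eq_cfc_sqrt hB]
    rw [this, sineOf, ← cfc_pow _ _ _ hc.continuousOn, ← cfc_mul _ _ B hs.continuousOn
      hk.continuousOn, ← cfc_mul _ _ B hs.continuousOn (hsk _ hk).continuousOn]
    congr 1
    ext s
    ring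
  rw [e]
  rfl

/-- The operators `ε⁻¹ √B sin (ε / √B)` are contractions and converge to the identity on the dense
range of `B`, by differentiability at time `0`; hence they and their powers converge strongly
everywhere. They serve as mollifiers. -/
theorem tendsto_inv_smul_sineOf_pow (hd : DenseRange B) (n : ℕ) (y : H) :
    Tendsto (fun ε : ℝ => (ε ^ n)⁻¹ • (sineOf B ε ^ n) y) (𝓝[>] 0) (𝓝 y) := by
  have hbound : ∀ ε : ℝ, 0 < ε → ∀ x, ‖ε⁻¹ • sineOf B ε x‖ ≤ ‖x‖ := by
    intro ε hε x
    have h1 := (sineOf B ε).le_of_opNorm_le (norm_sineOf_le ε) x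
    rw [abs_of_pos hε] at h1
    rw [norm_smul, norm_inv, Real.norm_eq_abs, abs_of_pos hε, inv_mul_le_iff₀ hε]
    exact h1
  have h1 : ∀ y, Tendsto (fun ε : ℝ => ε⁻¹ • sineOf B ε y) (𝓝[>] 0) (𝓝 y) := by
    intro y
    rw [Metric.tendsto_nhds]
    intro δ hδ
    obtain ⟨_, ⟨z, rfl⟩, hz⟩ := Metric.mem_closure_iff.1 (hd y) (δ / 3) (by positivity)
    have h2 := (hasDerivAt_iff_tendsto_slope.1 (hasDerivAt_sineOf_apply hB 0 z))
    rw [cosineOf_zero hB] at h2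
    have h3 := (Metric.tendsto_nhds.1 (h2.mono_left (nhdsGT_le_nhdsNE 0))) (δ / 3) (by positivity)
    filter_upwards [h3, self_mem_nhdsWithin] with ε hε hε0
    rw [slope_def_module, sineOf_zero, sub_zero, zero_apply, sub_zero] at hε
    have h4 := hbound ε hε0 (y - B z)
    rw [map_sub, smul_sub] at h4
    rw [dist_eq_norm] at hz hε ⊢
    have e : ε⁻¹ • sineOf B ε y - y = (ε⁻¹ • sineOf B ε y - ε⁻¹ • sineOf B ε (B z)) +
      (ε⁻¹ • sineOf B ε (B z) - B z) - (y - B z) := by abel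
    rw [e]
    calc _ ≤ ‖ε⁻¹ • sineOf B ε y - ε⁻¹ • sineOf B ε (B z)‖ + ‖ε⁻¹ • sineOf B ε (B z) - B z‖ +
          ‖y - B z‖ := (norm_sub_le _ _).trans (add_le_add_left (norm_add_le _ _) _)
      _ < δ / 3 + δ / 3 + δ / 3 := by linarith
      _ = δ := by ring
  induction n with
  | zero => simp
  | succ n ih =>
    have h2 : Tendsto (fun ε : ℝ => ε⁻¹ • sineOf B ε ((ε ^ n)⁻¹ • (sineOf B ε ^ n) y - y))
        (𝓝[>] 0) (𝓝 0) := by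
      have h3 := (tendsto_sub_nhds_zero_iff.2 ih).norm
      rw [norm_zero] at h3
      refine squeeze_zero_norm' ?_ h3
      filter_upwards [self_mem_nhdsWithin] with ε hε using hbound ε hε _
    have h4 := h2.add (h1 y)
    rw [zero_add] at h4
    refine h4.congr fun ε => ?_
    rw [map_sub, smul_sub, sub_add_cancel, pow_succ', pow_succ', mul_inv, mul_smul]
    congr 1
    rw [← Complex.coe_smul, map_smul, Complex.coe_smul]
    rfl

end SineCalculus

end WaveSpectrum

namespace WaveSpectrum

/-! ### Uniqueness for systems in characteristic form -/

section Cauchy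

/-- One integration in the Picard scheme; dividing by the factorial makes the bound reproduce
itself. -/
theorem norm_le_pow_succ_of_deriv {f f' : ℝ → ℂ} {s K : ℝ} {m : ℕ} (hs : 0 ≤ s)
    (hf : ∀ σ ∈ Icc 0 s, HasDerivAt f (f' σ) σ) (h0 : f 0 = 0)
    (hb : ∀ σ ∈ Icc 0 s, ‖f' σ‖ ≤ K * σ ^ m / m.factorial) :
    ‖f s‖ ≤ K * s ^ (m + 1) / (m + 1).factorial := by
  refine image_norm_le_of_norm_deriv_right_le_deriv_boundary (f := f) (f' := f') (a := 0) (b := s)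
    (B := fun σ => K * σ ^ (m + 1) / (m + 1).factorial) (B' := fun σ => K * σ ^ m / m.factorial)
    (fun σ hσ => (hf σ hσ).continuousAt.continuousWithinAt)
    (fun σ hσ => (hf σ (Ico_subset_Icc_self hσ)).hasDerivWithinAt) (by simp [h0]) (fun σ => ?_)
    (fun σ hσ => hb σ (Ico_subset_Icc_self hσ)) (right_mem_Icc.2 hs)
  refine (((hasDerivAt_pow (m + 1) σ).const_mul K).div_const _).congr_deriv ?_
  rw [Nat.factorial_succ]
  push_cast
  have : (m.factorial : ℝ) ≠ 0 := by positivity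
  have h1 : (m : ℝ) + 1 ≠ 0 := by positivity
  field_simp

/-- Uniqueness for the Cauchy problem of a hyperbolic system in characteristic form, in a
characteristic triangle. The first argument is the direction of evolution. -/
theorem eq_zero_of_characteristic_system {R ρ₀ C M : ℝ} {v a b Q : ℝ → ℝ → ℂ}
    (hv : ∀ s ρ, 0 ≤ s → |ρ - ρ₀| + s < R →
      HasDerivAt (fun σ => v σ ρ) ((a s ρ + b s ρ) / 2) s)
    (ha : ∀ s ρ, 0 ≤ s → |ρ - ρ₀| + s < R →
      HasDerivAt (fun σ => a σ (ρ + s - σ)) (Q s ρ * v s ρ) s)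
    (hb : ∀ s ρ, 0 ≤ s → |ρ - ρ₀| + s < R →
      HasDerivAt (fun σ => b σ (ρ - s + σ)) (Q s ρ * v s ρ) s)
    (hv0 : ∀ ρ, |ρ - ρ₀| < R → v 0 ρ = 0) (ha0 : ∀ ρ, |ρ - ρ₀| < R → a 0 ρ = 0)
    (hb0 : ∀ ρ, |ρ - ρ₀| < R → b 0 ρ = 0)
    (hQ : ∀ s ρ, 0 ≤ s → |ρ - ρ₀| + s < R → ‖Q s ρ‖ ≤ C)
    (hM : ∀ s ρ, 0 ≤ s → |ρ - ρ₀| + s < R → ‖v s ρ‖ ≤ M) {s ρ : ℝ} (hs : 0 ≤ s)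
    (hρ : |ρ - ρ₀| + s < R) : v s ρ = 0 := by
  have hC : 0 ≤ C := (norm_nonneg _).trans (hQ s ρ hs hρ)
  -- Picard iteration: `a` and `b` are integrals of `Q v` along characteristics and `v` is an
  -- integral of their mean, so each round gains the factor `C s² / ((2n + 1)(2n + 2))`.
  have key : ∀ (n : ℕ) (s ρ : ℝ), 0 ≤ s → |ρ - ρ₀| + s < R →
      ‖v s ρ‖ ≤ M * C ^ n * s ^ (2 * n) / (2 * n).factorial := by
    intro n
    induction n with
    | zero => intro s ρ hs hρ; simpa using hM s ρ hs hρ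
    | succ n ih =>
      -- Following a characteristic back to the initial line never leaves the triangle.
      have hmem : ∀ s ρ σ : ℝ, σ ∈ Icc 0 s → |ρ - ρ₀| + s < R → |ρ + s - σ - ρ₀| + σ < R := by
        intro s ρ σ hσ h
        refine lt_of_le_of_lt ?_ h
        have h2 := abs_add_le (ρ - ρ₀) (s - σ)
        rw [abs_of_nonneg (sub_nonneg.2 hσ.2)] at h2
        rw [show ρ + s - σ - ρ₀ = ρ - ρ₀ + (s - σ) by ring]
        linarith
      have hmem' : ∀ s ρ σ : ℝ, σ ∈ Icc 0 s → |ρ - ρ₀| + s < R → |ρ - s + σ - ρ₀| + σ < R := by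
        intro s ρ σ hσ h
        refine lt_of_le_of_lt ?_ h
        have h2 := abs_sub (ρ - ρ₀) (s - σ)
        rw [abs_of_nonneg (sub_nonneg.2 hσ.2)] at h2
        rw [show ρ - s + σ - ρ₀ = ρ - ρ₀ - (s - σ) by ring]
        linarith
      have hQv : ∀ s ρ, 0 ≤ s → |ρ - ρ₀| + s < R →
          ‖Q s ρ * v s ρ‖ ≤ M * C ^ (n + 1) * s ^ (2 * n) / (2 * n).factorial := by
        intro s ρ hs hρ
        rw [norm_mul]
        calc ‖Q s ρ‖ * ‖v s ρ‖ ≤ C * (M * C ^ n * s ^ (2 * n) / (2 * n).factorial) :=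
              mul_le_mul (hQ s ρ hs hρ) (ih s ρ hs hρ) (norm_nonneg _) hC
          _ = _ := by ring
      have hA : ∀ s ρ, 0 ≤ s → |ρ - ρ₀| + s < R →
          ‖a s ρ‖ ≤ M * C ^ (n + 1) * s ^ (2 * n + 1) / (2 * n + 1).factorial := by
        intro s ρ hs hρ
        have := norm_le_pow_succ_of_deriv (f := fun σ => a σ (ρ + s - σ))
          (f' := fun σ => Q σ (ρ + s - σ) * v σ (ρ + s - σ)) (K := M * C ^ (n + 1)) (m := 2 * n) hs
          (fun σ hσ => by
            have := ha σ (ρ + s - σ) hσ.1 (hmem s ρ σ hσ hρ)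
            simpa only [sub_add_cancel] using this)
          (by
            have := hmem s ρ 0 ⟨le_rfl, hs⟩ hρ
            exact ha0 _ (by rwa [add_zero] at this))
          (fun σ hσ => hQv σ _ hσ.1 (hmem s ρ σ hσ hρ))
        simpa only [add_sub_cancel_right] using this
      have hB : ∀ s ρ, 0 ≤ s → |ρ - ρ₀| + s < R →
          ‖b s ρ‖ ≤ M * C ^ (n + 1) * s ^ (2 * n + 1) / (2 * n + 1).factorial := by
        intro s ρ hs hρ
        have := norm_le_pow_succ_of_deriv (f := fun σ => b σ (ρ - s + σ))
          (f' := fun σ => Q σ (ρ - s + σ) * v σ (ρ - s + σ)) (K := M * C ^ (n + 1)) (m := 2 * n) hs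
          (fun σ hσ => by
            have := hb σ (ρ - s + σ) hσ.1 (hmem' s ρ σ hσ hρ)
            simpa only [add_sub_cancel_right] using this)
          (by
            have := hmem' s ρ 0 ⟨le_rfl, hs⟩ hρ
            exact hb0 _ (by rwa [add_zero] at this))
          (fun σ hσ => hQv σ _ hσ.1 (hmem' s ρ σ hσ hρ))
        simpa only [sub_add_cancel] using this
      intro s ρ hs hρ
      have hlt : ∀ σ ∈ Icc 0 s, |ρ - ρ₀| + σ < R := fun σ hσ =>
        lt_of_le_of_lt (by linarith [hσ.2]) hρ
      refine norm_le_pow_succ_of_deriv (f := fun σ => v σ ρ) (f' := fun σ => (a σ ρ + b σ ρ) / 2)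
        (K := M * C ^ (n + 1)) (m := 2 * n + 1) hs (fun σ hσ => hv σ ρ hσ.1 (hlt σ hσ))
        (hv0 ρ (by linarith)) fun σ hσ => ?_
      rw [norm_div, Complex.norm_ofNat, div_le_iff₀ two_pos]
      calc ‖a σ ρ + b σ ρ‖ ≤ ‖a σ ρ‖ + ‖b σ ρ‖ := norm_add_le _ _
        _ ≤ _ := by linarith [hA σ ρ hσ.1 (hlt σ hσ), hB σ ρ hσ.1 (hlt σ hσ)]
  -- The bounds are `M` times the even terms of the exponential series at `√C s`.
  have hlim : Tendsto (fun n : ℕ => M * ((√C * s) ^ (2 * n) / (2 * n).factorial)) atTop (𝓝 0) := by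
    have h1 := (FloorSemiring.tendsto_pow_div_factorial_atTop (√C * s)).comp
      (tendsto_id.const_mul_atTop' (r := 2) two_pos)
    simpa using h1.const_mul M
  refine norm_le_zero_iff.1 (ge_of_tendsto' hlim fun n => (key n s ρ hs hρ).trans_eq ?_)
  rw [mul_pow, pow_mul √C, Real.sq_sqrt hC]
  ring

/-- Differentiation of `e (p σ) (X σ)` for a locally bounded family of evaluations `e`. -/
theorem hasDerivAt_eval {H : Type*} [NormedAddCommGroup H] [NormedSpace ℂ H]
    (e : H →ₗ[ℂ] (ℝ → ℂ)) (he : ∀ R : ℝ, ∃ C, ∀ x, |x| ≤ R → ∀ r, ‖e r x‖ ≤ C * ‖r‖)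
    {p : ℝ → H} {p' : H} {X : ℝ → ℝ} {c s : ℝ} {d : ℂ} (hp : HasDerivAt p p' s)
    (hX : HasDerivAt X c s) (hd : HasDerivAt (e (p s)) d (X s))
    (hc : ContinuousAt (e p') (X s)) :
    HasDerivAt (fun σ => e (p σ) (X σ)) (e p' (X s) + c * d) s := by
  have h1 : HasDerivAt (fun σ => e (p s) (X σ)) (c * d) s := by
    have := hd.scomp s hX
    simpa [Function.comp_def] using this
  -- The factor `σ - s` vanishes at `s`, so continuity of `e p'` suffices.
  have h2 : HasDerivAt (fun σ : ℝ => ((σ - s : ℝ) : ℂ) * e p' (X σ)) (e p' (X s)) s := by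
    rw [hasDerivAt_iff_tendsto_slope]
    have h3 : Tendsto (fun σ => e p' (X σ)) (𝓝[≠] s) (𝓝 (e p' (X s))) :=
      (hc.comp hX.continuousAt).tendsto.mono_left nhdsWithin_le_nhds
    refine h3.congr' ?_
    filter_upwards [self_mem_nhdsWithin] with σ hσ
    have : ((σ - s : ℝ) : ℂ) ≠ 0 := by
      rw [Complex.ofReal_ne_zero]; exact sub_ne_zero.2 hσ
    rw [slope_def_module, sub_self, Complex.ofReal_zero, zero_mul, sub_zero, ← Complex.coe_smul,
      smul_eq_mul, Complex.ofReal_inv, inv_mul_cancel_left₀ this]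
  -- The remainder is `o(σ - s)` in `H`, and the local bound on the evaluations keeps it so at the
  -- moving point `X σ`.
  have h3 : HasDerivAt (fun σ => e (p σ - p s - (σ - s) • p') (X σ)) 0 s := by
    obtain ⟨C, hC⟩ := he (|X s| + 1)
    rw [hasDerivAt_iff_isLittleO]
    have h4 := hp.isLittleO
    have h5 : (fun σ => e (p σ - p s - (σ - s) • p') (X σ)) =O[𝓝 s]
        fun σ => p σ - p s - (σ - s) • p' := by
      refine Asymptotics.IsBigO.of_bound C ?_
      have : ∀ᶠ σ in 𝓝 s, |X σ| < |X s| + 1 :=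
        (hX.continuousAt.abs).eventually (gt_mem_nhds (lt_add_one _))
      filter_upwards [this] with σ hσ using hC _ hσ.le _
    have h6 := h5.trans_isLittleO h4
    simpa using h6
  refine ((h1.add h2).add h3).congr_deriv (by ring) |>.congr_of_eventuallyEq
    (Eventually.of_forall fun σ => ?_)
  simp only [Pi.add_apply]
  rw [map_sub, map_sub, ← Complex.coe_smul, map_smul]
  simp only [Pi.sub_apply, Pi.smul_apply, smul_eq_mul]
  ring

end Cauchy

end WaveSpectrum

namespace WaveSpectrum

/-! ### The subspaces `L₂(E)` and their projections -/

section HalfLine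

theorem norm_sq_eq_integral (y : HalfLineL2) :
    ‖y‖ ^ 2 = ∫ x in Ioi (0 : ℝ), ‖y x‖ ^ 2 := by
  have h := L2.inner_def (𝕜 := ℂ) y y
  simp only [inner_self_eq_norm_sq_to_K] at h
  have h2 : ((‖y‖ ^ 2 : ℝ) : ℂ) = ((∫ x in Ioi (0 : ℝ), ‖y x‖ ^ 2 : ℝ) : ℂ) := by
    rw [← integral_complex_ofReal]
    simpa using h
  exact_mod_cast h2

theorem integrable_norm_sq (y : HalfLineL2) :
    Integrable (fun x => ‖y x‖ ^ 2) (volume.restrict (Ioi (0 : ℝ))) :=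
  (memLp_two_iff_integrable_sq_norm (Lp.aestronglyMeasurable y)).1 (Lp.memLp y)

theorem integral_norm_sq_eq_of_ae {y : HalfLineL2} {f : ℝ → ℂ}
    (h : y =ᵐ[volume.restrict (Ioi 0)] f) : ‖y‖ ^ 2 = ∫ x in Ioi (0 : ℝ), ‖f x‖ ^ 2 := by
  rw [norm_sq_eq_integral]
  refine integral_congr_ae ?_
  filter_upwards [h] with x hx
  rw [hx]

/-- Dominated convergence in `L₂(ℝ₊)`. -/
theorem tendsto_of_ae_tendsto {ι : Type*} {l : Filter ι} [l.IsCountablyGenerated]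
    {u : ι → HalfLineL2} {y g : HalfLineL2} {f : ι → ℝ → ℂ} {f₀ : ℝ → ℂ}
    (hu : ∀ i, u i =ᵐ[volume.restrict (Ioi 0)] f i) (hy : y =ᵐ[volume.restrict (Ioi 0)] f₀)
    (hb : ∀ i, ∀ᵐ x ∂volume.restrict (Ioi (0 : ℝ)), ‖f i x - f₀ x‖ ≤ ‖g x‖)
    (ht : ∀ᵐ x ∂volume.restrict (Ioi (0 : ℝ)), Tendsto (fun i => f i x) l (𝓝 (f₀ x))) :
    Tendsto u l (𝓝 y) := by
  rw [tendsto_iff_norm_sub_tendsto_zero]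
  have h2 : Tendsto (fun i => ‖u i - y‖ ^ 2) l (𝓝 0) := by
    have h3 : ∀ i, ‖u i - y‖ ^ 2 = ∫ x in Ioi (0 : ℝ), ‖f i x - f₀ x‖ ^ 2 := fun i =>
      integral_norm_sq_eq_of_ae ((Lp.coeFn_sub _ _).trans ((hu i).sub hy))
    simp only [h3]
    suffices Tendsto (fun i => ∫ x in Ioi (0 : ℝ), ‖f i x - f₀ x‖ ^ 2) l
        (𝓝 (∫ x in Ioi (0 : ℝ), (0 : ℝ))) by simpa using this
    refine tendsto_integral_filter_of_dominated_convergence (fun x => ‖g x‖ ^ 2)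
      (Eventually.of_forall fun i => ?_) (Eventually.of_forall fun i => ?_) (integrable_norm_sq g) ?_
    · exact (((Lp.aestronglyMeasurable _).congr (hu i)).sub
        ((Lp.aestronglyMeasurable _).congr hy)).norm.pow 2
    · filter_upwards [hb i] with x hx
      rw [Real.norm_of_nonneg (sq_nonneg _)]
      gcongr
    · filter_upwards [ht] with x hx
      have := ((hx.sub_const (f₀ x)).norm).pow 2
      simpa using this
  simpa using h2.sqrt

theorem mem_L2On_iff {E : Set ℝ} (hE : MeasurableSet E) {y : HalfLineL2} :
    y ∈ L2On E ↔ ∀ᵐ x ∂volume.restrict (Ioi (0 : ℝ)), x ∉ E → y x = 0 := by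
  change y =ᵐ[(volume.restrict (Ioi 0)).restrict Eᶜ] (0 : ℝ → ℂ) ↔ _
  rw [EventuallyEq, ae_restrict_iff' hE.compl]
  rfl

/-- Multiplication by the indicator function of `E`. -/
noncomputable def restrictTo {E : Set ℝ} (hE : MeasurableSet E) (y : HalfLineL2) : HalfLineL2 :=
  ((Lp.memLp y).indicator hE).toLp _

theorem coeFn_restrictTo {E : Set ℝ} (hE : MeasurableSet E) (y : HalfLineL2) :
    restrictTo hE y =ᵐ[volume.restrict (Ioi 0)] E.indicator y := MemLp.coeFn_toLp _

theorem restrictTo_mem {E : Set ℝ} (hE : MeasurableSet E) (y : HalfLineL2) :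
    restrictTo hE y ∈ L2On E := by
  rw [mem_L2On_iff hE]
  filter_upwards [coeFn_restrictTo hE y] with x hx hxE
  rw [hx, indicator_of_notMem hxE]

theorem inner_eq_zero_of_mem {E : Set ℝ} (hE : MeasurableSet E) {y z : HalfLineL2}
    (hy : y ∈ L2On E) (hz : z ∈ L2On Eᶜ) : inner ℂ y z = 0 := by
  rw [mem_L2On_iff hE] at hy
  rw [mem_L2On_iff hE.compl] at hz
  rw [L2.inner_def]
  refine integral_eq_zero_of_ae ?_
  filter_upwards [hy, hz] with x h1 h2
  by_cases hx : x ∈ E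
  · rw [h2 (not_not.2 hx), inner_zero_right]; rfl
  · rw [h1 hx, inner_zero_left]; rfl

theorem restrictTo_add_compl {E : Set ℝ} (hE : MeasurableSet E) (y : HalfLineL2) :
    y = restrictTo hE y + restrictTo hE.compl y := by
  refine Lp.ext ?_
  filter_upwards [coeFn_restrictTo hE y, coeFn_restrictTo hE.compl y,
    Lp.coeFn_add (restrictTo hE y) (restrictTo hE.compl y)] with x h1 h2 h3
  rw [h3, Pi.add_apply, h1, h2, indicator_self_add_compl_apply]

theorem L2On_orthogonal {E : Set ℝ} (hE : MeasurableSet E) :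
    (L2On E).orthogonal = L2On Eᶜ := by
  refine le_antisymm (fun y hy => ?_) fun z hz y hy => inner_eq_zero_of_mem hE hy hz
  have h1 : inner ℂ (restrictTo hE y) y = 0 := hy _ (restrictTo_mem hE y)
  have h2 : restrictTo hE y = 0 := by
    rw [restrictTo_add_compl hE y, inner_add_right, ← restrictTo_add_compl hE y,
      inner_eq_zero_of_mem hE (restrictTo_mem hE y) (restrictTo_mem hE.compl y), add_zero] at h1
    exact inner_self_eq_zero.1 h1
  rw [restrictTo_add_compl hE y, h2, zero_add]
  exact restrictTo_mem _ _

theorem starProjection_L2On {E : Set ℝ} (hE : MeasurableSet E) (y : HalfLineL2) :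
    (L2On E).toSubmodule.starProjection y = restrictTo hE y := by
  refine Submodule.eq_starProjection_of_mem_orthogonal' (restrictTo_mem hE y) ?_
    (restrictTo_add_compl hE y)
  have : restrictTo hE.compl y ∈ (L2On E).orthogonal := by
    rw [L2On_orthogonal hE]; exact restrictTo_mem _ _
  exact this

theorem coeFn_starProjection_L2On {E : Set ℝ} (hE : MeasurableSet E) (y : HalfLineL2) :
    (L2On E).toSubmodule.starProjection y =ᵐ[volume.restrict (Ioi 0)] E.indicator y := by
  rw [starProjection_L2On hE]
  exact coeFn_restrictTo hE y

theorem L2On_mono {E F : Set ℝ} (hE : MeasurableSet E) (hF : MeasurableSet F)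
    (h : ∀ᵐ x ∂volume.restrict (Ioi (0 : ℝ)), x ∈ E → x ∈ F) : L2On E ≤ L2On F := by
  intro y hy
  rw [mem_L2On_iff hE] at hy
  rw [mem_L2On_iff hF]
  filter_upwards [h, hy] with x h1 h2 h3 using h2 fun hx => h3 (h1 hx)

/-- An exponential vanishes nowhere; its truncation to `E` decides whether `L₂(E)` lies in `L₂(F)`,
that is, inclusion up to null sets. -/
theorem exists_ne_zero_halfLineL2 : ∃ y : HalfLineL2, ∀ᵐ x ∂volume.restrict (Ioi (0 : ℝ)), y x ≠ 0 := by
  have h1 : IntegrableOn (fun x : ℝ => Real.exp (-2 * x)) (Ioi 0) :=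
    integrableOn_exp_mul_Ioi (by norm_num) 0
  have h2 : MemLp (fun x : ℝ => (Real.exp (-x) : ℂ)) 2 (volume.restrict (Ioi (0 : ℝ))) := by
    have hc : Continuous fun x : ℝ => (Real.exp (-x) : ℂ) := by fun_prop
    rw [memLp_two_iff_integrable_sq_norm hc.aestronglyMeasurable]
    refine h1.congr (Eventually.of_forall fun x => ?_)
    simp only [Complex.norm_real, Real.norm_eq_abs, sq_abs, ← Real.exp_nsmul]
    congr 1
    simp
  refine ⟨h2.toLp _, ?_⟩
  filter_upwards [MemLp.coeFn_toLp h2] with x hx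
  rw [hx]
  exact_mod_cast (Real.exp_pos _).ne'

theorem L2On_le_iff {E F : Set ℝ} (hE : MeasurableSet E) (hF : MeasurableSet F) :
    L2On E ≤ L2On F ↔ ∀ᵐ x ∂volume.restrict (Ioi (0 : ℝ)), x ∈ E → x ∈ F := by
  refine ⟨fun h => ?_, L2On_mono hE hF⟩
  obtain ⟨y, hy⟩ := exists_ne_zero_halfLineL2
  have h1 := (mem_L2On_iff hF).1 (h (restrictTo_mem hE y))
  filter_upwards [h1, hy, coeFn_restrictTo hE y] with x h2 h3 h4 hxE
  by_contra hxF
  rw [h2 hxF, indicator_of_mem hxE] at h4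
  exact h3 h4.symm

theorem L2On_congr {E F : Set ℝ} (hE : MeasurableSet E) (hF : MeasurableSet F)
    (h : ∀ᵐ x ∂volume.restrict (Ioi (0 : ℝ)), (x ∈ E ↔ x ∈ F)) : L2On E = L2On F :=
  le_antisymm (L2On_mono hE hF (h.mono fun _ h => h.1)) (L2On_mono hF hE (h.mono fun _ h => h.2))

theorem L2On_univ : L2On univ = ⊤ := by
  refine top_le_iff.1 fun y _ => ?_
  rw [mem_L2On_iff MeasurableSet.univ]
  exact Eventually.of_forall fun x hx => absurd (mem_univ x) hx

theorem L2On_empty : L2On ∅ = ⊥ := by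
  refine le_bot_iff.1 fun y hy => ?_
  rw [mem_L2On_iff MeasurableSet.empty] at hy
  refine ClosedSubmodule.mem_bot.2 (Lp.ext ?_)
  filter_upwards [hy, Lp.coeFn_zero ℂ 2 (volume.restrict (Ioi (0 : ℝ)))] with x hx h0
  rw [hx (notMem_empty x), h0]; rfl

theorem L2On_inter {E F : Set ℝ} (hE : MeasurableSet E) (hF : MeasurableSet F) :
    L2On (E ∩ F) = L2On E ⊓ L2On F := by
  refine le_antisymm (le_inf ?_ ?_) fun y hy => ?_
  · exact L2On_mono (hE.inter hF) hE (Eventually.of_forall fun x h => h.1)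
  · exact L2On_mono (hE.inter hF) hF (Eventually.of_forall fun x h => h.2)
  · rw [mem_L2On_iff (hE.inter hF)]
    filter_upwards [(mem_L2On_iff hE).1 hy.1, (mem_L2On_iff hF).1 hy.2] with x h1 h2 h3
    by_cases hx : x ∈ E
    · exact h2 fun hx' => h3 ⟨hx, hx'⟩
    · exact h1 hx

/-- De Morgan: orthogonal complements turn the closed sum into an intersection. -/
theorem L2On_union {E F : Set ℝ} (hE : MeasurableSet E) (hF : MeasurableSet F) :
    L2On (E ∪ F) = L2On E ⊔ L2On F := by
  have h := ClosedSubmodule.sup_orthogonal (L2On Eᶜ) (L2On Fᶜ)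
  rw [← L2On_inter hE.compl hF.compl, L2On_orthogonal hE.compl, L2On_orthogonal hF.compl,
    L2On_orthogonal (hE.compl.inter hF.compl), compl_inter, compl_compl, compl_compl] at h
  exact h.symm

theorem L2On_eq_bot_iff {E : Set ℝ} (hE : MeasurableSet E) :
    L2On E = ⊥ ↔ ∀ᵐ x ∂volume.restrict (Ioi (0 : ℝ)), x ∉ E := by
  rw [← le_bot_iff, ← L2On_empty, L2On_le_iff hE MeasurableSet.empty]
  rfl

/-- Strong convergence of the projections follows from convergence of the sets. -/
theorem tendsto_starProjection_L2On {ι : Type*} {l : Filter ι} [l.IsCountablyGenerated]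
    {E : ι → Set ℝ} {F : Set ℝ} (hE : ∀ i, MeasurableSet (E i)) (hF : MeasurableSet F)
    (h : ∀ᵐ x ∂volume.restrict (Ioi (0 : ℝ)), ∀ᶠ i in l, (x ∈ E i ↔ x ∈ F)) (y : HalfLineL2) :
    Tendsto (fun i => (L2On (E i)).toSubmodule.starProjection y) l
      (𝓝 ((L2On F).toSubmodule.starProjection y)) := by
  refine tendsto_of_ae_tendsto (g := y) (fun i => coeFn_starProjection_L2On (hE i) y)
    (coeFn_starProjection_L2On hF y) (fun i => Eventually.of_forall fun x => ?_) ?_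
  · by_cases h1 : x ∈ E i <;> by_cases h2 : x ∈ F <;> simp [h1, h2]
  · filter_upwards [h] with x hx
    refine tendsto_const_nhds.congr' ?_
    filter_upwards [hx] with i hi
    by_cases h2 : x ∈ F
    · simp [h2, hi.2 h2]
    · rw [indicator_of_notMem h2, indicator_of_notMem fun h => h2 (hi.1 h)]

end HalfLine

/-! ### Boundaries of neighborhoods -/

section NullFrontier

/-- The neighborhoods of a subset of the line have null boundary. -/
theorem volume_frontier_thickening (t : ℝ) (S : Set ℝ) :
    volume (frontier (Metric.thickening t S)) = 0 := by
  rcases le_or_gt t 0 with ht | ht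
  · simp [Metric.thickening_of_nonpos ht]
  set Z := frontier (Metric.thickening t S) with hZ
  have hU : IsOpen (Metric.thickening t S) := Metric.isOpen_thickening
  -- A boundary point lies at distance exactly `t` from some `s` in the closure of `S`, and the
  -- interval of radius `t` about `s` contains no boundary point. So each boundary point is isolated
  -- in the boundary from one side, and there are only countably many such points.
  have hsub : Z ⊆ {x ∈ Z | 𝓝[Z ∩ Ioi x] x = ⊥} ∪ {x ∈ Z | 𝓝[Z ∩ Iio x] x = ⊥} := by
    intro z hz
    rw [hZ, hU.frontier_eq] at hz
    have hS : (closure S).Nonempty := by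
      by_contra h
      rw [not_nonempty_iff_eq_empty, closure_empty_iff] at h
      simp [h] at hz
    obtain ⟨s, hs, hzs⟩ := isClosed_closure.exists_infDist_eq_dist hS z
    have h1 : dist z s ≤ t := by
      rw [← hzs, Metric.infDist_closure]
      exact ENNReal.toReal_le_of_le_ofReal ht.le
        (Metric.closure_thickening_subset_cthickening t S hz.1)
    have h2 : t ≤ dist z s := by
      refine not_lt.1 fun h => hz.2 ?_
      rw [← Metric.thickening_closure]
      exact Metric.mem_thickening_iff.2 ⟨s, hs, h⟩
    have hI : ∀ x, |x - s| < t → x ∉ Z := fun x hx hxZ => by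
      rw [hZ, hU.frontier_eq] at hxZ
      refine hxZ.2 ?_
      rw [← Metric.thickening_closure]
      exact Metric.mem_thickening_iff.2 ⟨s, hs, by rwa [Real.dist_eq]⟩
    have h3 : |z - s| = t := le_antisymm h1 h2
    have hz' : z ∈ Z := by rwa [hZ, hU.frontier_eq]
    rcases le_or_gt z s with h | h
    · refine Or.inl ⟨hz', empty_mem_iff_bot.1 ?_⟩
      rw [abs_of_nonpos (by linarith)] at h3
      refine mem_nhdsWithin.2 ⟨Iio s, isOpen_Iio, mem_Iio.2 (by linarith), ?_⟩
      rintro x ⟨hx, hxZ, hxz⟩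
      rw [mem_Iio] at hx
      rw [mem_Ioi] at hxz
      exact hI x (by rw [abs_lt]; constructor <;> linarith) hxZ
    · refine Or.inr ⟨hz', empty_mem_iff_bot.1 ?_⟩
      rw [abs_of_pos (by linarith)] at h3
      refine mem_nhdsWithin.2 ⟨Ioi s, isOpen_Ioi, mem_Ioi.2 (by linarith), ?_⟩
      rintro x ⟨hx, hxZ, hxz⟩
      rw [mem_Ioi] at hx
      rw [mem_Iio] at hxz
      exact hI x (by rw [abs_lt]; constructor <;> linarith) hxZ
  refine measure_mono_null hsub (Countable.measure_zero ?_ _)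
  exact countable_setOfPred_isolated_right_within.union countable_setOfPred_isolated_left_within

end NullFrontier

end WaveSpectrum

namespace WaveSpectrum

/-! ### Eikonals of the point atoms and their distance -/

section Eikonal

/-- A uniform partition with mesh below both thresholds compares the two limits. -/
theorem HasStieltjesIntegral.unique {H : Type*} [NormedAddCommGroup H] [InnerProductSpace ℂ H]
    [CompleteSpace H] {ω : ℝ≥0 → ClosedSubmodule ℂ H} {T : ℝ≥0} {y z z' : H}
    (h : HasStieltjesIntegral ω T y z) (h' : HasStieltjesIntegral ω T y z') : z = z' := by
  rw [← sub_eq_zero, ← norm_le_zero_iff]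
  refine le_of_forall_pos_lt_add fun ε hε => ?_
  obtain ⟨δ, hδ, H1⟩ := h (ε / 2) (half_pos hε)
  obtain ⟨δ', hδ', H2⟩ := h' (ε / 2) (half_pos hε)
  obtain ⟨n, hn⟩ := exists_nat_gt ((T : ℝ) / min δ δ')
  have hm : 0 < min δ δ' := lt_min hδ hδ'
  have hn0 : (0 : ℝ) < n := lt_of_le_of_lt (by positivity) hn
  set t : ℕ → ℝ≥0 := fun i => T * i / n with ht
  have h0 : t 0 = 0 := by simp [ht]
  have hT : t n = T := by
    have : (n : ℝ≥0) ≠ 0 := by exact_mod_cast hn0.ne'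
    simp only [ht]
    field_simp
  have hle : ∀ i, t i ≤ t (i + 1) := fun i => by
    simp only [ht]
    push_cast
    gcongr
    exact le_self_add
  have hmesh : ∀ i, (t (i + 1) : ℝ) - t i < min δ δ' := fun i => by
    have : (t (i + 1) : ℝ) - t i = T / n := by
      simp only [ht]
      push_cast
      ring
    rw [this, div_lt_iff₀ hn0]
    rw [div_lt_iff₀ hm] at hn
    linarith
  have e1 := H1 n t t h0 hT fun i _ => ⟨le_rfl, hle i, (hmesh i).trans_le (min_le_left _ _)⟩
  have e2 := H2 n t t h0 hT fun i _ => ⟨le_rfl, hle i, (hmesh i).trans_le (min_le_right _ _)⟩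
  rw [zero_add]
  rw [norm_sub_rev] at e1
  have := (norm_add_le _ _).trans_lt (add_lt_add e1 e2)
  rwa [sub_add_sub_cancel, add_halves] at this

theorem measurableSet_halfLineBall (x r : ℝ≥0) : MeasurableSet (halfLineBall x r) :=
  (measurableSet_le measurable_const measurable_id).inter
    (measurableSet_lt (f := fun y : ℝ => |y - x|) (by fun_prop) measurable_const)

-- For fixed `ρ` the function `t ↦ 1_{ρ < t}` jumps once, so the Stieltjes sum collapses to the tag
-- of the one interval containing `ρ`, which is within the mesh of `ρ`.
open scoped Classical in
theorem abs_riemannSum_sub_le {δ : ℝ} {ρ : ℝ} (hρ : 0 ≤ ρ) {t ξ : ℕ → ℝ≥0} (h0 : t 0 = 0)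
    (n : ℕ) (h : ∀ i < n, t i ≤ ξ i ∧ ξ i ≤ t (i + 1) ∧ (t (i + 1) : ℝ) - t i < δ) :
    ((t n : ℝ) ≤ ρ → ∑ i ∈ Finset.range n, (ξ i : ℝ) *
      ((if ρ < t (i + 1) then 1 else 0) - (if ρ < t i then 1 else 0)) = 0) ∧
    (ρ < t n → |∑ i ∈ Finset.range n, (ξ i : ℝ) *
      ((if ρ < t (i + 1) then 1 else 0) - (if ρ < t i then 1 else 0)) - ρ| ≤ δ) := by
  induction n with
  | zero => simp [h0, hρ.not_gt]
  | succ n ih =>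
    obtain ⟨ih1, ih2⟩ := ih fun i hi => h i (hi.trans (Nat.lt_succ_self n))
    obtain ⟨h1, h2, h3⟩ := h n (Nat.lt_succ_self n)
    have h1' : (t n : ℝ) ≤ ξ n := h1
    have h2' : (ξ n : ℝ) ≤ t (n + 1) := h2
    rw [Finset.sum_range_succ]
    constructor
    · intro h4
      rw [ih1 (h1'.trans (h2'.trans h4)), if_neg h4.not_gt,
        if_neg (h1'.trans (h2'.trans h4)).not_gt]
      simp
    · intro h4
      rw [if_pos h4]
      rcases lt_or_ge ρ (t n) with h5 | h5
      · rw [if_pos h5, sub_self, mul_zero, add_zero]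
        exact ih2 h5
      · rw [if_neg h5.not_gt, ih1 h5, zero_add, sub_zero, mul_one, abs_le]
        constructor <;> linarith

/-- The projections are multiplications by indicators, so at almost every `s` the operator sum is
the scalar sum of `abs_riemannSum_sub_le` with `ρ = |s - x|`. A pointwise error at most `δ` gives a
norm error at most `δ ‖y‖`. -/
theorem hasStieltjesIntegral_pointAtom {x T : ℝ≥0} {y z : HalfLineL2}
    (hz : z =ᵐ[volume.restrict (Ioi 0)]
      (halfLineBall x T).indicator fun ξ => ((|ξ - x| : ℝ) : ℂ) * y ξ) :
    HasStieltjesIntegral (pointAtom x) T y z := by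
  classical
  intro ε hε
  refine ⟨ε / (‖y‖ + 1), by positivity, fun n t ξ h0 hT h => ?_⟩
  have hbound : ‖(∑ i ∈ Finset.range n, ((ξ i : ℝ) : ℂ) •
      ((pointAtom x (t (i + 1))).toSubmodule.starProjection y -
      (pointAtom x (t i)).toSubmodule.starProjection y)) - z‖ ≤ ε / (‖y‖ + 1) * ‖y‖ := by
    refine Lp.norm_le_mul_norm_of_ae_le_mul ?_
    have hsum : ∀ m : ℕ, (∑ i ∈ Finset.range m, ((ξ i : ℝ) : ℂ) •
        ((pointAtom x (t (i + 1))).toSubmodule.starProjection y -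
        (pointAtom x (t i)).toSubmodule.starProjection y) : HalfLineL2)
        =ᵐ[volume.restrict (Ioi 0)] fun s => ((∑ i ∈ Finset.range m, (ξ i : ℝ) *
      ((if |s - x| < t (i + 1) then 1 else 0) - (if |s - x| < t i then 1 else 0)) : ℝ) : ℂ) *
        y s := by
      intro m
      induction m with
      | zero =>
        simp only [Finset.range_zero, Finset.sum_empty, Complex.ofReal_zero, zero_mul]
        exact Lp.coeFn_zero _ _ _
      | succ m ih =>
        simp only [Finset.sum_range_succ]
        filter_upwards [Lp.coeFn_add (∑ i ∈ Finset.range m, ((ξ i : ℝ) : ℂ) •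
          ((pointAtom x (t (i + 1))).toSubmodule.starProjection y -
          (pointAtom x (t i)).toSubmodule.starProjection y)) (((ξ m : ℝ) : ℂ) •
          ((pointAtom x (t (m + 1))).toSubmodule.starProjection y -
          (pointAtom x (t m)).toSubmodule.starProjection y)), ih,
          Lp.coeFn_smul ((ξ m : ℝ) : ℂ) ((pointAtom x (t (m + 1))).toSubmodule.starProjection y -
          (pointAtom x (t m)).toSubmodule.starProjection y),
          Lp.coeFn_sub ((pointAtom x (t (m + 1))).toSubmodule.starProjection y)
          ((pointAtom x (t m)).toSubmodule.starProjection y),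
          coeFn_starProjection_L2On (measurableSet_halfLineBall x (t (m + 1))) y,
          coeFn_starProjection_L2On (measurableSet_halfLineBall x (t m)) y,
          ae_restrict_mem measurableSet_Ioi] with s h1 h2 h3 h4 h5 h6 h7
        have h7' : 0 ≤ s := le_of_lt h7
        have hb : ∀ r, (s ∈ halfLineBall x r ↔ |s - x| < r) := fun r => and_iff_right h7'
        rw [h1, Pi.add_apply, h2, h3, Pi.smul_apply, h4, Pi.sub_apply]
        have h8 : ∀ r, (halfLineBall x r).indicator (y : ℝ → ℂ) s =
            (if |s - x| < r then (1 : ℂ) else 0) * y s := fun r => by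
          by_cases hr : |s - x| < r
          · rw [indicator_of_mem ((hb r).2 hr), if_pos hr, one_mul]
          · rw [indicator_of_notMem fun h => hr ((hb r).1 h), if_neg hr, zero_mul]
        rw [pointAtom, pointAtom, h5, h6, h8, h8]
        push_cast
        simp only [smul_eq_mul, apply_ite Complex.ofReal, Complex.ofReal_one, Complex.ofReal_zero]
        ring
    filter_upwards [Lp.coeFn_sub (∑ i ∈ Finset.range n, ((ξ i : ℝ) : ℂ) •
      ((pointAtom x (t (i + 1))).toSubmodule.starProjection y -
      (pointAtom x (t i)).toSubmodule.starProjection y)) z, hsum n, hz,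
      ae_restrict_mem measurableSet_Ioi] with s h1 h2 h3 h4
    have h4' : 0 ≤ s := le_of_lt h4
    rw [h1, Pi.sub_apply, h2, h3]
    have key := abs_riemannSum_sub_le (abs_nonneg (s - x)) h0 n h
    rw [hT] at key
    by_cases hr : |s - x| < T
    · rw [indicator_of_mem (show s ∈ halfLineBall x T from ⟨h4', hr⟩), ← sub_mul, norm_mul,
        ← Complex.ofReal_sub, Complex.norm_real, Real.norm_eq_abs]
      exact mul_le_mul_of_nonneg_right (key.2 hr) (norm_nonneg _)
    · rw [indicator_of_notMem fun h : s ∈ halfLineBall x T => hr h.2, key.1 (not_lt.1 hr)]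
      simp only [Complex.ofReal_zero, zero_mul, sub_zero, norm_zero]
      positivity
  refine hbound.trans_lt ?_
  rw [div_mul_eq_mul_div, div_lt_iff₀ (by positivity)]
  nlinarith [norm_nonneg y]

theorem exists_hasStieltjesIntegral_pointAtom (x T : ℝ≥0) (y : HalfLineL2) :
    ∃ z : HalfLineL2, z =ᵐ[volume.restrict (Ioi 0)]
      (halfLineBall x T).indicator fun ξ => ((|ξ - x| : ℝ) : ℂ) * y ξ := by
  have hm : MemLp ((halfLineBall x T).indicator fun ξ => ((|ξ - x| : ℝ) : ℂ) * y ξ) 2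
      (volume.restrict (Ioi 0)) := by
    refine MemLp.of_le_mul (c := T) (Lp.memLp y) ?_ (Eventually.of_forall fun s => ?_)
    · refine AEStronglyMeasurable.indicator ?_ (measurableSet_halfLineBall x T)
      refine AEStronglyMeasurable.mul ?_ (Lp.aestronglyMeasurable y)
      exact Continuous.aestronglyMeasurable (by fun_prop)
    · by_cases h : s ∈ halfLineBall x T
      · rw [indicator_of_mem h, norm_mul, Complex.norm_real, Real.norm_eq_abs, abs_abs]
        exact mul_le_mul_of_nonneg_right h.2.le (norm_nonneg _)
      · rw [indicator_of_notMem h, norm_zero]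
        positivity
  exact ⟨hm.toLp _, MemLp.coeFn_toLp hm⟩

/-- The eikonal of the atom `ω_x` is multiplication by `|ξ - x|`. -/
theorem mem_eikonalGraph_pointAtom_iff {x : ℝ≥0} {y z : HalfLineL2} :
    (y, z) ∈ eikonalGraph (pointAtom x) ↔
      z =ᵐ[volume.restrict (Ioi 0)] fun ξ => ((|ξ - x| : ℝ) : ℂ) * y ξ := by
  constructor
  · rintro ⟨Z, hZ, hl⟩
    have hZ' : ∀ T, Z T =ᵐ[volume.restrict (Ioi 0)]
        (halfLineBall x T).indicator fun ξ => ((|ξ - x| : ℝ) : ℂ) * y ξ := by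
      intro T
      obtain ⟨z', hz'⟩ := exists_hasStieltjesIntegral_pointAtom x T y
      rw [(hZ T).unique (hasStieltjesIntegral_pointAtom hz')]
      exact hz'
    -- Truncation to radius `R` recovers `Z R`, because every later `Z T` agrees with it there.
    -- Integer radii suffice, which leaves countably many null sets.
    have h1 : ∀ R : ℕ, restrictTo (measurableSet_halfLineBall x R) z = Z R := by
      intro R
      have h2 := (((L2On (halfLineBall x R)).toSubmodule.starProjection).continuous.tendsto z).comp hl
      simp only [starProjection_L2On (measurableSet_halfLineBall x R)] at h2
      refine tendsto_nhds_unique h2 (tendsto_const_nhds.congr' ?_)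
      filter_upwards [eventually_ge_atTop (R : ℝ≥0)] with T hT
      simp only [Function.comp_apply, starProjection_L2On (measurableSet_halfLineBall x R)]
      refine Lp.ext ?_
      filter_upwards [hZ' R, hZ' T, coeFn_restrictTo (measurableSet_halfLineBall x R) (Z T)]
        with s h1 h2 h3
      rw [h1, h3]
      by_cases h : s ∈ halfLineBall x R
      · have h' : s ∈ halfLineBall x T := ⟨h.1, h.2.trans_le hT⟩
        rw [indicator_of_mem h, indicator_of_mem h, h2, indicator_of_mem h']
      · rw [indicator_of_notMem h, indicator_of_notMem h]
    have h2 : ∀ᵐ s ∂volume.restrict (Ioi (0 : ℝ)), ∀ R : ℕ,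
        (halfLineBall x R).indicator z s =
          (halfLineBall x R).indicator (fun ξ => ((|ξ - x| : ℝ) : ℂ) * y ξ) s := by
      rw [ae_all_iff]
      intro R
      filter_upwards [coeFn_restrictTo (measurableSet_halfLineBall x R) z, hZ' R] with s h3 h4
      rw [← h3, h1 R, h4]
    filter_upwards [h2, ae_restrict_mem measurableSet_Ioi] with s h3 h4
    obtain ⟨R, hR⟩ := exists_nat_gt |s - x|
    have h5 : s ∈ halfLineBall x R := ⟨le_of_lt h4, by simpa using hR⟩
    have := h3 R
    rwa [indicator_of_mem h5, indicator_of_mem h5] at this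
  · intro hz
    refine ⟨fun T => restrictTo (measurableSet_halfLineBall x T) z, fun T => ?_, ?_⟩
    · refine hasStieltjesIntegral_pointAtom ((coeFn_restrictTo _ _).trans ?_)
      filter_upwards [hz] with s hs
      by_cases h : s ∈ halfLineBall x T
      · rw [indicator_of_mem h, indicator_of_mem h, hs]
      · rw [indicator_of_notMem h, indicator_of_notMem h]
    · have h1 := tendsto_starProjection_L2On (l := atTop) (E := fun T : ℝ≥0 => halfLineBall x T)
        (F := univ) (fun T => measurableSet_halfLineBall x T) MeasurableSet.univ (by
          filter_upwards [ae_restrict_mem measurableSet_Ioi] with s hs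
          filter_upwards [eventually_gt_atTop (Real.toNNReal |s - x|)] with T hT
          refine iff_of_true ⟨le_of_lt hs, ?_⟩ (mem_univ s)
          exact (Real.toNNReal_lt_iff_lt_coe (abs_nonneg _)).1 hT) z
      have h2 : (L2On univ).toSubmodule.starProjection z = z := by
        rw [Submodule.starProjection_eq_self_iff, L2On_univ]
        trivial
      rw [h2] at h1
      refine h1.congr fun T => ?_
      rw [starProjection_L2On (measurableSet_halfLineBall x T)]

/-- `Submodule.toLinearPMap` keeps the given graph only if it is single-valued; here it is the graph
of a multiplication operator. -/
theorem eikonal_graph_pointAtom (x : ℝ≥0) :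
    (eikonal (pointAtom x)).graph = eikonalGraph (pointAtom x) := by
  refine Submodule.toLinearPMap_graph_eq _ ?_
  rintro ⟨y, z⟩ h (hy : y = 0)
  rw [mem_eikonalGraph_pointAtom_iff] at h
  change z = 0
  refine Lp.ext (h.trans ?_)
  filter_upwards [Lp.coeFn_zero ℂ 2 (volume.restrict (Ioi (0 : ℝ)))] with s hs
  rw [hy, hs]
  simp

theorem coeFn_eikonal_pointAtom (x : ℝ≥0) (y : (eikonal (pointAtom x)).domain) :
    eikonal (pointAtom x) y =ᵐ[volume.restrict (Ioi 0)]
      fun ξ => ((|ξ - x| : ℝ) : ℂ) * (y : HalfLineL2) ξ := by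
  rw [← mem_eikonalGraph_pointAtom_iff, ← eikonal_graph_pointAtom]
  exact LinearPMap.mem_graph _ y

theorem mem_domain_eikonal_pointAtom {x : ℝ≥0} {y z : HalfLineL2}
    (h : z =ᵐ[volume.restrict (Ioi 0)] fun ξ => ((|ξ - x| : ℝ) : ℂ) * y ξ) :
    y ∈ (eikonal (pointAtom x)).domain := by
  rw [← mem_eikonalGraph_pointAtom_iff, ← eikonal_graph_pointAtom] at h
  exact LinearPMap.mem_domain_of_mem_graph h

theorem coeFn_eikonal_sub (x x' : ℝ≥0)
    (y : (eikonal (pointAtom x) - eikonal (pointAtom x')).domain) :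
    (eikonal (pointAtom x) - eikonal (pointAtom x')) y =ᵐ[volume.restrict (Ioi 0)]
      fun ξ => ((|ξ - x| - |ξ - x'| : ℝ) : ℂ) * (y : HalfLineL2) ξ := by
  rw [LinearPMap.sub_apply]
  filter_upwards [Lp.coeFn_sub (eikonal (pointAtom x) ⟨y, y.2.1⟩)
    (eikonal (pointAtom x') ⟨y, y.2.2⟩), coeFn_eikonal_pointAtom x ⟨y, y.2.1⟩,
    coeFn_eikonal_pointAtom x' ⟨y, y.2.2⟩] with s h1 h2 h3
  rw [h1, Pi.sub_apply, h2, h3]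
  push_cast
  ring

/-- The eikonal distance of the atoms is the distance on the half-line. -/
theorem eikonalDist_pointAtom (x x' : ℝ≥0) :
    eikonalDist (pointAtom x) (pointAtom x') = edist x x' := by
  have hd : edist x x' = ENNReal.ofReal |(x : ℝ) - x'| := by
    rw [edist_dist, NNReal.dist_eq]
  rw [hd]
  refine le_antisymm (iSup₂_le fun y hy => ?_) ?_
  · rw [← ofReal_norm]
    refine ENNReal.ofReal_le_ofReal ?_
    have h1 : ‖(eikonal (pointAtom x) - eikonal (pointAtom x')) y‖ ≤
        |(x : ℝ) - x'| * ‖(y : HalfLineL2)‖ := by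
      refine Lp.norm_le_mul_norm_of_ae_le_mul ?_
      filter_upwards [coeFn_eikonal_sub x x' y] with s hs
      rw [hs, norm_mul, Complex.norm_real, Real.norm_eq_abs]
      refine mul_le_mul_of_nonneg_right ?_ (norm_nonneg _)
      have := abs_abs_sub_abs_le_abs_sub (s - x) (s - x')
      rwa [sub_sub_sub_cancel_left, abs_sub_comm (x' : ℝ)] at this
    exact h1.trans (mul_le_of_le_one_right (abs_nonneg _) hy)
  -- To the right of both points the difference of the two multipliers is the constant `x' - x`, so
  -- the unit indicator of `(M, M + 1]` attains the norm.
  · set M : ℝ≥0 := max x x' with hM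
    set E : Set ℝ := Ioc (M : ℝ) (M + 1) with hE
    have hvol : (volume.restrict (Ioi (0 : ℝ))) E = 1 := by
      rw [Measure.restrict_apply measurableSet_Ioc, inter_eq_left.2, Real.volume_Ioc]
      · simp
      · exact fun s hs => lt_of_le_of_lt M.2 hs.1
    have hfin : (volume.restrict (Ioi (0 : ℝ))) E ≠ ⊤ := by rw [hvol]; exact ENNReal.one_ne_top
    set y : HalfLineL2 := indicatorConstLp 2 measurableSet_Ioc hfin (1 : ℂ) with hy
    have hyE : y =ᵐ[volume.restrict (Ioi 0)] E.indicator fun _ => 1 := indicatorConstLp_coeFn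
    have hny : ‖y‖ = 1 := by
      rw [hy, norm_indicatorConstLp (by norm_num) (by norm_num), measureReal_def, hvol]
      simp
    have hdom : ∀ w : ℝ≥0, y ∈ (eikonal (pointAtom w)).domain := by
      intro w
      have hm : MemLp (fun ξ => ((|ξ - w| : ℝ) : ℂ) * y ξ) 2 (volume.restrict (Ioi (0 : ℝ))) := by
        refine MemLp.of_le_mul (c := M + 1 + w) (Lp.memLp y) ?_ ?_
        · refine AEStronglyMeasurable.mul ?_ (Lp.aestronglyMeasurable y)
          exact Continuous.aestronglyMeasurable (by fun_prop)
        · filter_upwards [hyE, ae_restrict_mem measurableSet_Ioi] with s hs hs0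
          rw [norm_mul]
          by_cases h : s ∈ E
          · gcongr
            rw [Complex.norm_real, Real.norm_eq_abs, abs_abs, abs_le]
            have hs0' : 0 < s := hs0
            have := h.2
            have := w.2
            constructor <;> linarith
          · rw [hs, indicator_of_notMem h]
            simp
      exact mem_domain_eikonal_pointAtom (MemLp.coeFn_toLp hm)
    let Y : (eikonal (pointAtom x) - eikonal (pointAtom x')).domain := ⟨y, hdom x, hdom x'⟩
    have hval : (eikonal (pointAtom x) - eikonal (pointAtom x')) Y =
        (((x' : ℝ) - x : ℝ) : ℂ) • y := by
      refine Lp.ext ?_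
      filter_upwards [coeFn_eikonal_sub x x' Y, Lp.coeFn_smul (((x' : ℝ) - x : ℝ) : ℂ) y, hyE]
        with s h1 h2 h3
      rw [h1, h2, Pi.smul_apply, smul_eq_mul]
      change _ * y s = _
      by_cases h : s ∈ E
      · have hx : (x : ℝ) ≤ s := le_trans (by exact_mod_cast le_max_left x x') h.1.le
        have hx' : (x' : ℝ) ≤ s := le_trans (by exact_mod_cast le_max_right x x') h.1.le
        rw [abs_of_nonneg (sub_nonneg.2 hx), abs_of_nonneg (sub_nonneg.2 hx')]
        congr 2
        ring
      · rw [h3, indicator_of_notMem h, mul_zero, mul_zero]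
    refine le_trans ?_ (le_iSup₂ (f := fun (y : (eikonal (pointAtom x) -
      eikonal (pointAtom x')).domain) (_ : ‖(y : HalfLineL2)‖ ≤ 1) =>
      ‖(eikonal (pointAtom x) - eikonal (pointAtom x')) y‖ₑ) Y hny.le)
    rw [hval, ← ofReal_norm, norm_smul, hny, mul_one, Complex.norm_real, Real.norm_eq_abs,
      abs_sub_comm]

end Eikonal

end WaveSpectrum

namespace WaveSpectrum

/-! ### Test functions, du Bois-Reymond lemmas, Green's formula -/

section TestFunctions

/-- Real test functions on the line. -/
structure IsTest (k : ℝ → ℝ) : Prop where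
  contDiff : ContDiff ℝ (⊤ : ℕ∞) k
  compact : HasCompactSupport k

namespace IsTest

variable {k l : ℝ → ℝ}

theorem continuous (hk : IsTest k) : Continuous k := hk.contDiff.continuous

theorem differentiable (hk : IsTest k) : Differentiable ℝ k :=
  hk.contDiff.differentiable (by simp)

theorem hasDerivAt (hk : IsTest k) (x : ℝ) : HasDerivAt k (deriv k x) x :=
  (hk.differentiable x).hasDerivAt

theorem deriv (hk : IsTest k) : IsTest (deriv k) :=
  ⟨(contDiff_infty_iff_deriv.1 hk.contDiff).2, hk.compact.deriv⟩

theorem integrable (hk : IsTest k) : Integrable k :=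
  hk.continuous.integrable_of_hasCompactSupport hk.compact

theorem sub (hk : IsTest k) (hl : IsTest l) : IsTest (k - l) :=
  ⟨hk.contDiff.sub hl.contDiff, hk.compact.sub hl.compact⟩

theorem const_mul (c : ℝ) (hk : IsTest k) : IsTest fun x => c * k x :=
  ⟨contDiff_const.mul hk.contDiff, hk.compact.mul_left⟩

theorem integrable_smul (hk : IsTest k) {f : ℝ → ℂ} (hf : LocallyIntegrable f) :
    Integrable fun x => k x • f x :=
  hf.integrable_smul_left_of_hasCompactSupport hk.continuous hk.compact

theorem exists_bound_support (hk : IsTest k) : ∃ R : ℝ, 0 < R ∧ ∀ x, R ≤ |x| → k x = 0 := by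
  obtain ⟨R, hR⟩ := hk.compact.isBounded.subset_closedBall (0 : ℝ)
  refine ⟨|R| + 1, by positivity, fun x hx => ?_⟩
  by_contra h
  have h1 := hR (subset_tsupport _ h)
  rw [Metric.mem_closedBall, Real.dist_0_eq_abs] at h1
  linarith [le_abs_self R]

theorem deriv_eq_zero {x : ℝ} (hx : x ∉ tsupport k) : _root_.deriv k x = 0 :=
  by_contra fun h => hx (support_deriv_subset h)

theorem tsupport_deriv_subset : tsupport (_root_.deriv k) ⊆ tsupport k :=
  closure_minimal support_deriv_subset (isClosed_tsupport _)

/-- A test function of mean zero is the derivative of a test function. -/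
theorem exists_deriv_eq (hk : IsTest k) (h0 : ∫ x, k x = 0) {U : Set ℝ} (hU : U.OrdConnected)
    (hkU : tsupport k ⊆ U) : ∃ c, IsTest c ∧ tsupport c ⊆ U ∧ _root_.deriv c = k := by
  rcases (tsupport k).eq_empty_or_nonempty with he | hne
  · have hk0 : k = 0 := tsupport_eq_empty_iff.1 he
    refine ⟨0, ⟨contDiff_const, HasCompactSupport.zero⟩, ?_, ?_⟩
    · rw [tsupport_eq_empty_iff.2 rfl]; exact empty_subset _
    · rw [hk0]; ext x; simp
  obtain ⟨m, hm, hm'⟩ := hk.compact.exists_isLeast hne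
  obtain ⟨M, hM, hM'⟩ := hk.compact.exists_isGreatest hne
  have hd : ∀ x, HasDerivAt (fun x => ∫ t in m..x, k t) (k x) x := fun x =>
    intervalIntegral.integral_hasDerivAt_right (hk.continuous.intervalIntegrable _ _)
      hk.continuous.stronglyMeasurable.stronglyMeasurableAtFilter hk.continuous.continuousAt
  have hderiv : _root_.deriv (fun x => ∫ t in m..x, k t) = k := funext fun x => (hd x).deriv
  have hz1 : ∀ x, x < m → k x = 0 := fun x hx => by
    by_contra h; exact hx.not_ge (hm' (subset_tsupport _ h))
  have hz2 : ∀ x, M < x → k x = 0 := fun x hx => by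
    by_contra h; exact hx.not_ge (hM' (subset_tsupport _ h))
  have hsupp : Function.support (fun x => ∫ t in m..x, k t) ⊆ Icc m M := by
    intro x hx
    by_contra hcon
    refine hx ?_
    rcases lt_or_ge x m with h | h
    · change ∫ t in m..x, k t = 0
      rw [intervalIntegral.integral_of_ge h.le, integral_Ioc_eq_integral_Ioo, setIntegral_eq_zero_of_forall_eq_zero, neg_zero]
      exact fun t ht => hz1 t ht.2
    · have hMx : M < x := not_le.1 fun h' => hcon ⟨h, h'⟩
      change ∫ t in m..x, k t = 0
      rw [intervalIntegral.integral_of_le h, ← integral_Icc_eq_integral_Ioc, ← h0]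
      refine setIntegral_eq_integral_of_forall_compl_eq_zero fun t ht => ?_
      rcases lt_or_ge t m with h1 | h1
      · exact hz1 t h1
      · exact hz2 t (hMx.trans (not_le.1 fun h' => ht ⟨h1, h'⟩))
  have hts : tsupport (fun x => ∫ t in m..x, k t) ⊆ Icc m M := closure_minimal hsupp isClosed_Icc
  refine ⟨fun x => ∫ t in m..x, k t, ⟨?_, ?_⟩, hts.trans (hU.out (hkU hm) (hkU hM)), hderiv⟩
  · rw [contDiff_infty_iff_deriv, hderiv]
    exact ⟨fun x => (hd x).differentiableAt, hk.contDiff⟩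
  · exact isCompact_Icc.of_isClosed_subset (isClosed_tsupport _) hts

end IsTest

theorem exists_isTest_integral_eq_one {U : Set ℝ} (hU : IsOpen U) (hne : U.Nonempty) :
    ∃ θ, IsTest θ ∧ tsupport θ ⊆ U ∧ ∫ x, θ x = 1 := by
  obtain ⟨x, hx⟩ := hne
  obtain ⟨ε, hε, hb⟩ := Metric.isOpen_iff.1 hU x hx
  let f : ContDiffBump x := ⟨ε / 4, ε / 2, by positivity, by linarith⟩
  refine ⟨f.normed volume, ⟨f.contDiff_normed, f.hasCompactSupport_normed⟩, ?_, f.integral_normed⟩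
  rw [f.tsupport_normed_eq]
  exact (Metric.closedBall_subset_ball (by change ε / 2 < ε; linarith)).trans hb

/-- The lemma of du Bois-Reymond. -/
theorem ae_eq_const_of_integral_deriv_smul_eq_zero {U : Set ℝ} (hU : IsOpen U)
    (hc : U.OrdConnected) {f : ℝ → ℂ} (hf : LocallyIntegrable f)
    (h : ∀ k, IsTest k → tsupport k ⊆ U → ∫ x, deriv k x • f x = 0) :
    ∃ c : ℂ, ∀ᵐ x, x ∈ U → f x = c := by
  rcases U.eq_empty_or_nonempty with rfl | hne
  · exact ⟨0, by simp⟩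
  obtain ⟨θ, hθ, hθU, hθ1⟩ := exists_isTest_integral_eq_one hU hne
  set c := ∫ x, θ x • f x with hc'
  refine ⟨c, ?_⟩
  have hfc : LocallyIntegrable fun x => f x - c := hf.sub (locallyIntegrable_const c)
  have := hU.ae_eq_zero_of_integral_contDiff_smul_eq_zero (f := fun x => f x - c)
    (hfc.locallyIntegrableOn U) fun k hk1 hk2 hkU => ?_
  · filter_upwards [this] with x hx hxU using sub_eq_zero.1 (hx hxU)
  have hk : IsTest k := ⟨hk1, hk2⟩
  -- Subtracting `(∫ k) θ` makes the mean zero, so the result is the derivative of a test function;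
  -- the subtracted term produces the constant `c`.
  have hb : IsTest (k - fun x => (∫ t, k t) * θ x) := hk.sub (hθ.const_mul _)
  obtain ⟨d, hd, hdU, hdk⟩ := hb.exists_deriv_eq (by
    simp only [Pi.sub_apply]
    rw [integral_sub hk.integrable (hθ.const_mul _).integrable, integral_const_mul, hθ1, mul_one,
      sub_self]) hc ((tsupport_sub k _).trans (union_subset hkU
        ((closure_mono (Function.support_mul_subset_right _ _)).trans hθU)))
  have h1 := h d hd hdU
  rw [hdk] at h1
  have h2 : ∀ x, (k - fun x => (∫ t, k t) * θ x) x • f x =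
      k x • f x - (∫ t, k t) • (θ x • f x) := fun x => by
    rw [Pi.sub_apply, sub_smul, mul_smul]
  simp only [h2] at h1
  have h3 : Integrable fun x => (∫ t, k t) • (θ x • f x) := (hθ.integrable_smul hf).smul (∫ t, k t)
  rw [integral_sub (hk.integrable_smul hf) h3, integral_smul, ← hc'] at h1
  simp only [smul_sub]
  rw [integral_sub (hk.integrable_smul hf) (hk.integrable.smul_const c), integral_smul_const]
  exact h1

/-- The lemma of du Bois-Reymond for second derivatives. -/
theorem ae_eq_affine_of_integral_deriv_deriv_smul_eq_zero {U : Set ℝ} (hU : IsOpen U)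
    (hc : U.OrdConnected) {f : ℝ → ℂ} (hf : LocallyIntegrable f)
    (h : ∀ k, IsTest k → tsupport k ⊆ U → ∫ x, deriv (deriv k) x • f x = 0) :
    ∃ α β : ℂ, ∀ᵐ x : ℝ, x ∈ U → f x = α + x * β := by
  rcases U.eq_empty_or_nonempty with rfl | hne
  · exact ⟨0, 0, by simp⟩
  obtain ⟨θ, hθ, hθU, hθ1⟩ := exists_isTest_integral_eq_one hU hne
  -- Writing `k - (∫ k) θ` as the derivative of a test function gives `∫ k' f = (∫ k) κ`, whereas `∫
  -- k' x κ = -(∫ k) κ`. Hence `f + x κ` satisfies the first-order hypothesis, and `-κ` is the slope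
  -- of `f`.
  set κ := ∫ x, deriv θ x • f x with hκ
  have hx : LocallyIntegrable fun x : ℝ => (x : ℂ) * κ :=
    (Complex.continuous_ofReal.mul continuous_const).locallyIntegrable
  suffices hmain : ∀ k, IsTest k → tsupport k ⊆ U →
      ∫ x, deriv k x • (f + fun x : ℝ => (x : ℂ) * κ) x = 0 by
    obtain ⟨c, hc⟩ := ae_eq_const_of_integral_deriv_smul_eq_zero hU hc (hf.add hx) hmain
    refine ⟨c, -κ, ?_⟩
    filter_upwards [hc] with x hx hxU
    rw [← hx hxU, Pi.add_apply]
    ring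
  intro k hk hkU
  have hb : IsTest (k - fun x => (∫ t, k t) * θ x) := hk.sub (hθ.const_mul _)
  obtain ⟨d, hd, hdU, hdk⟩ := hb.exists_deriv_eq (by
    simp only [Pi.sub_apply]
    rw [integral_sub hk.integrable (hθ.const_mul _).integrable, integral_const_mul, hθ1, mul_one,
      sub_self]) hc ((tsupport_sub k _).trans (union_subset hkU
        ((closure_mono (Function.support_mul_subset_right _ _)).trans hθU)))
  have h1 := h d hd hdU
  rw [hdk] at h1
  have h2 : ∀ x, deriv (k - fun x => (∫ t, k t) * θ x) x • f x =
      deriv k x • f x - (∫ t, k t) • (deriv θ x • f x) := fun x => by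
    rw [((hk.hasDerivAt x).sub ((hθ.hasDerivAt x).const_mul _)).deriv, sub_smul, mul_smul]
  simp only [h2] at h1
  have h3 : Integrable fun x => (∫ t, k t) • (deriv θ x • f x) :=
    (hθ.deriv.integrable_smul hf).smul (∫ t, k t)
  rw [integral_sub (hk.deriv.integrable_smul hf) h3, integral_smul, ← hκ] at h1
  have h3 : ∫ x, deriv k x • ((x : ℂ) * κ) = -((∫ t, k t) • κ) := by
    have h4 : ∀ x : ℝ, deriv k x • ((x : ℂ) * κ) = (deriv k x * x) • κ := fun x => by
      rw [mul_smul, ← smul_eq_mul (x : ℂ), Complex.coe_smul]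
    simp only [h4]
    rw [integral_smul_const, ← neg_smul]
    congr 1
    have hxk : HasCompactSupport fun x => k x * x := hk.compact.mul_right
    have h5 : Integrable fun x : ℝ => deriv k x * x :=
      (hk.deriv.continuous.mul continuous_id).integrable_of_hasCompactSupport
        hk.deriv.compact.mul_right
    have h6 := integral_eq_zero_of_hasDerivAt_of_integrable
      (f := fun x => k x * x) (f' := fun x => deriv k x * x + k x * 1)
      (fun x => (hk.hasDerivAt x).mul (hasDerivAt_id x)) (h5.add (by simpa using hk.integrable))
      ((hk.continuous.mul continuous_id).integrable_of_hasCompactSupport hxk)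
    simp only [mul_one] at h6
    rw [integral_add h5 hk.integrable] at h6
    linarith
  simp only [Pi.add_apply, smul_add]
  rw [integral_add (hk.deriv.integrable_smul hf) (hk.deriv.integrable_smul hx), h3]
  rw [sub_eq_zero] at h1
  rw [h1, add_neg_cancel]

/-- Integration by parts for a primitive of an integrable function. -/
theorem integral_smul_eq_of_primitive {g G : ℝ → ℂ} {k : ℝ → ℝ} {R : ℝ} (hR : 0 ≤ R)
    (hg : IntervalIntegrable g volume 0 R) (hG : ∀ x ∈ Icc 0 R, G x = G 0 + ∫ s in (0 : ℝ)..x, g s)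
    (hk : IsTest k) :
    ∫ x in (0 : ℝ)..R, k x • g x = k R • G R - k 0 • G 0 - ∫ x in (0 : ℝ)..R, deriv k x • G x := by
  -- Integration by parts for absolutely continuous functions is done for real densities and then
  -- applied to the real and imaginary parts of `g`.
  have hreal : ∀ u : ℝ → ℝ, IntervalIntegrable u volume 0 R →
      ∫ x in (0 : ℝ)..R, k x * u x = k R * (∫ s in (0 : ℝ)..R, u s) -
        ∫ x in (0 : ℝ)..R, deriv k x * ∫ s in (0 : ℝ)..x, u s := by
    intro u hu
    have h0 : (0 : ℝ) ∈ uIcc 0 R := left_mem_uIcc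
    have h1 := hu.absolutelyContinuousOnInterval_intervalIntegral h0
    have h2 : AbsolutelyContinuousOnInterval k 0 R :=
      ((hk.contDiff.of_le (by exact_mod_cast le_top)).contDiffOn
        (n := 1)).absolutelyContinuousOnInterval
    have h3 := h2.integral_mul_deriv_eq_deriv_mul h1
    rw [intervalIntegral.integral_same, mul_zero, sub_zero] at h3
    rw [← h3]
    refine intervalIntegral.integral_congr_ae ?_
    filter_upwards [hu.ae_hasDerivAt_integral] with x hx hxR
    rw [(hx (uIoc_subset_uIcc hxR) 0 h0).deriv]
  have hcA : ContinuousOn (fun x => ∫ s in (0 : ℝ)..x, g s) (uIcc 0 R) :=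
    intervalIntegral.continuousOn_primitive_interval (by rwa [← intervalIntegrable_iff'])
  have hi1 : IntervalIntegrable (fun x => k x • g x) volume 0 R :=
    hg.continuousOn_smul hk.continuous.continuousOn
  have hi2 : IntervalIntegrable (fun x => deriv k x • ∫ s in (0 : ℝ)..x, g s) volume 0 R :=
    (hk.deriv.continuous.continuousOn.smul hcA).intervalIntegrable
  have hA : ∫ x in (0 : ℝ)..R, k x • g x = k R • (∫ s in (0 : ℝ)..R, g s) -
      ∫ x in (0 : ℝ)..R, deriv k x • ∫ s in (0 : ℝ)..x, g s := by
    have hsub : ∀ x ∈ uIcc 0 R, IntervalIntegrable g volume 0 x := fun x hx =>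
      hg.mono_set (uIcc_subset_uIcc left_mem_uIcc hx)
    have hre : ∀ x ∈ uIcc 0 R, (∫ s in (0 : ℝ)..x, g s).re = ∫ s in (0 : ℝ)..x, (g s).re :=
      fun x hx => (Complex.reCLM.intervalIntegral_comp_comm (hsub x hx)).symm
    have him : ∀ x ∈ uIcc 0 R, (∫ s in (0 : ℝ)..x, g s).im = ∫ s in (0 : ℝ)..x, (g s).im :=
      fun x hx => (Complex.imCLM.intervalIntegral_comp_comm (hsub x hx)).symm
    apply Complex.ext
    · have e1 := Complex.reCLM.intervalIntegral_comp_comm hi1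
      have e2 := Complex.reCLM.intervalIntegral_comp_comm hi2
      simp only [Complex.reCLM_apply, Complex.smul_re, smul_eq_mul] at e1 e2
      rw [← e1, Complex.sub_re, ← e2, Complex.smul_re, hre R right_mem_uIcc, smul_eq_mul,
        hreal (fun x => (g x).re) ⟨hg.1.re, hg.2.re⟩]
      congr 1
      exact intervalIntegral.integral_congr fun x hx => by simp only [hre x hx]
    · have e1 := Complex.imCLM.intervalIntegral_comp_comm hi1
      have e2 := Complex.imCLM.intervalIntegral_comp_comm hi2
      simp only [Complex.imCLM_apply, Complex.smul_im, smul_eq_mul] at e1 e2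
      rw [← e1, Complex.sub_im, ← e2, Complex.smul_im, him R right_mem_uIcc, smul_eq_mul,
        hreal (fun x => (g x).im) ⟨hg.1.im, hg.2.im⟩]
      congr 1
      exact intervalIntegral.integral_congr fun x hx => by simp only [him x hx]
  have hkint : ∫ x in (0 : ℝ)..R, deriv k x • G 0 = (k R - k 0) • G 0 := by
    rw [intervalIntegral.integral_smul_const, intervalIntegral.integral_deriv_eq_sub
      (fun x _ => hk.differentiable x) (hk.deriv.continuous.intervalIntegrable _ _)]
  have e : ∫ x in (0 : ℝ)..R, deriv k x • G x = (k R - k 0) • G 0 +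
      ∫ x in (0 : ℝ)..R, deriv k x • ∫ s in (0 : ℝ)..x, g s := by
    have hi3 : IntervalIntegrable (fun x => deriv k x • G 0) volume 0 R :=
      (hk.deriv.continuous.smul continuous_const).intervalIntegrable _ _
    rw [← hkint, ← intervalIntegral.integral_add hi3 hi2]
    refine intervalIntegral.integral_congr fun x hx => ?_
    rw [uIcc_of_le hR] at hx
    rw [hG x hx, smul_add]
  rw [hA, e, hG R (right_mem_Icc.2 hR), smul_add, sub_smul]
  abel

theorem integral_Ioi_eq_intervalIntegral {f : ℝ → ℂ} {R : ℝ} (hR : 0 ≤ R)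
    (h : ∀ x, R ≤ x → f x = 0) : ∫ x in Ioi (0 : ℝ), f x = ∫ x in (0 : ℝ)..R, f x := by
  rw [intervalIntegral.integral_of_le hR]
  refine setIntegral_eq_of_subset_of_forall_sdiff_eq_zero measurableSet_Ioi
    (fun x hx => hx.1) fun x hx => h x ?_
  by_contra hcon
  exact hx.2 ⟨hx.1, (not_le.1 hcon).le⟩

/-- Green's formula on the half-line. -/
theorem IsH2Loc.integral_smul_eq {f f' f'' : ℝ → ℂ} (hf : IsH2Loc f f' f'') {k : ℝ → ℝ}
    (hk : IsTest k) : ∫ x in Ioi (0 : ℝ), k x • f'' x =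
      deriv k 0 • f 0 - k 0 • f' 0 + ∫ x in Ioi (0 : ℝ), deriv (deriv k) x • f x := by
  obtain ⟨R1, hR1, h1⟩ := hk.exists_bound_support
  obtain ⟨R2, hR2, h2⟩ := hk.deriv.exists_bound_support
  obtain ⟨R3, hR3, h3⟩ := hk.deriv.deriv.exists_bound_support
  set R := max R1 (max R2 R3)
  have hR : 0 ≤ R := hR1.le.trans (le_max_left _ _)
  have h1' : ∀ x, R ≤ x → k x = 0 := fun x hx =>
    h1 x (((le_max_left _ _).trans hx).trans (le_abs_self x))
  have h2' : ∀ x, R ≤ x → deriv k x = 0 := fun x hx =>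
    h2 x ((((le_max_left _ _).trans (le_max_right _ _)).trans hx).trans (le_abs_self x))
  have h3' : ∀ x, R ≤ x → deriv (deriv k) x = 0 := fun x hx =>
    h3 x ((((le_max_right _ _).trans (le_max_right _ _)).trans hx).trans (le_abs_self x))
  rw [integral_Ioi_eq_intervalIntegral hR fun x hx => by rw [h1' x hx, zero_smul],
    integral_Ioi_eq_intervalIntegral hR fun x hx => by rw [h3' x hx, zero_smul],
    integral_smul_eq_of_primitive hR (hf.intervalIntegrable hR)
      (fun x hx => hf.deriv_eq_integral x hx.1) hk,
    integral_smul_eq_of_primitive hR (hf.intervalIntegrable_deriv hR)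
      (fun x hx => hf.eq_integral x hx.1) hk.deriv, h1' R le_rfl, h2' R le_rfl]
  simp only [zero_smul]
  abel

end TestFunctions

end WaveSpectrum

namespace WaveSpectrum

/-! ### The minimal operator and the regularity of its adjoint -/

section SturmLiouville

open scoped Classical in
/-- The element of `L₂(ℝ₊)` defined by a square integrable real function. -/
noncomputable def realL2 (k : ℝ → ℝ) : HalfLineL2 :=
  if h : MemLp (fun x => (k x : ℂ)) 2 (volume.restrict (Ioi (0 : ℝ))) then h.toLp _ else 0

theorem coeFn_realL2 {k : ℝ → ℝ} (h : MemLp (fun x => (k x : ℂ)) 2 (volume.restrict (Ioi (0 : ℝ)))) :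
    realL2 k =ᵐ[volume.restrict (Ioi 0)] fun x => (k x : ℂ) := by
  rw [realL2, dif_pos h]
  exact MemLp.coeFn_toLp h

/-- The expression `-k'' + q k`. -/
noncomputable def slExpr (q k : ℝ → ℝ) (x : ℝ) : ℝ := -deriv (deriv k) x + q x * k x

variable {q k l : ℝ → ℝ} (hq : ContinuousOn q (Ici 0))

theorem IsTest.memLp (hk : IsTest k) :
    MemLp (fun x => (k x : ℂ)) 2 (volume.restrict (Ioi (0 : ℝ))) := by
  have h1 : MemLp k 2 volume := hk.continuous.memLp_of_hasCompactSupport hk.compact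
  exact (h1.restrict _).ofReal

include hq in
theorem exists_bound_potential (R : ℝ) : ∃ Q : ℝ, 0 ≤ Q ∧ ∀ x, 0 ≤ x → x ≤ R → |q x| ≤ Q := by
  obtain ⟨Q, hQ⟩ := isCompact_Icc.exists_bound_of_continuousOn
    (hq.mono (Icc_subset_Ici_self : Icc 0 R ⊆ Ici 0))
  exact ⟨|Q|, abs_nonneg _, fun x h0 hR => (hQ x ⟨h0, hR⟩).trans (le_abs_self Q)⟩

include hq in
theorem aestronglyMeasurable_potential :
    AEStronglyMeasurable (fun x => (q x : ℂ)) (volume.restrict (Ioi (0 : ℝ))) :=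
  (Complex.continuous_ofReal.comp_continuousOn (hq.mono Ioi_subset_Ici_self)).aestronglyMeasurable
    measurableSet_Ioi

include hq in
theorem IsTest.memLp_potential_mul (hk : IsTest k) :
    MemLp (fun x => (q x : ℂ) * (k x : ℂ)) 2 (volume.restrict (Ioi (0 : ℝ))) := by
  obtain ⟨R, hR, hkR⟩ := hk.exists_bound_support
  obtain ⟨Q, hQ0, hQ⟩ := exists_bound_potential hq R
  refine MemLp.of_le_mul (c := Q) hk.memLp
    ((aestronglyMeasurable_potential hq).mul hk.memLp.aestronglyMeasurable) ?_
  filter_upwards [ae_restrict_mem measurableSet_Ioi] with x hx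
  have hx0 : 0 ≤ x := le_of_lt hx
  rcases le_total x R with h | h
  · rw [norm_mul, Complex.norm_real, Real.norm_eq_abs]
    exact mul_le_mul_of_nonneg_right (hQ x hx0 h) (norm_nonneg _)
  · rw [hkR x (by rwa [abs_of_nonneg hx0])]
    simp

include hq in
theorem IsTest.memLp_slExpr (hk : IsTest k) :
    MemLp (fun x => (slExpr q k x : ℂ)) 2 (volume.restrict (Ioi (0 : ℝ))) := by
  have := hk.deriv.deriv.memLp.neg.add (hk.memLp_potential_mul hq)
  refine this.ae_eq (Eventually.of_forall fun x => ?_)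
  simp [slExpr]

theorem inner_realL2 (h : MemLp (fun x => (k x : ℂ)) 2 (volume.restrict (Ioi (0 : ℝ))))
    (y : HalfLineL2) : inner ℂ (realL2 k) y = ∫ x in Ioi (0 : ℝ), k x • y x := by
  rw [L2.inner_def]
  refine integral_congr_ae ?_
  filter_upwards [coeFn_realL2 h] with x hx
  rw [hx]
  simp [mul_comm]

theorem integrable_smul_realL2 (h : MemLp (fun x => (k x : ℂ)) 2 (volume.restrict (Ioi (0 : ℝ))))
    (y : HalfLineL2) : IntegrableOn (fun x => k x • y x) (Ioi (0 : ℝ)) := by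
  have := L2.integrable_inner (𝕜 := ℂ) (realL2 k) y
  refine this.congr ?_
  filter_upwards [coeFn_realL2 h] with x hx
  rw [hx]
  simp [mul_comm]

theorem locallyIntegrable_indicator (y : HalfLineL2) :
    LocallyIntegrable ((Ioi (0 : ℝ)).indicator y) := by
  have : MemLp ((Ioi (0 : ℝ)).indicator y) 2 volume :=
    (memLp_indicator_iff_restrict measurableSet_Ioi).2 (Lp.memLp y)
  exact this.locallyIntegrable (by norm_num)

theorem integral_smul_indicator (k : ℝ → ℝ) (y : ℝ → ℂ) :
    ∫ x, k x • (Ioi (0 : ℝ)).indicator y x = ∫ x in Ioi (0 : ℝ), k x • y x := by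
  rw [← integral_indicator measurableSet_Ioi]
  congr 1
  ext x
  by_cases h : x ∈ Ioi (0 : ℝ)
  · rw [indicator_of_mem h, indicator_of_mem h]
  · rw [indicator_of_notMem h, indicator_of_notMem h, smul_zero]

/-- An element of `L₂(ℝ₊)` that is orthogonal to the test functions with support in `U` vanishes
in `U`. -/
theorem ae_eq_zero_of_integral_smul {y : HalfLineL2} {U : Set ℝ} (hU : IsOpen U)
    (h : ∀ k, IsTest k → tsupport k ⊆ Ioi 0 → tsupport k ⊆ U →
      ∫ x in Ioi (0 : ℝ), k x • y x = 0) :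
    ∀ᵐ x ∂volume.restrict (Ioi (0 : ℝ)), x ∈ U → y x = 0 := by
  have h1 := (hU.inter isOpen_Ioi).ae_eq_zero_of_integral_contDiff_smul_eq_zero
    (U := U ∩ Ioi (0 : ℝ)) ((locallyIntegrable_indicator y).locallyIntegrableOn _)
    fun k hk1 hk2 hkU => by
      rw [integral_smul_indicator]
      exact h k ⟨hk1, hk2⟩ (fun x hx => (hkU hx).2) fun x hx => (hkU hx).1
  rw [ae_restrict_iff' measurableSet_Ioi]
  filter_upwards [h1] with x hx h0 hxU
  have := hx ⟨hxU, h0⟩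
  rwa [indicator_of_mem h0] at this

theorem IsTest.isH2Loc (hk : IsTest k) :
    IsH2Loc (fun x => (k x : ℂ)) (fun x => ((_root_.deriv k x : ℝ) : ℂ))
      (fun x => ((_root_.deriv (_root_.deriv k) x : ℝ) : ℂ)) where
  memLp R := by
    have h1 : MemLp (_root_.deriv (_root_.deriv k)) 2 volume :=
      hk.deriv.deriv.continuous.memLp_of_hasCompactSupport hk.deriv.deriv.compact
    exact (h1.restrict _).ofReal
  eq_integral x _ := by
    rw [intervalIntegral.integral_ofReal, intervalIntegral.integral_deriv_eq_sub
      (fun x _ => hk.differentiable x) (hk.deriv.continuous.intervalIntegrable _ _)]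
    push_cast; ring
  deriv_eq_integral x _ := by
    rw [intervalIntegral.integral_ofReal, intervalIntegral.integral_deriv_eq_sub
      (fun x _ => hk.deriv.differentiable x) (hk.deriv.deriv.continuous.intervalIntegrable _ _)]
    push_cast; ring

include hq in
theorem IsTest.mem_sturmLiouvilleGraph (hk : IsTest k) (h0 : k 0 = 0) (h1 : _root_.deriv k 0 = 0) :
    (realL2 k, realL2 (slExpr q k)) ∈ sturmLiouvilleGraph q := by
  refine ⟨_, _, _, hk.isH2Loc, by simp [h0], by simp [h1], coeFn_realL2 hk.memLp,
    (coeFn_realL2 (hk.memLp_slExpr hq)).trans (Eventually.of_forall fun x => ?_)⟩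
  simp [slExpr]

theorem IsTest.apply_zero_of_tsupport (hk : tsupport k ⊆ Ioi 0) : k 0 = 0 :=
  image_eq_zero_of_notMem_tsupport fun h => lt_irrefl (0 : ℝ) (hk h)

theorem IsTest.deriv_zero_of_tsupport (hk : tsupport k ⊆ Ioi 0) : _root_.deriv k 0 = 0 :=
  IsTest.deriv_eq_zero fun h => lt_irrefl (0 : ℝ) (hk h)

/-- If `y = 0`, moving both derivatives onto a test function shows that `f''`, hence `z`, is
orthogonal to all of them. So the relation is single-valued and really is the graph of the operator.
-/
theorem sturmLiouvilleOp_graph : (sturmLiouvilleOp q).graph = sturmLiouvilleGraph q := by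
  refine Submodule.toLinearPMap_graph_eq _ ?_
  rintro ⟨y, z⟩ ⟨f, f', f'', hf, h0, h0', hy, hz⟩ (hy0 : y = 0)
  change z = 0
  have hf0 : f =ᵐ[volume.restrict (Ioi 0)] 0 := by
    rw [hy0] at hy
    exact hy.symm.trans (Lp.coeFn_zero _ _ _)
  have h1 : ∀ᵐ x ∂volume.restrict (Ioi (0 : ℝ)), x ∈ univ → z x = 0 := by
    refine ae_eq_zero_of_integral_smul isOpen_univ fun k hk hk0 _ => ?_
    have h2 := hf.integral_smul_eq hk
    rw [h0, h0', smul_zero, smul_zero, sub_zero, zero_add] at h2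
    have h3 : ∫ x in Ioi (0 : ℝ), deriv (deriv k) x • f x = 0 := by
      refine integral_eq_zero_of_ae ?_
      filter_upwards [hf0] with x hx
      rw [hx]; simp
    have h4 : ∫ x in Ioi (0 : ℝ), k x • z x = -∫ x in Ioi (0 : ℝ), k x • f'' x := by
      rw [← integral_neg]
      refine integral_congr_ae ?_
      filter_upwards [hz, hf0] with x hx hx0
      rw [hx, hx0]; simp
    rw [h4, h2, h3, neg_zero]
  refine Lp.ext ?_
  filter_upwards [h1, Lp.coeFn_zero ℂ 2 (volume.restrict (Ioi (0 : ℝ)))] with x hx h0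
  rw [hx trivial, h0]; rfl

include hq in
theorem dense_sturmLiouvilleOp_domain :
    Dense ((sturmLiouvilleOp q).domain : Set HalfLineL2) := by
  rw [Submodule.dense_iff_topologicalClosure_eq_top, Submodule.topologicalClosure_eq_top_iff,
    Submodule.eq_bot_iff]
  intro y hy
  have h1 : ∀ᵐ x ∂volume.restrict (Ioi (0 : ℝ)), x ∈ univ → y x = 0 := by
    refine ae_eq_zero_of_integral_smul isOpen_univ fun k hk hk0 _ => ?_
    rw [← inner_realL2 hk.memLp]
    refine hy _ ?_
    have := hk.mem_sturmLiouvilleGraph hq (IsTest.apply_zero_of_tsupport hk0)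
      (IsTest.deriv_zero_of_tsupport hk0)
    rw [← sturmLiouvilleOp_graph] at this
    exact LinearPMap.mem_domain_of_mem_graph this
  refine Lp.ext ?_
  filter_upwards [h1, Lp.coeFn_zero ℂ 2 (volume.restrict (Ioi (0 : ℝ)))] with x hx h0
  rw [hx trivial, h0]; rfl

/-- `y` has the representative `f ∈ H²_loc` and `z = -f'' + q f`. -/
structure IsRegular (q : ℝ → ℝ) (y z : HalfLineL2) (f f' f'' : ℝ → ℂ) : Prop where
  isH2Loc : IsH2Loc f f' f''
  fst : y =ᵐ[volume.restrict (Ioi 0)] f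
  snd : z =ᵐ[volume.restrict (Ioi 0)] fun x => -f'' x + (q x : ℂ) * f x

/-- The potential terms cancel and only the boundary form `k'(0) f(0) - k(0) f'(0)` survives. This
is how boundary values of a representative are read off from inner products. -/
theorem IsRegular.integral_green {y z : HalfLineL2} {f f' f'' : ℝ → ℂ}
    (hr : IsRegular q y z f f' f'') (hk : IsTest k) (hq : ContinuousOn q (Ici 0)) :
    inner ℂ (realL2 (slExpr q k)) y - inner ℂ (realL2 k) z =
      deriv k 0 • f 0 - k 0 • f' 0 := by
  have hqk := integrable_smul_realL2 (k := fun x => q x * k x)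
    (by simpa using hk.memLp_potential_mul hq) y
  have hk2 := integrable_smul_realL2 hk.deriv.deriv.memLp y
  have hk2n : Integrable (fun x => -(deriv (deriv k) x • y x)) (volume.restrict (Ioi 0)) := hk2.neg
  have hkz := integrable_smul_realL2 hk.memLp z
  have e1 : inner ℂ (realL2 (slExpr q k)) y = -(∫ x in Ioi (0 : ℝ), deriv (deriv k) x • f x) +
      ∫ x in Ioi (0 : ℝ), (q x * k x) • y x := by
    have e0 : ∫ x in Ioi (0 : ℝ), deriv (deriv k) x • f x =
        ∫ x in Ioi (0 : ℝ), deriv (deriv k) x • y x := by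
      refine integral_congr_ae ?_
      filter_upwards [hr.fst] with x hx
      rw [hx]
    rw [inner_realL2 (hk.memLp_slExpr hq), e0, ← integral_neg, ← integral_add hk2n hqk]
    refine integral_congr_ae (Eventually.of_forall fun x => ?_)
    simp only [slExpr, add_smul, neg_smul]
  have e2 : inner ℂ (realL2 k) z = -(∫ x in Ioi (0 : ℝ), k x • f'' x) +
      ∫ x in Ioi (0 : ℝ), (q x * k x) • y x := by
    have e3 : ∫ x in Ioi (0 : ℝ), k x • f'' x =
        ∫ x in Ioi (0 : ℝ), ((q x * k x) • y x - k x • z x) := by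
      refine integral_congr_ae ?_
      filter_upwards [hr.fst, hr.snd] with x hx hx'
      simp only [hx, hx', Complex.real_smul]
      push_cast
      ring
    rw [inner_realL2 hk.memLp, e3, integral_sub hqk hkz]
    abel
  rw [e1, e2, hr.isH2Loc.integral_smul_eq hk]
  abel

-- No condition at `0` is needed: elements of the minimal domain have zero value and slope there, so
-- the boundary form vanishes.
include hq in
theorem IsTest.mem_adjoint_graph (hk : IsTest k) :
    (realL2 k, realL2 (slExpr q k)) ∈ (sturmLiouvilleOp q).adjoint.graph := by
  rw [mem_adjoint_graph_iff (dense_sturmLiouvilleOp_domain hq)]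
  intro f
  have hf := (sturmLiouvilleOp q).mem_graph f
  rw [sturmLiouvilleOp_graph] at hf
  obtain ⟨g, g', g'', hg, h0, h0', e1, e2⟩ := hf
  have h := (IsRegular.mk hg e1 e2).integral_green hk hq
  rw [h0, h0', smul_zero, smul_zero, sub_zero, sub_eq_zero] at h
  rw [← inner_conj_symm, ← h, inner_conj_symm]

include hq in
theorem memLp_rhs (y z : HalfLineL2) (R : ℝ) :
    MemLp (fun x => (q x : ℂ) * y x - z x) 2 (volume.restrict (Ioc 0 R)) := by
  obtain ⟨Q, hQ0, hQ⟩ := exists_bound_potential hq R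
  have hle : volume.restrict (Ioc 0 R) ≤ volume.restrict (Ioi (0 : ℝ)) :=
    Measure.restrict_mono (fun x hx => hx.1) le_rfl
  refine MemLp.sub (MemLp.of_le_mul (c := Q) ((Lp.memLp y).mono_measure hle) ?_ ?_)
    ((Lp.memLp z).mono_measure hle)
  · exact ((aestronglyMeasurable_potential hq).mul (Lp.aestronglyMeasurable y)).mono_measure hle
  · filter_upwards [ae_restrict_mem measurableSet_Ioc] with x hx
    rw [norm_mul, Complex.norm_real, Real.norm_eq_abs]
    exact mul_le_mul_of_nonneg_right (hQ x hx.1.le hx.2) (norm_nonneg _)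

include hq in
/-- Elements of the domain of the maximal operator are in `H²_loc([0, ∞))`. -/
theorem exists_isRegular {y z : HalfLineL2} (h : (y, z) ∈ (sturmLiouvilleOp q).adjoint.graph) :
    ∃ f f' f'', IsRegular q y z f f' f'' := by
  rw [mem_adjoint_graph_iff (dense_sturmLiouvilleOp_domain hq)] at h
  -- This is what `y''` has to be. The second distributional derivative of `y` minus the double
  -- primitive `G` of `κ` is zero, so `y - G` is affine.
  set κ : ℝ → ℂ := (Ioi (0 : ℝ)).indicator fun x => (q x : ℂ) * y x - z x with hκ
  have hκR : ∀ R : ℝ, MemLp κ 2 (volume.restrict (Ioc 0 R)) := fun R => by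
    refine (memLp_rhs hq y z R).ae_eq ?_
    filter_upwards [ae_restrict_mem measurableSet_Ioc] with x hx
    rw [hκ, indicator_of_mem (show x ∈ Ioi (0 : ℝ) from hx.1)]
  have hκi : ∀ a b, IntervalIntegrable κ volume a b := fun a b => by
    rw [intervalIntegrable_iff, hκ, integrableOn_indicator_iff measurableSet_Ioi]
    have h1 : IntegrableOn (fun x => (q x : ℂ) * y x - z x) (Ioc 0 (max a b)) :=
      (memLp_rhs hq y z (max a b)).integrable (by norm_num)
    exact h1.mono_set fun x hx => ⟨hx.1, (uIoc_subset_uIcc hx.2).2⟩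
  set G' : ℝ → ℂ := fun x => ∫ s in (0 : ℝ)..x, κ s with hG'
  set G : ℝ → ℂ := fun x => ∫ s in (0 : ℝ)..x, G' s with hG
  have hG'c : Continuous G' := intervalIntegral.continuous_primitive hκi 0
  have hGc : Continuous G :=
    intervalIntegral.continuous_primitive (fun a b => hG'c.intervalIntegrable a b) 0
  have hH : IsH2Loc G G' κ := ⟨hκR, fun x _ => by simp [hG], fun x _ => by simp [hG']⟩
  have hli : LocallyIntegrable fun x => (Ioi (0 : ℝ)).indicator y x - G x :=
    (locallyIntegrable_indicator y).sub hGc.locallyIntegrable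
  obtain ⟨α, β, hαβ⟩ := ae_eq_affine_of_integral_deriv_deriv_smul_eq_zero isOpen_Ioi
    (ordConnected_Ioi (a := (0 : ℝ))) hli fun k hk hk0 => by
      have hg := hk.mem_sturmLiouvilleGraph hq (IsTest.apply_zero_of_tsupport hk0)
        (IsTest.deriv_zero_of_tsupport hk0)
      rw [← sturmLiouvilleOp_graph] at hg
      obtain ⟨f, hf1, hf2⟩ := (LinearPMap.mem_graph_iff _).1 hg
      have h1 := h f
      rw [hf1, hf2] at h1
      simp only at h1
      have hqk := integrable_smul_realL2 (k := fun x => q x * k x)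
        (by simpa using hk.memLp_potential_mul hq) y
      have hk2 := integrable_smul_realL2 hk.deriv.deriv.memLp y
      have hk2n : Integrable (fun x => -(deriv (deriv k) x • y x)) (volume.restrict (Ioi 0)) :=
        hk2.neg
      have hkz := integrable_smul_realL2 hk.memLp z
      rw [inner_realL2 (hk.memLp_slExpr hq), inner_realL2 hk.memLp] at h1
      have e1 : ∫ x in Ioi (0 : ℝ), slExpr q k x • y x =
          -(∫ x in Ioi (0 : ℝ), deriv (deriv k) x • y x) +
            ∫ x in Ioi (0 : ℝ), (q x * k x) • y x := by
        rw [← integral_neg, ← integral_add hk2n hqk]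
        refine integral_congr_ae (Eventually.of_forall fun x => ?_)
        simp only [slExpr, add_smul, neg_smul]
      have e2 : ∫ x in Ioi (0 : ℝ), k x • κ x =
          (∫ x in Ioi (0 : ℝ), (q x * k x) • y x) - ∫ x in Ioi (0 : ℝ), k x • z x := by
        rw [← integral_sub hqk hkz]
        refine integral_congr_ae ?_
        filter_upwards [ae_restrict_mem measurableSet_Ioi] with x hx
        rw [hκ, indicator_of_mem hx]
        simp only [Complex.real_smul]
        push_cast
        ring
      have e3 := hH.integral_smul_eq hk
      rw [IsTest.apply_zero_of_tsupport hk0, IsTest.deriv_zero_of_tsupport hk0, zero_smul,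
        zero_smul, sub_zero, zero_add] at e3
      have e4 : ∫ x, deriv (deriv k) x • G x = ∫ x in Ioi (0 : ℝ), deriv (deriv k) x • G x := by
        refine (setIntegral_eq_integral_of_forall_compl_eq_zero fun x hx => ?_).symm
        rw [IsTest.deriv_eq_zero fun h => hx (hk0 (IsTest.tsupport_deriv_subset h)), zero_smul]
      simp only [smul_sub]
      rw [integral_sub (hk.deriv.deriv.integrable_smul (locallyIntegrable_indicator y))
        (hk.deriv.deriv.integrable_smul hGc.locallyIntegrable), integral_smul_indicator, e4, ← e3,
        e2, ← h1, e1]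
      abel
  have hy : y =ᵐ[volume.restrict (Ioi 0)] fun x : ℝ => G x + (α + x * β) := by
    rw [EventuallyEq, ae_restrict_iff' measurableSet_Ioi]
    filter_upwards [hαβ] with x hx h0
    have := hx h0
    rw [indicator_of_mem h0] at this
    rw [← this]; ring
  refine ⟨fun x : ℝ => G x + (α + x * β), fun x => G' x + β, κ, ⟨hκR, fun x hx => ?_, fun x hx => ?_⟩,
    hy, ?_⟩
  · rw [intervalIntegral.integral_add (hG'c.intervalIntegrable _ _) (by simp)]
    simp [hG]
    ring
  · simp [hG', add_comm]
  · filter_upwards [hy, ae_restrict_mem measurableSet_Ioi] with x hx hx0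
    rw [← hx, hκ, indicator_of_mem hx0]
    ring

end SturmLiouville

end WaveSpectrum

namespace WaveSpectrum

/-! ### The Dirichlet condition in the form domain -/

section FormDomain

variable {q k l : ℝ → ℝ}

theorem realL2_sub (hk : MemLp (fun x => (k x : ℂ)) 2 (volume.restrict (Ioi (0 : ℝ))))
    (hl : MemLp (fun x => (l x : ℂ)) 2 (volume.restrict (Ioi (0 : ℝ)))) :
    realL2 (k - l) = realL2 k - realL2 l := by
  have h : MemLp (fun x => (((k - l) x : ℝ) : ℂ)) 2 (volume.restrict (Ioi (0 : ℝ))) := by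
    refine (hk.sub hl).ae_eq (Eventually.of_forall fun x => ?_)
    simp
  refine Lp.ext ?_
  filter_upwards [coeFn_realL2 h, coeFn_realL2 hk, coeFn_realL2 hl,
    Lp.coeFn_sub (realL2 k) (realL2 l)] with x h1 h2 h3 h4
  rw [h1, h4]
  simp only [Pi.sub_apply]
  rw [h2, h3, Complex.ofReal_sub]

theorem IsTest.comp_mul (hk : IsTest k) {c : ℝ} (hc : c ≠ 0) : IsTest fun x => k (c * x) :=
  ⟨hk.contDiff.comp (contDiff_const.mul contDiff_id), by
    simpa only [smul_eq_mul] using hk.compact.comp_smul hc⟩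

theorem IsTest.exists_bound (hk : IsTest k) : ∃ A, 0 ≤ A ∧ ∀ x, |k x| ≤ A := by
  obtain ⟨A, hA⟩ := hk.compact.exists_bound_of_continuous hk.continuous
  exact ⟨|A|, abs_nonneg _, fun x => (hA x).trans (le_abs_self A)⟩

theorem IsTest.exists_bound_mul_abs (hk : IsTest k) (h0 : k 0 = 0) :
    ∃ A, 0 ≤ A ∧ ∀ x, |k x| ≤ A * |x| := by
  obtain ⟨A, hA0, hA⟩ := hk.deriv.exists_bound
  refine ⟨A, hA0, fun x => ?_⟩
  have := convex_univ.norm_image_sub_le_of_norm_deriv_le (f := k) (C := A)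
    (fun y _ => hk.differentiable y) (fun y _ => hA y) (mem_univ 0) (mem_univ x)
  simpa [h0] using this

theorem IsTest.deriv_rescale (hk : IsTest k) {c : ℝ} (hc : c ≠ 0) :
    (_root_.deriv fun x => c⁻¹ * k (c * x)) = fun x => _root_.deriv k (c * x) := by
  ext x
  have h := ((hk.hasDerivAt (c * x)).comp x ((hasDerivAt_id x).const_mul c)).const_mul c⁻¹
  rw [show (fun x => c⁻¹ * k (c * x)) = fun x => c⁻¹ * (k ∘ fun x => c * x) x from rfl]
  refine h.deriv.trans ?_
  field_simp

theorem IsTest.deriv_comp_mul (hk : IsTest k) (c : ℝ) :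
    (_root_.deriv fun x => k (c * x)) = fun x => c * _root_.deriv k (c * x) := by
  ext x
  have h := (hk.hasDerivAt (c * x)).comp x ((hasDerivAt_id x).const_mul c)
  refine h.deriv.trans ?_
  ring

/-- Test functions with `k(0) = 0` lie in the form domain. -/
theorem IsTest.realL2_mem_formDomain (hq : ContinuousOn q (Ici 0)) (hk : IsTest k) (h0 : k 0 = 0) :
    realL2 k ∈ formDomain (sturmLiouvilleOp q) := by
  obtain ⟨A, hA0, hA⟩ := hk.exists_bound_mul_abs h0
  obtain ⟨R1, hR1, hkR⟩ := hk.exists_bound_support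
  obtain ⟨R2, hR2, hkR2⟩ := hk.deriv.deriv.exists_bound_support
  obtain ⟨A', hA'0, hA'⟩ : ∃ A', 0 ≤ A' ∧ ∀ x, |x * _root_.deriv (_root_.deriv k) x| ≤ A' := by
    obtain ⟨D, hD0, hD⟩ := hk.deriv.deriv.exists_bound
    refine ⟨R2 * D, by positivity, fun x => ?_⟩
    rcases le_total R2 |x| with h | h
    · rw [hkR2 x h, mul_zero, abs_zero]; positivity
    · rw [abs_mul]; exact mul_le_mul h (hD x) (abs_nonneg _) hR2.le
  set R := max R1 R2 with hR
  have hRpos : 0 < R := lt_max_of_lt_left hR1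
  obtain ⟨Q, hQ0, hQ⟩ := exists_bound_potential hq R
  -- A shrinking corrector: `W n` has the value `0` and the slope `k'(0)` at `0` and tends to `0`,
  -- so `k - W n` is in the minimal domain and converges to `k`. The scaling keeps `|W n x| ≤ A x`
  -- and `x |(W n)'' x| ≤ A'` uniformly in `n`.
  set W : ℕ → ℝ → ℝ := fun n x => ((n : ℝ) + 1)⁻¹ * k (((n : ℝ) + 1) * x) with hW
  have hn : ∀ n : ℕ, (n : ℝ) + 1 ≠ 0 := fun n => by positivity
  have hWt : ∀ n, IsTest (W n) := fun n => (hk.comp_mul (hn n)).const_mul _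
  have hWd : ∀ n, _root_.deriv (W n) = fun x => _root_.deriv k (((n : ℝ) + 1) * x) :=
    fun n => hk.deriv_rescale (hn n)
  have hWdd : ∀ n, _root_.deriv (_root_.deriv (W n)) =
      fun x => ((n : ℝ) + 1) * _root_.deriv (_root_.deriv k) (((n : ℝ) + 1) * x) :=
    fun n => by rw [hWd, hk.deriv.deriv_comp_mul]
  have hW0 : ∀ n, W n 0 = 0 := fun n => by simp [hW, h0]
  have hWd0 : ∀ n, _root_.deriv (W n) 0 = _root_.deriv k 0 := fun n => by simp [hWd]
  have hWb : ∀ n x, 0 < x → |W n x| ≤ A * x := fun n x hx => by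
    have := hA (((n : ℝ) + 1) * x)
    have hp : 0 < (n : ℝ) + 1 := by positivity
    rw [abs_mul ((n : ℝ) + 1), abs_of_pos hp, abs_of_pos hx] at this
    simp only [hW]
    rw [abs_mul, abs_of_pos (inv_pos.2 hp), inv_mul_le_iff₀ hp]
    linarith
  have hWddb : ∀ n x, 0 < x → x * |_root_.deriv (_root_.deriv (W n)) x| ≤ A' := fun n x hx => by
    have := hA' (((n : ℝ) + 1) * x)
    have hp : 0 < (n : ℝ) + 1 := by positivity
    rw [mul_right_comm, mul_comm, abs_mul, abs_of_pos hx] at this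
    rw [hWdd]
    exact this
  have hz : ∀ (n : ℕ) x, 0 < x → R ≤ ((n : ℝ) + 1) * x →
      W n x = 0 ∧ _root_.deriv (_root_.deriv (W n)) x = 0 := fun n x hx h => by
    have hp : 0 < ((n : ℝ) + 1) * x := by positivity
    rw [hWdd]
    simp only [hW]
    rw [hkR _ (by rw [abs_of_pos hp]; exact (le_max_left _ _).trans h),
      hkR2 _ (by rw [abs_of_pos hp]; exact (le_max_right _ _).trans h)]
    simp
  have hzR : ∀ n x, R ≤ x → W n x = 0 ∧ _root_.deriv (_root_.deriv (W n)) x = 0 :=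
    fun n x hx => hz n x (hRpos.trans_le hx) (by
      have : (0 : ℝ) ≤ n := by positivity
      nlinarith)
  have hev : ∀ x, 0 < x → ∀ᶠ n : ℕ in atTop, R ≤ ((n : ℝ) + 1) * x := fun x hx => by
    have : Tendsto (fun n : ℕ => ((n : ℝ) + 1) * x) atTop atTop :=
      (tendsto_atTop_add_const_right _ _ tendsto_natCast_atTop_atTop).atTop_mul_const hx
    exact this.eventually_ge_atTop R
  have hdiff : ∀ {k l : ℝ → ℝ}, IsTest k → IsTest l →
      _root_.deriv (k - l) = _root_.deriv k - _root_.deriv l := fun hk hl =>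
    funext fun x => deriv_sub (hk.differentiable x) (hl.differentiable x)
  have hg : ∀ n, (realL2 (k - W n), realL2 (slExpr q (k - W n))) ∈ (sturmLiouvilleOp q).graph :=
    fun n => by
      rw [sturmLiouvilleOp_graph]
      refine (hk.sub (hWt n)).mem_sturmLiouvilleGraph hq (by simp [h0, hW0]) ?_
      rw [hdiff hk (hWt n), Pi.sub_apply, hWd0, sub_self]
  have hgW : ∀ n m, (realL2 (W n - W m), realL2 (slExpr q (W n - W m))) ∈
      (sturmLiouvilleOp q).graph :=
    fun n m => by
      rw [sturmLiouvilleOp_graph]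
      refine ((hWt n).sub (hWt m)).mem_sturmLiouvilleGraph hq (by simp [hW0]) ?_
      rw [hdiff (hWt n) (hWt m), Pi.sub_apply, hWd0, hWd0, sub_self]
  choose u hu1 hu2 using fun n => (LinearPMap.mem_graph_iff _).1 (hg n)
  simp only at hu1 hu2
  refine Submodule.subset_span ⟨u, ?_, ?_⟩
  · simp only [hu1]
    have hfin : volume.restrict (Ioi (0 : ℝ)) (Ioc 0 R) ≠ ∞ := by
      rw [Measure.restrict_apply measurableSet_Ioc]
      exact ((measure_mono inter_subset_left).trans_lt measure_Ioc_lt_top).ne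
    refine tendsto_of_ae_tendsto (f := fun n x => ((k - W n) x : ℂ)) (f₀ := fun x => (k x : ℂ))
      (g := indicatorConstLp 2 measurableSet_Ioc hfin ((A * R : ℝ) : ℂ)) (fun n => coeFn_realL2 (hk.sub (hWt n)).memLp)
      (coeFn_realL2 hk.memLp) (fun n => ?_) ?_
    · filter_upwards [ae_restrict_mem measurableSet_Ioi, indicatorConstLp_coeFn (p := 2)
        (hs := measurableSet_Ioc) (hμs := hfin) (c := ((A * R : ℝ) : ℂ))] with x hx hi
      rw [hi]
      simp only [Pi.sub_apply, Complex.ofReal_sub, sub_sub_cancel_left, norm_neg,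
        Complex.norm_real, Real.norm_eq_abs]
      rcases le_total R x with h | h
      · rw [(hzR n x h).1, abs_zero]; positivity
      · rw [indicator_of_mem (show x ∈ Ioc 0 R from ⟨hx, h⟩), Complex.norm_real, Real.norm_eq_abs,
          abs_of_nonneg (by positivity : 0 ≤ A * R)]
        exact (hWb n x hx).trans (mul_le_mul_of_nonneg_left h hA0)
    · filter_upwards [ae_restrict_mem measurableSet_Ioi] with x hx
      refine tendsto_const_nhds.congr' ?_
      filter_upwards [hev x hx] with n hn
      simp [(hz n x hx hn).1]
  · have hin : ∀ p : ℕ × ℕ, inner ℂ (sturmLiouvilleOp q (u p.1 - u p.2))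
        ((u p.1 - u p.2 : (sturmLiouvilleOp q).domain) : HalfLineL2) =
        ∫ x in Ioi (0 : ℝ), ((slExpr q (W p.2 - W p.1) x * (W p.2 - W p.1) x : ℝ) : ℂ) := by
      rintro ⟨n, m⟩
      obtain ⟨w, hw1, hw2⟩ := (LinearPMap.mem_graph_iff _).1 (hgW m n)
      simp only at hw1 hw2
      have e : u n - u m = w := by
        refine Subtype.ext ?_
        rw [hw1, AddSubgroupClass.coe_sub, hu1, hu1,
          ← realL2_sub (hk.sub (hWt n)).memLp (hk.sub (hWt m)).memLp]
        congr 1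
        abel
      simp only
      rw [e, hw1, hw2, inner_realL2 (((hWt m).sub (hWt n)).memLp_slExpr hq)]
      refine integral_congr_ae ?_
      filter_upwards [coeFn_realL2 ((hWt m).sub (hWt n)).memLp] with x hx
      rw [hx, Complex.real_smul, Complex.ofReal_mul]
    simp only [hin]
    have hF : ∀ n m x, 0 < x → slExpr q (W m - W n) x * (W m - W n) x =
        -((_root_.deriv (_root_.deriv (W m)) x - _root_.deriv (_root_.deriv (W n)) x) *
          (W m x - W n x)) + q x * (W m x - W n x) ^ 2 := fun n m x hx => by
      rw [slExpr, hdiff (hWt m) (hWt n), hdiff (hWt m).deriv (hWt n).deriv]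
      simp only [Pi.sub_apply]
      ring
    rw [show (0 : ℂ) = ∫ x in Ioi (0 : ℝ), (0 : ℂ) by simp]
    -- In the form of `W m - W n`, the bounds `2A'/x` on the second derivative and `2Ax` on the
    -- function multiply to `4A'A`: the singularity at `0` cancels. The potential term is bounded by
    -- `Q (2AR)²`.
    refine tendsto_integral_filter_of_dominated_convergence
      ((Ioc 0 R).indicator fun _ => 4 * A' * A + Q * (2 * A * R) ^ 2) ?_ ?_ ?_ ?_
    · refine Eventually.of_forall fun p => ?_
      have h1 := (((hWt p.2).sub (hWt p.1)).memLp_slExpr hq).aestronglyMeasurable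
      have h2 := ((hWt p.2).sub (hWt p.1)).memLp.aestronglyMeasurable
      refine (h1.mul h2).congr (Eventually.of_forall fun x => ?_)
      simp
    · refine Eventually.of_forall fun p => ?_
      filter_upwards [ae_restrict_mem measurableSet_Ioi] with x (hx : 0 < x)
      rw [Complex.norm_real, Real.norm_eq_abs, hF _ _ _ hx]
      rcases le_total R x with h | h
      · rw [(hzR p.1 x h).1, (hzR p.1 x h).2, (hzR p.2 x h).1, (hzR p.2 x h).2]
        simp only [sub_zero, mul_zero, neg_zero, ne_eq, OfNat.ofNat_ne_zero, not_false_eq_true,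
          zero_pow, add_zero, abs_zero]
        exact indicator_nonneg (fun _ _ => by positivity) _
      · rw [indicator_of_mem (show x ∈ Ioc 0 R from ⟨hx, h⟩)]
        have b1 : |W p.2 x - W p.1 x| ≤ 2 * A * x :=
          (abs_sub _ _).trans (by linarith [hWb p.1 x hx, hWb p.2 x hx])
        have b2 : x * |_root_.deriv (_root_.deriv (W p.2)) x -
            _root_.deriv (_root_.deriv (W p.1)) x| ≤ 2 * A' :=
          (mul_le_mul_of_nonneg_left (abs_sub _ _) hx.le).trans
            (by linarith [hWddb p.1 x hx, hWddb p.2 x hx])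
        refine (abs_add_le _ _).trans (add_le_add ?_ ?_)
        · rw [abs_neg, abs_mul]
          refine (mul_le_mul_of_nonneg_left b1 (abs_nonneg _)).trans ?_
          nlinarith
        · rw [abs_mul, abs_pow]
          refine mul_le_mul (hQ x hx.le h) (pow_le_pow_left₀ (abs_nonneg _) (b1.trans ?_) 2)
            (by positivity) hQ0
          gcongr
    · refine Integrable.mono_measure ?_ Measure.restrict_le_self
      rw [integrable_indicator_iff measurableSet_Ioc]
      exact integrableOn_const measure_Ioc_lt_top.ne
    · filter_upwards [ae_restrict_mem measurableSet_Ioi] with x (hx : 0 < x)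
      refine tendsto_const_nhds.congr' ?_
      have h1 := (tendsto_fst (f := atTop (α := ℕ)) (g := atTop (α := ℕ))).eventually (hev x hx)
      have h2 := (tendsto_snd (f := atTop (α := ℕ)) (g := atTop (α := ℕ))).eventually (hev x hx)
      rw [prod_atTop_atTop_eq] at h1 h2
      filter_upwards [h1, h2] with p hp1 hp2
      rw [hF _ _ _ hx, (hz _ x hx hp1).1, (hz _ x hx hp2).1]
      simp

theorem exists_isTest_eq_mul {ρ : ℝ} (hρ : 0 < ρ) :
    ∃ χ, IsTest χ ∧ (∀ x, |x| ≤ ρ → χ x = 1) ∧ tsupport χ ⊆ Metric.closedBall 0 (2 * ρ) := by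
  let f : ContDiffBump (0 : ℝ) := ⟨ρ, 2 * ρ, hρ, by linarith⟩
  refine ⟨f, ⟨f.contDiff, f.hasCompactSupport⟩, fun x hx => f.one_of_mem_closedBall ?_,
    f.tsupport_eq.subset⟩
  simpa using hx

/-- The functions in the range of `B` vanish at `0`. -/
theorem IsRegular.apply_zero {B : HalfLineL2 →L[ℂ] HalfLineL2} (hq : ContinuousOn q (Ici 0))
    (hB : IsFriedrichsInverse (sturmLiouvilleOp q) B) {r : HalfLineL2} {f f' f'' : ℝ → ℂ}
    (hr : IsRegular q (B r) r f f' f'') : f 0 = 0 := by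
  obtain ⟨χ, hχ, hχ1, -⟩ := exists_isTest_eq_mul one_pos
  -- With value `0` and slope `1` at the origin, `xχ` is in the domain of `L`. Symmetry of `B` makes
  -- the left side of Green's formula vanish, and the right side is `f 0`.
  have hθ : IsTest fun x => x * χ x := ⟨contDiff_id.mul hχ.contDiff, hχ.compact.mul_left⟩
  have h0 : (fun x => x * χ x) 0 = 0 := by simp
  have h1 : deriv (fun x => x * χ x) 0 = 1 := by
    have := (hasDerivAt_id (0 : ℝ)).mul (hχ.hasDerivAt 0)
    refine this.deriv.trans ?_
    rw [hχ1 0 (by simp)]; simp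
  have h2 := hB.eq _ _ (hθ.mem_adjoint_graph hq) (hθ.realL2_mem_formDomain hq h0)
  have h3 := hr.integral_green hθ hq
  rw [← hB.inner_left_eq, h2, sub_self, h1] at h3
  simpa using h3.symm

end FormDomain

end WaveSpectrum

/-! ### Pointwise values of functions in the range of the inverse -/

namespace WaveSpectrum

/-- Pointwise values `e r` of the odd extension of `B r`, and of its derivative `e' r`. -/
structure IsEvaluation (q : ℝ → ℝ) (B : HalfLineL2 →L[ℂ] HalfLineL2)
    (e e' : HalfLineL2 →ₗ[ℂ] (ℝ → ℂ)) : Prop where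
  ae_eq : ∀ r, B r =ᵐ[volume.restrict (Ioi 0)] e r
  apply_neg : ∀ r x, e r (-x) = -e r x
  hasDerivAt : ∀ r x, HasDerivAt (e r) (e' r x) x
  continuous_deriv : ∀ r, Continuous (e' r)
  hasDerivAt_deriv : ∀ r x, HasDerivAt (e' (B r)) ((q |x| : ℂ) * e (B r) x - e r x) x
  bound : ∀ R : ℝ, ∃ C : ℝ, ∀ x, |x| ≤ R → ∀ r, ‖e r x‖ ≤ C * ‖r‖
  bound_deriv : ∀ R : ℝ, ∃ C : ℝ, ∀ x, |x| ≤ R → ∀ r, ‖e' r x‖ ≤ C * ‖r‖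
  green : ∀ k, IsTest k → ∀ r, inner ℂ (realL2 (slExpr q k)) (B r) - inner ℂ (realL2 k) r =
    -(k 0 • e' r 0)

/-- Upgrades almost everywhere identities between primitives to pointwise identities of continuous
densities; it makes the pointwise derivative linear in `r`. -/
theorem eq_zero_of_ae_integral_eq_zero {g : ℝ → ℂ} (hg : Continuous g)
    (h : ∀ᵐ x ∂volume.restrict (Ioi (0 : ℝ)), ∫ s in (0 : ℝ)..x, g s = 0) {x : ℝ} (hx : 0 ≤ x) :
    g x = 0 := by
  have hd : ∀ x, HasDerivAt (fun x => ∫ s in (0 : ℝ)..x, g s) (g x) x := fun x =>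
    (hg.integral_hasStrictDerivAt 0 x).hasDerivAt
  have h1 : EqOn (fun x => ∫ s in (0 : ℝ)..x, g s) 0 (Ioi 0) :=
    Measure.eqOn_open_of_ae_eq (μ := volume) h isOpen_Ioi
      (fun x _ => (hd x).continuousAt.continuousWithinAt) continuousOn_const
  have h2 : EqOn g 0 (Ioi 0) := fun x hx => by
    have h3 : HasDerivAt (fun _ : ℝ => (0 : ℂ)) (g x) x :=
      (hd x).congr_of_eventuallyEq (by
        filter_upwards [isOpen_Ioi.mem_nhds hx] with y hy using (h1 hy).symm)
    exact h3.unique (hasDerivAt_const x 0)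
  have h3 := h2.closure hg continuous_const
  rw [closure_Ioi] at h3
  exact h3 hx

theorem integral_norm_Ioc_le (y : HalfLineL2) {R : ℝ} (hR : 0 ≤ R) :
    ∫ x in Ioc 0 R, ‖y x‖ ≤ (R + 1) * ‖y‖ := by
  have hle : volume.restrict (Ioc 0 R) ≤ volume.restrict (Ioi (0 : ℝ)) :=
    Measure.restrict_mono (fun x hx => hx.1) le_rfl
  rcases eq_or_ne y 0 with rfl | hy
  · have : ∫ x in Ioc 0 R, ‖(0 : HalfLineL2) x‖ = 0 := by
      refine integral_eq_zero_of_ae ?_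
      filter_upwards [ae_mono hle (Lp.coeFn_zero ℂ 2 (volume.restrict (Ioi (0 : ℝ))))] with x hx
      rw [hx]; simp
    rw [this]; simp
  have ha : 0 < ‖y‖ := norm_pos_iff.2 hy
  have hi2 : IntegrableOn (fun x => ‖y x‖ ^ 2) (Ioc 0 R) :=
    (integrable_norm_sq y).mono_measure hle
  have hs : ∫ x in Ioc 0 R, ‖y x‖ ^ 2 ≤ ‖y‖ ^ 2 := by
    rw [norm_sq_eq_integral]
    exact setIntegral_mono_set (integrable_norm_sq y) (Eventually.of_forall fun x => by positivity)
      (Eventually.of_forall fun x (hx : x ∈ Ioc 0 R) => hx.1)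
  have hi : IntegrableOn (fun x => (‖y‖ + ‖y‖⁻¹ * ‖y x‖ ^ 2)) (Ioc 0 R) :=
    (integrableOn_const measure_Ioc_lt_top.ne).add (hi2.const_mul _)
  have h1 : ∫ x in Ioc 0 R, ‖y x‖ ≤ ∫ x in Ioc 0 R, (‖y‖ + ‖y‖⁻¹ * ‖y x‖ ^ 2) := by
    refine integral_mono_of_nonneg (Eventually.of_forall fun x => norm_nonneg _) hi
      (Eventually.of_forall fun x => ?_)
    -- Young's inequality replaces Cauchy-Schwarz, at the cost of the constant `R + 1` in place of
    -- `√R`.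
    have h2 : ‖y‖ * ‖y x‖ ≤ ‖y‖ ^ 2 + ‖y x‖ ^ 2 := by
      nlinarith [sq_nonneg (‖y‖ - ‖y x‖), sq_nonneg ‖y‖, sq_nonneg ‖y x‖]
    have h3 : ‖y x‖ = ‖y‖⁻¹ * (‖y‖ * ‖y x‖) := by field_simp
    have h4 : ‖y‖ + ‖y‖⁻¹ * ‖y x‖ ^ 2 = ‖y‖⁻¹ * (‖y‖ ^ 2 + ‖y x‖ ^ 2) := by field_simp
    refine h3.le.trans (le_of_le_of_eq ?_ h4.symm)
    exact mul_le_mul_of_nonneg_left h2 (by positivity)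
  refine h1.trans ?_
  have hc : IntegrableOn (fun _ : ℝ => ‖y‖) (Ioc 0 R) := integrableOn_const measure_Ioc_lt_top.ne
  rw [integral_add hc (hi2.const_mul _), integral_const_mul, setIntegral_const]
  have h5 : ‖y‖⁻¹ * ∫ x in Ioc 0 R, ‖y x‖ ^ 2 ≤ ‖y‖ := by
    rw [inv_mul_le_iff₀ ha, ← sq]; exact hs
  have h6 : volume.real (Ioc 0 R) = R := by simp [hR]
  rw [h6, smul_eq_mul]
  linarith

theorem IsH2Loc.continuousOn_deriv {f f' f'' : ℝ → ℂ} (h : IsH2Loc f f' f'') :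
    ContinuousOn f' (Ici 0) := by
  have hκi : ∀ a b, IntervalIntegrable ((Ioi (0 : ℝ)).indicator f'') volume a b := fun a b => by
    rw [intervalIntegrable_iff, integrableOn_indicator_iff measurableSet_Ioi]
    have h1 : IntegrableOn f'' (Ioc 0 (max a b)) := (h.memLp (max a b)).integrable (by norm_num)
    exact h1.mono_set fun x hx => ⟨hx.1, (uIoc_subset_uIcc hx.2).2⟩
  have hc : Continuous fun x => f' 0 + ∫ s in (0 : ℝ)..x, (Ioi (0 : ℝ)).indicator f'' s :=
    continuous_const.add (intervalIntegral.continuous_primitive hκi 0)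
  refine hc.continuousOn.congr fun x hx => ?_
  have hx0 : (0 : ℝ) ≤ x := hx
  simp only
  rw [h.deriv_eq_integral x hx0, intervalIntegral.integral_of_le hx0,
    intervalIntegral.integral_of_le hx0]
  congr 1
  refine setIntegral_congr_fun measurableSet_Ioc fun s hs => ?_
  rw [indicator_of_mem (show s ∈ Ioi (0 : ℝ) from hs.1)]

/-- The derivative of the representative of `B r` is extended evenly and integrated from `0`.
Because the representative vanishes at `0`, the result is its odd extension, of class `C¹` across
`0`, and the Dirichlet problem becomes an equation on the line with the potential `q |x|`. -/
theorem exists_isEvaluation {q : ℝ → ℝ} {B : HalfLineL2 →L[ℂ] HalfLineL2}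
    (hq : ContinuousOn q (Ici 0)) (hB : IsFriedrichsInverse (sturmLiouvilleOp q) B) :
    ∃ e e', IsEvaluation q B e e' := by
  choose F F' F'' hF using fun r => exists_isRegular hq (hB.graph r)
  have hF0 : ∀ r, F r 0 = 0 := fun r => (hF r).apply_zero hq hB
  set D : HalfLineL2 → ℝ → ℂ := fun r x => F' r |x| with hD
  have hDc : ∀ r, Continuous (D r) := fun r =>
    (hF r).isH2Loc.continuousOn_deriv.comp_continuous continuous_abs fun x => abs_nonneg x
  have hDabs : ∀ r x, D r |x| = D r x := fun r x => by simp [hD]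
  set E : HalfLineL2 → ℝ → ℂ := fun r x => ∫ s in (0 : ℝ)..x, D r s with hE
  have hEF : ∀ r x, 0 ≤ x → F r x = E r x := fun r x hx => by
    rw [(hF r).isH2Loc.eq_integral x hx, hF0, zero_add]
    refine intervalIntegral.integral_congr fun s hs => ?_
    rw [uIcc_of_le hx] at hs
    simp only [hD, abs_of_nonneg hs.1]
  have hEd : ∀ r x, HasDerivAt (E r) (D r x) x := fun r x =>
    ((hDc r).integral_hasStrictDerivAt 0 x).hasDerivAt
  have hEc : ∀ r, Continuous (E r) := fun r =>
    continuous_iff_continuousAt.2 fun x => (hEd r x).continuousAt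
  have hEneg : ∀ r x, E r (-x) = -E r x := fun r x => by
    have h := intervalIntegral.integral_comp_neg (D r) (a := 0) (b := x)
    rw [neg_zero] at h
    simp only [hE]
    rw [intervalIntegral.integral_symm, ← h]
    congr 1
    refine intervalIntegral.integral_congr fun s _ => ?_
    simp only [hD, abs_neg]
  have hBE : ∀ r, B r =ᵐ[volume.restrict (Ioi 0)] E r := fun r => by
    filter_upwards [(hF r).fst, ae_restrict_mem measurableSet_Ioi] with x hx h0
    rw [hx, hEF r x (le_of_lt h0)]
  have hDi : ∀ r a b, IntervalIntegrable (D r) volume a b := fun r a b =>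
    (hDc r).intervalIntegrable a b
  have hadd : ∀ r s, D (r + s) = D r + D s := fun r s => by
    ext x
    have := eq_zero_of_ae_integral_eq_zero (g := fun x => D (r + s) x - (D r x + D s x))
      ((hDc _).sub ((hDc _).add (hDc _))) (by
        have hm := Lp.coeFn_add (B r) (B s)
        rw [← map_add] at hm
        filter_upwards [hBE (r + s), hBE r, hBE s, hm] with x h1 h2 h3 h4
        rw [intervalIntegral.integral_sub (hDi _ _ _) ((hDi _ _ _).add (hDi _ _ _)),
          intervalIntegral.integral_add (hDi _ _ _) (hDi _ _ _)]
        change E (r + s) x - (E r x + E s x) = 0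
        rw [← h1, ← h2, ← h3, h4, Pi.add_apply, sub_self]) (abs_nonneg x)
    simp only [hDabs] at this
    exact sub_eq_zero.1 this
  have hsmul : ∀ (c : ℂ) r, D (c • r) = c • D r := fun c r => by
    ext x
    have := eq_zero_of_ae_integral_eq_zero (g := fun x => D (c • r) x - c • D r x)
      ((hDc _).sub ((hDc _).const_smul c)) (by
        have hm := Lp.coeFn_smul c (B r)
        rw [← map_smul] at hm
        filter_upwards [hBE (c • r), hBE r, hm] with x h1 h2 h4
        rw [intervalIntegral.integral_sub (g := fun s => c • D r s) (hDi _ _ _)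
          ((hDi _ _ _).smul c), intervalIntegral.integral_smul]
        change E (c • r) x - c • E r x = 0
        rw [← h1, ← h2, h4, Pi.smul_apply, sub_self]) (abs_nonneg x)
    simp only [hDabs] at this
    exact sub_eq_zero.1 this
  have hEadd : ∀ r s, E (r + s) = E r + E s := fun r s => by
    ext x
    simp only [hE, hadd, Pi.add_apply]
    exact intervalIntegral.integral_add (hDi _ _ _) (hDi _ _ _)
  have hEsmul : ∀ (c : ℂ) r, E (c • r) = c • E r := fun c r => by
    ext x
    simp only [hE, hsmul, Pi.smul_apply]
    exact intervalIntegral.integral_smul _ _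
  have hgreen : ∀ k, IsTest k → ∀ r, inner ℂ (realL2 (slExpr q k)) (B r) -
      inner ℂ (realL2 k) r = -(k 0 • D r 0) := fun k hk r => by
    rw [(hF r).integral_green hk hq, hF0, smul_zero, zero_sub]
    simp only [hD, abs_zero]
  have hbd : ∀ R : ℝ, 0 ≤ R → ∃ C : ℝ, ∀ x, |x| ≤ R → ∀ r, ‖D r x‖ ≤ C * ‖r‖ := fun R hR => by
    obtain ⟨χ, hχ, hχ1, -⟩ := exists_isTest_eq_mul one_pos
    obtain ⟨Q, hQ0, hQ⟩ := exists_bound_potential hq R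
    -- Green's formula with `χ(0) = 1` expresses the endpoint derivative through inner products,
    -- hence boundedly in `r`.
    have h0 : ∀ r, ‖D r 0‖ ≤ (‖realL2 (slExpr q χ)‖ * ‖B‖ + ‖realL2 χ‖) * ‖r‖ := fun r => by
      have h := hgreen χ hχ r
      rw [hχ1 0 (by simp), one_smul] at h
      rw [← norm_neg, ← h, add_mul, mul_assoc]
      refine (norm_sub_le _ _).trans (add_le_add ?_ (norm_inner_le_norm _ _))
      exact (norm_inner_le_norm _ _).trans
        (mul_le_mul_of_nonneg_left (B.le_opNorm r) (norm_nonneg _))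
    refine ⟨(‖realL2 (slExpr q χ)‖ * ‖B‖ + ‖realL2 χ‖) + (Q * (R + 1) * ‖B‖ + (R + 1)),
      fun x hx r => ?_⟩
    have h1 : D r x = D r 0 + ∫ s in (0 : ℝ)..|x|, F'' r s := by
      simp only [hD, abs_zero]
      exact (hF r).isH2Loc.deriv_eq_integral _ (abs_nonneg x)
    have hle : volume.restrict (Ioc 0 R) ≤ volume.restrict (Ioi (0 : ℝ)) :=
      Measure.restrict_mono (fun x hx => hx.1) le_rfl
    have hint : ∀ y : HalfLineL2, IntegrableOn (fun x => ‖y x‖) (Ioc 0 R) := fun y =>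
      (((Lp.memLp y).mono_measure hle).integrable (by norm_num)).norm
    have h2 : ‖∫ s in (0 : ℝ)..|x|, F'' r s‖ ≤ ∫ s in Ioc 0 R, (Q * ‖B r s‖ + ‖r s‖) := by
      rw [intervalIntegral.integral_of_le (abs_nonneg x)]
      refine (norm_integral_le_integral_norm _).trans ?_
      have hiF : IntegrableOn (fun s => ‖F'' r s‖) (Ioc 0 R) :=
        (((hF r).isH2Loc.memLp R).integrable (by norm_num)).norm
      refine (setIntegral_mono_set hiF (Eventually.of_forall fun _ => norm_nonneg _)
        (Ioc_subset_Ioc_right hx).eventuallyLE).trans ?_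
      refine integral_mono_ae hiF (((hint _).const_mul Q).add (hint _)) ?_
      filter_upwards [ae_mono hle (hF r).fst, ae_mono hle (hF r).snd,
        ae_restrict_mem measurableSet_Ioc] with s h3 h4 hs
      have h5 : F'' r s = (q s : ℂ) * B r s - r s := by rw [h4, h3]; ring
      rw [h5]
      refine (norm_sub_le _ _).trans ?_
      rw [norm_mul, Complex.norm_real, Real.norm_eq_abs]
      gcongr
      exact hQ s hs.1.le hs.2
    rw [integral_add ((hint _).const_mul Q) (hint _), integral_const_mul] at h2
    have h6 := integral_norm_Ioc_le (B r) hR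
    have h7 := integral_norm_Ioc_le r hR
    have h8 := B.le_opNorm r
    have h9 : Q * ∫ s in Ioc 0 R, ‖B r s‖ ≤ Q * ((R + 1) * (‖B‖ * ‖r‖)) :=
      mul_le_mul_of_nonneg_left (h6.trans (by gcongr)) hQ0
    rw [h1]
    refine (norm_add_le _ _).trans ?_
    have := h0 r
    linarith
  have hbd' : ∀ R : ℝ, ∃ C : ℝ, ∀ x, |x| ≤ R → ∀ r, ‖D r x‖ ≤ C * ‖r‖ := fun R => by
    obtain ⟨C, hC⟩ := hbd |R| (abs_nonneg R)
    exact ⟨C, fun x hx r => hC x (hx.trans (le_abs_self R)) r⟩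
  refine ⟨⟨⟨E, hEadd⟩, hEsmul⟩, ⟨⟨D, hadd⟩, hsmul⟩, hBE, hEneg, hEd, hDc, fun r x => ?_,
    fun R => ?_, hbd', hgreen⟩
  · change HasDerivAt (D (B r)) ((q |x| : ℂ) * E (B r) x - E r x) x
    set G : ℝ → ℂ := fun x => (q |x| : ℂ) * E (B r) x - E r x with hG
    have hGc : Continuous G := by
      have hqc : Continuous fun x => q |x| :=
        hq.comp_continuous continuous_abs fun x => abs_nonneg x
      exact ((Complex.continuous_ofReal.comp hqc).mul (hEc _)).sub (hEc _)
    -- `G` is odd, so its primitive is even, in agreement with the even extension of the derivative;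
    -- the equation therefore holds across `0` too.
    have hGneg : ∀ x, ∫ s in (0 : ℝ)..-x, G s = ∫ s in (0 : ℝ)..x, G s := fun x => by
      have h := intervalIntegral.integral_comp_neg G (a := 0) (b := x)
      rw [neg_zero] at h
      rw [intervalIntegral.integral_symm, ← h, ← intervalIntegral.integral_neg]
      refine intervalIntegral.integral_congr fun s _ => ?_
      simp only [hG, abs_neg, hEneg]
      ring
    have hDG : D (B r) = fun x => D (B r) 0 + ∫ s in (0 : ℝ)..x, G s := by
      ext x
      have h1 : ∫ s in (0 : ℝ)..x, G s = ∫ s in (0 : ℝ)..|x|, G s := by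
        rcases abs_choice x with h | h <;> rw [h]
        rw [hGneg]
      have h2 : ∫ s in (0 : ℝ)..|x|, G s = ∫ s in (0 : ℝ)..|x|, F'' (B r) s := by
        rw [intervalIntegral.integral_of_le (abs_nonneg x),
          intervalIntegral.integral_of_le (abs_nonneg x)]
        have hle : volume.restrict (Ioc 0 |x|) ≤ volume.restrict (Ioi (0 : ℝ)) :=
          Measure.restrict_mono (fun x hx => hx.1) le_rfl
        refine integral_congr_ae ?_
        filter_upwards [ae_mono hle (hF (B r)).snd, ae_mono hle (hBE r),
          ae_restrict_mem measurableSet_Ioc] with s h3 h4 hs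
        rw [hEF _ s hs.1.le] at h3
        simp only [hG, abs_of_pos hs.1]
        rw [← h4, h3]
        ring
      rw [h1, h2]
      simp only [hD, abs_zero]
      exact (hF (B r)).isH2Loc.deriv_eq_integral _ (abs_nonneg x)
    rw [hDG]
    exact ((hGc.integral_hasStrictDerivAt 0 x).hasDerivAt).const_add _
  · obtain ⟨C, hC⟩ := hbd' R
    refine ⟨C * |R|, fun x hx r => ?_⟩
    change ‖∫ s in (0 : ℝ)..x, D r s‖ ≤ _
    have h := intervalIntegral.norm_integral_le_of_norm_le_const (a := 0) (b := x) (f := D r)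
      (C := C * ‖r‖) fun s hs => hC s (by
        have := abs_sub_left_of_mem_uIcc (uIoc_subset_uIcc hs)
        simp only [sub_zero] at this
        exact this.trans hx) r
    rw [sub_zero] at h
    have hC0 : 0 ≤ C * ‖r‖ := (norm_nonneg _).trans (hC x hx r)
    refine h.trans ?_
    rw [mul_right_comm C |R|]
    exact mul_le_mul_of_nonneg_left (hx.trans (le_abs_self R)) hC0

end WaveSpectrum

namespace WaveSpectrum

/-! ### Domain of dependence and sideways uniqueness -/

section Waves

variable {q : ℝ → ℝ} {B : HalfLineL2 →L[ℂ] HalfLineL2} {e e' : HalfLineL2 →ₗ[ℂ] (ℝ → ℂ)}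

theorem real_smul_eq (d : ℝ) (y : HalfLineL2) : d • y = (d : ℂ) • y :=
  (algebraMap_smul ℂ d y).symm

namespace IsEvaluation

variable (he : IsEvaluation q B e e') (hB : 0 ≤ B)

include he

theorem continuous (r : HalfLineL2) : Continuous (e r) :=
  continuous_iff_continuousAt.2 fun x => (he.hasDerivAt r x).continuousAt

theorem apply_zero (r : HalfLineL2) : e r 0 = 0 := by
  have h := he.apply_neg r 0
  rw [neg_zero] at h
  exact self_eq_neg.1 h

include hB

theorem hasDerivAt_deriv_sineOf (z : HalfLineL2) (s x : ℝ) :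
    HasDerivAt (e' (sineOf B s (B z)))
      ((q |x| : ℂ) * e (sineOf B s (B z)) x - e (sineOf B s z) x) x := by
  have h := he.hasDerivAt_deriv (sineOf B s z) x
  rwa [apply_sineOf hB] at h

/-- As `e r` gives the values of `B r`, the function `e (sineOf B t (B z)) x` is the wave with
initial velocity `B² z`, and `e (cosineOf B t z) x` is its time derivative. Differentiating along a
curve `(p, X)` in space-time covers the characteristics. -/
theorem hasDerivAt_wave {z : HalfLineL2} {p X : ℝ → ℝ} {c d s : ℝ} (hp : HasDerivAt p d s)
    (hX : HasDerivAt X c s) : HasDerivAt (fun σ => e (sineOf B (p σ) (B z)) (X σ))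
      (d * e (cosineOf B (p s) z) (X s) + c * e' (sineOf B (p s) (B z)) (X s)) s := by
  have h1 : HasDerivAt (fun σ => sineOf B (p σ) (B z)) (d • cosineOf B (p s) z) s :=
    (hasDerivAt_sineOf_apply hB (p s) z).scomp s hp
  have h2 := hasDerivAt_eval e he.bound h1 hX (he.hasDerivAt _ _) (he.continuous _).continuousAt
  convert h2 using 2
  rw [real_smul_eq, map_smul]; rfl

theorem hasDerivAt_wave_time {z : HalfLineL2} {p X : ℝ → ℝ} {c d s : ℝ} (hp : HasDerivAt p d s)
    (hX : HasDerivAt X c s) : HasDerivAt (fun σ => e (cosineOf B (p σ) z) (X σ))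
      (-d * e (sineOf B (p s) z) (X s) + c * e' (cosineOf B (p s) z) (X s)) s := by
  have h1 : HasDerivAt (fun σ => cosineOf B (p σ) z) (d • -sineOf B (p s) z) s :=
    (hasDerivAt_cosineOf_apply hB (p s) z).scomp s hp
  have h2 := hasDerivAt_eval e he.bound h1 hX (he.hasDerivAt _ _) (he.continuous _).continuousAt
  convert h2 using 2
  rw [real_smul_eq, map_smul, map_neg]
  simp

theorem hasDerivAt_wave_space {z : HalfLineL2} {p X : ℝ → ℝ} {c d s : ℝ} (hp : HasDerivAt p d s)
    (hX : HasDerivAt X c s) : HasDerivAt (fun σ => e' (sineOf B (p σ) (B z)) (X σ))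
      (d * e' (cosineOf B (p s) z) (X s) + c * ((q |X s| : ℂ) * e (sineOf B (p s) (B z)) (X s) -
        e (sineOf B (p s) z) (X s))) s := by
  have h1 : HasDerivAt (fun σ => sineOf B (p σ) (B z)) (d • cosineOf B (p s) z) s :=
    (hasDerivAt_sineOf_apply hB (p s) z).scomp s hp
  have h2 := hasDerivAt_eval e' he.bound_deriv h1 hX (he.hasDerivAt_deriv_sineOf hB z _ _)
    (he.continuous_deriv _).continuousAt
  convert h2 using 2
  rw [real_smul_eq, map_smul]; rfl

omit he hB in
theorem exists_bound_wave (he : IsEvaluation q B e e') (z : HalfLineL2) (R T : ℝ) :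
    ∃ M : ℝ, ∀ x t, |x| ≤ R → |t| ≤ T → ‖e (sineOf B t (B z)) x‖ ≤ M := by
  obtain ⟨C, hC⟩ := he.bound R
  refine ⟨|C| * (|T| * ‖B z‖), fun x t hx ht => (hC x hx _).trans ?_⟩
  refine mul_le_mul (le_abs_self C) ?_ (norm_nonneg _) (abs_nonneg C)
  refine ((sineOf B t).le_of_opNorm_le (norm_sineOf_le t) _).trans ?_
  exact mul_le_mul_of_nonneg_right (ht.trans (le_abs_self T)) (norm_nonneg _)

/-- Domain of dependence of a wave. -/
theorem wave_eq_zero (hq : ContinuousOn q (Ici 0)) {z : HalfLineL2} {x₀ R : ℝ}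
    (h : ∀ x, |x - x₀| < R → e (B z) x = 0) {t x : ℝ} (ht : 0 ≤ t) (hx : |x - x₀| + t < R) :
    e (sineOf B t (B z)) x = 0 := by
  have h' : ∀ x, |x - x₀| < R → e' (B z) x = 0 := fun x hx => by
    have h1 : HasDerivAt (fun _ : ℝ => (0 : ℂ)) (e' (B z) x) x := by
      refine (he.hasDerivAt (B z) x).congr_of_eventuallyEq ?_
      filter_upwards [(continuous_abs.comp (continuous_id.sub continuous_const)).isOpen_preimage
        _ isOpen_Iio |>.mem_nhds (show x ∈ _ from hx)] with y hy
      exact (h y hy).symm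
    exact h1.unique (hasDerivAt_const x 0)
  obtain ⟨Q, hQ0, hQ⟩ := exists_bound_potential hq (|x₀| + R)
  obtain ⟨M, hM⟩ := he.exists_bound_wave z (|x₀| + R) R
  have hloc : ∀ s ρ, 0 ≤ s → |ρ - x₀| + s < R → |ρ| ≤ |x₀| + R ∧ |s| ≤ R := fun s ρ hs hρ => by
    have := abs_sub_abs_le_abs_sub ρ x₀
    have := abs_nonneg (ρ - x₀)
    rw [abs_of_nonneg hs]
    constructor <;> linarith
  -- With `u` the wave, `u_tt - u_xx = -q u`. Take `v = u`, `a = u_t + u_x`, `b = u_t - u_x`: the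
  -- latter two change along the characteristics `x ± t = const` only through `-q u`.
  refine eq_zero_of_characteristic_system (R := R) (ρ₀ := x₀) (C := Q) (M := M)
    (v := fun s ρ => e (sineOf B s (B z)) ρ)
    (a := fun s ρ => e (cosineOf B s z) ρ + e' (sineOf B s (B z)) ρ)
    (b := fun s ρ => e (cosineOf B s z) ρ - e' (sineOf B s (B z)) ρ)
    (Q := fun _ ρ => -(q |ρ| : ℂ)) ?_ ?_ ?_ ?_ ?_ ?_ ?_ ?_ ht hx
  · intro s ρ _ _
    refine (he.hasDerivAt_wave hB (z := z) (hasDerivAt_id s) (hasDerivAt_const s ρ)).congr_deriv ?_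
    simp only [id]
    push_cast
    ring
  · intro s ρ _ _
    have hX : HasDerivAt (fun σ => ρ + s - σ) (-1) s := (hasDerivAt_id s).const_sub (ρ + s)
    have h1 := (he.hasDerivAt_wave_time hB (z := z) (hasDerivAt_id s) hX).add
      (he.hasDerivAt_wave_space hB (z := z) (hasDerivAt_id s) hX)
    refine h1.congr_deriv ?_
    simp only [id, add_sub_cancel_right]
    push_cast; ring
  · intro s ρ _ _
    have hX : HasDerivAt (fun σ => ρ - s + σ) 1 s := (hasDerivAt_id s).const_add (ρ - s)
    have h1 := (he.hasDerivAt_wave_time hB (z := z) (hasDerivAt_id s) hX).sub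
      (he.hasDerivAt_wave_space hB (z := z) (hasDerivAt_id s) hX)
    refine h1.congr_deriv ?_
    simp only [id, sub_add_cancel]
    push_cast; ring
  · intro ρ _; simp [sineOf_zero]
  · intro ρ hρ; simp [sineOf_zero, cosineOf_zero hB, h ρ hρ]
  · intro ρ hρ; simp [sineOf_zero, cosineOf_zero hB, h ρ hρ]
  · intro s ρ hs hρ
    simp only [norm_neg, Complex.norm_real, Real.norm_eq_abs]
    exact hQ _ (abs_nonneg _) (hloc s ρ hs hρ).1
  · intro s ρ hs hρ
    exact hM _ _ (hloc s ρ hs hρ).1 (hloc s ρ hs hρ).2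

/-- Sideways uniqueness: a wave with zero Cauchy data on `{x₀} × (-R, R)` vanishes in the
characteristic rhombus, and so does the velocity at time zero. -/
theorem eq_zero_of_cauchy_data (hq : ContinuousOn q (Ici 0)) {z : HalfLineL2} {x₀ R : ℝ}
    (h : ∀ t, |t| < R → e (sineOf B t (B z)) x₀ = 0)
    (h' : ∀ t, |t| < R → e' (sineOf B t (B z)) x₀ = 0) {x : ℝ} (hx : |x - x₀| < R) :
    e (B z) x = 0 := by
  have hzero : ∀ {x : ℝ} {T : ℝ}, (∀ t, |t| < T → e (sineOf B t (B z)) x = 0) →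
      ∀ t, |t| < T → e (cosineOf B t z) x = 0 := fun {x T} h t ht => by
    have h1 := he.hasDerivAt_wave hB (z := z) (hasDerivAt_id t) (hasDerivAt_const t x)
    have h2 : HasDerivAt (fun _ : ℝ => (0 : ℂ)) (e (cosineOf B t z) x) t := by
      refine HasDerivAt.congr_of_eventuallyEq (f := fun σ => e (sineOf B (id σ) (B z)) x) ?_ ?_
      · exact h1.congr_deriv (by simp)
      · filter_upwards [continuous_abs.isOpen_preimage _ isOpen_Iio |>.mem_nhds
          (show t ∈ _ from ht)] with y hy
        exact (h y hy).symm
    exact h2.unique (hasDerivAt_const t 0)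
  have hpos : 0 ≤ R := (abs_nonneg _).trans hx.le
  obtain ⟨Q, hQ0, hQ⟩ := exists_bound_potential hq (|x₀| + R)
  obtain ⟨M, hM⟩ := he.exists_bound_wave z (|x₀| + R) R
  -- Now the distance `s` from `x₀` is the evolution variable, `ρ` is the time, and `ε = ±1` chooses
  -- the side. In one dimension the wave equation keeps its form, with `Q = q` instead of `-q`.
  have key : ∀ ε : ℝ, |ε| = 1 → ∀ s ρ, 0 ≤ s → |ρ - 0| + s < R →
      e (sineOf B ρ (B z)) (x₀ + ε * s) = 0 := by
    intro ε hε s ρ hs hρ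
    have hεε : (ε : ℂ) * ε = 1 := by
      rw [← Complex.ofReal_mul, ← abs_mul_abs_self, hε]; simp
    have hloc : ∀ s ρ, 0 ≤ s → |ρ - 0| + s < R → |x₀ + ε * s| ≤ |x₀| + R ∧ |ρ| ≤ R :=
        fun s ρ hs hρ => by
      rw [sub_zero] at hρ
      have h1 := abs_add_le x₀ (ε * s)
      rw [abs_mul, hε, one_mul, abs_of_nonneg hs] at h1
      have := abs_nonneg ρ
      constructor <;> linarith
    have hX : ∀ s, HasDerivAt (fun σ => x₀ + ε * σ) ε s := fun s => by
      simpa using ((hasDerivAt_id s).const_mul ε).const_add x₀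
    refine eq_zero_of_characteristic_system (R := R) (ρ₀ := 0) (C := Q) (M := M)
      (v := fun s ρ => e (sineOf B ρ (B z)) (x₀ + ε * s))
      (a := fun s ρ => ε * e' (sineOf B ρ (B z)) (x₀ + ε * s) + e (cosineOf B ρ z) (x₀ + ε * s))
      (b := fun s ρ => ε * e' (sineOf B ρ (B z)) (x₀ + ε * s) - e (cosineOf B ρ z) (x₀ + ε * s))
      (Q := fun s _ => (q |x₀ + ε * s| : ℂ)) ?_ ?_ ?_ ?_ ?_ ?_ ?_ ?_ hs hρ
    · intro s ρ _ _
      refine (he.hasDerivAt_wave hB (z := z) (hasDerivAt_const s ρ) (hX s)).congr_deriv ?_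
      push_cast
      ring
    · intro s ρ _ _
      have hp : HasDerivAt (fun σ => ρ + s - σ) (-1) s := (hasDerivAt_id s).const_sub (ρ + s)
      have h1 := ((he.hasDerivAt_wave_space hB (z := z) hp (hX s)).const_mul (ε : ℂ)).add
        (he.hasDerivAt_wave_time hB (z := z) hp (hX s))
      refine h1.congr_deriv ?_
      simp only [add_sub_cancel_right]
      push_cast
      linear_combination ((q |x₀ + ε * s| : ℂ) * e (sineOf B ρ (B z)) (x₀ + ε * s) -
        e (sineOf B ρ z) (x₀ + ε * s)) * hεε
    · intro s ρ _ _
      have hp : HasDerivAt (fun σ => ρ - s + σ) 1 s := (hasDerivAt_id s).const_add (ρ - s)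
      have h1 := ((he.hasDerivAt_wave_space hB (z := z) hp (hX s)).const_mul (ε : ℂ)).sub
        (he.hasDerivAt_wave_time hB (z := z) hp (hX s))
      refine h1.congr_deriv ?_
      simp only [sub_add_cancel]
      push_cast
      linear_combination ((q |x₀ + ε * s| : ℂ) * e (sineOf B ρ (B z)) (x₀ + ε * s) -
        e (sineOf B ρ z) (x₀ + ε * s)) * hεε
    · intro ρ hρ
      rw [sub_zero] at hρ
      simpa using h ρ hρ
    · intro ρ hρ
      rw [sub_zero] at hρ
      simp [h' ρ hρ, hzero h ρ hρ]
    · intro ρ hρ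
      rw [sub_zero] at hρ
      simp [h' ρ hρ, hzero h ρ hρ]
    · intro s ρ hs hρ
      simp only [Complex.norm_real, Real.norm_eq_abs]
      exact hQ _ (abs_nonneg _) (hloc s ρ hs hρ).1
    · intro s ρ hs hρ
      exact hM _ _ (hloc s ρ hs hρ).1 (hloc s ρ hs hρ).2
  have hv : ∀ t, |t| < R - |x - x₀| → e (sineOf B t (B z)) x = 0 := fun t ht => by
    have hρ : |t - 0| + |x - x₀| < R := by rw [sub_zero]; linarith
    rcases le_total 0 (x - x₀) with hs | hs
    · have := key 1 (by simp) _ t (abs_nonneg (x - x₀)) hρ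
      rw [abs_of_nonneg hs] at this
      simpa using this
    · have := key (-1) (by simp) _ t (abs_nonneg (x - x₀)) hρ
      rw [abs_of_nonpos hs] at this
      simpa using this
  have := hzero hv 0 (by rw [abs_zero]; linarith)
  rwa [cosineOf_zero hB] at this

end IsEvaluation

end Waves

end WaveSpectrum

namespace WaveSpectrum

/-! ### Closed subspaces and mollification in time -/

section ClosedSubspaces

variable {H : Type*} [NormedAddCommGroup H] [InnerProductSpace ℂ H]

theorem closedSpan_le {S : Set H} {K : ClosedSubmodule ℂ H} : closedSpan S ≤ K ↔ S ⊆ K := by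
  rw [closedSpan, Submodule.closure_le, Submodule.span_le]
  rfl

theorem subset_closedSpan (S : Set H) : S ⊆ closedSpan S := closedSpan_le.1 le_rfl

variable [CompleteSpace H]

theorem le_of_orthogonal_le {K M : ClosedSubmodule ℂ H} (h : K.orthogonal ≤ M.orthogonal) :
    M ≤ K := by
  have := ClosedSubmodule.orthogonal_le h
  rwa [ClosedSubmodule.orthogonal_orthogonal_eq, ClosedSubmodule.orthogonal_orthogonal_eq] at this

/-- Test against the orthogonal complement; without integrability the integral is `0` by convention,
which also lies in `K`. -/
theorem integral_mem {α : Type*} [MeasurableSpace α] {μ : Measure α} {f : α → H}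
    (K : ClosedSubmodule ℂ H) (h : ∀ᵐ x ∂μ, f x ∈ K) : ∫ x, f x ∂μ ∈ K := by
  by_cases hf : Integrable f μ
  · rw [← ClosedSubmodule.orthogonal_orthogonal_eq K]
    intro u hu
    rw [← integral_inner hf]
    refine integral_eq_zero_of_ae ?_
    filter_upwards [h] with x hx
    rw [← inner_conj_symm, hu _ hx]
    simp
  · rw [integral_undef hf]
    exact K.toSubmodule.zero_mem

variable {B : H →L[ℂ] H} (hB : 0 ≤ B)

include hB

/-- By the product formula, twice the left side is the integral of `σ ↦ (g, S_σ w)` over `(τ - ε, τ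
+ ε)`, with `S_σ` the sine operator, that is, of `σ β`. Linear dependence on time thus survives
mollification on a shorter interval; `β = 0` covers orthogonality. -/
theorem inner_sineOf_apply_sineOf {g w : H} {β : ℂ} {t ε τ : ℝ}
    (h : ∀ τ : ℝ, |τ| < t → inner ℂ g (sineOf B τ w) = τ * β) (hε : 0 ≤ ε) (hτ : |τ| < t - ε) :
    inner ℂ g (sineOf B τ (sineOf B ε w)) = τ * (ε * β) := by
  have h1 := congrArg (fun A : H →L[ℂ] H => inner ℂ g (A w)) (sineOf_mul_sineOf hB τ ε)
  simp only [smul_apply, mul_apply_eq_comp, sub_apply, inner_sub_right] at h1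
  rw [← Complex.coe_smul, inner_smul_right] at h1
  have hd : ∀ σ, HasDerivAt (fun σ => inner ℂ g (cosineOf B σ w)) (-inner ℂ g (sineOf B σ w)) σ :=
    fun σ => by
      have := ((innerSL ℂ g).restrictScalars ℝ).hasFDerivAt.comp_hasDerivAt σ
        (hasDerivAt_cosineOf_apply hB σ w)
      exact this.congr_deriv (by simp)
  have hc : Continuous fun σ => -inner ℂ g (sineOf B σ w) :=
    (continuous_const.inner ((continuous_sineOf hB).clm_apply continuous_const)).neg
  have h2 := intervalIntegral.integral_eq_sub_of_hasDerivAt (a := τ - ε) (b := τ + ε)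
    (fun σ _ => hd σ) (hc.intervalIntegrable _ _)
  have h3 : ∫ σ in (τ - ε)..(τ + ε), -inner ℂ g (sineOf B σ w) =
      ∫ σ in (τ - ε)..(τ + ε), (σ : ℂ) * (-β) := by
    refine intervalIntegral.integral_congr fun σ hσ => ?_
    rw [uIcc_of_le (by linarith)] at hσ
    have : |σ| < t := by
      rw [abs_lt] at hτ ⊢
      constructor <;> linarith [hσ.1, hσ.2]
    rw [h σ this, mul_neg]
  rw [h3, intervalIntegral.integral_mul_const, intervalIntegral.integral_ofReal, integral_id] at h2
  push_cast at h1 h2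
  linear_combination h1 / 2 + h2 / 2

theorem inner_sineOf_apply_sineOf_pow {g w : H} {β : ℂ} {t ε : ℝ}
    (h : ∀ τ : ℝ, |τ| < t → inner ℂ g (sineOf B τ w) = τ * β) (hε : 0 ≤ ε) (n : ℕ) :
    ∀ τ : ℝ, |τ| < t - n * ε → inner ℂ g (sineOf B τ ((sineOf B ε ^ n) w)) = τ * (ε ^ n * β) := by
  induction n with
  | zero => simpa using h
  | succ n ih =>
    intro τ hτ
    rw [pow_succ', mul_apply_eq_comp,
      inner_sineOf_apply_sineOf hB ih hε (by push_cast at hτ; linarith), pow_succ']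
    ring

end ClosedSubspaces

/-! ### Propagation of supports and the wave isotony -/

section Propagation

variable {q k : ℝ → ℝ} {B : HalfLineL2 →L[ℂ] HalfLineL2} {e e' : HalfLineL2 →ₗ[ℂ] (ℝ → ℂ)}

/-- By duality: a vector orthogonal to `K` annihilates the test functions supported in `U`, so it
vanishes on `U`. -/
theorem L2On_le_of_realL2_mem {U : Set ℝ} (hU : IsOpen U) {K : ClosedSubmodule ℂ HalfLineL2}
    (h : ∀ k, IsTest k → tsupport k ⊆ Ioi 0 → tsupport k ⊆ U → realL2 k ∈ K) : L2On U ≤ K := by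
  refine le_of_orthogonal_le fun y hy => ?_
  rw [L2On_orthogonal hU.measurableSet, mem_L2On_iff hU.measurableSet.compl]
  have := ae_eq_zero_of_integral_smul (y := y) hU fun k hk hk0 hkU => by
    rw [← inner_realL2 hk.memLp]
    exact hy _ (h k hk hk0 hkU)
  simpa using this

/-- Smoothness of `q` matters only near the support of `k`, which stays away from `0`; elsewhere the
product `q k` vanishes. So the differential expression can be iterated on such functions. -/
theorem IsTest.slExpr_of_tsupport (hq : ContDiffOn ℝ (⊤ : ℕ∞) q (Ici 0)) (hk : IsTest k)
    (hk0 : tsupport k ⊆ Ioi 0) : IsTest (slExpr q k) ∧ tsupport (slExpr q k) ⊆ tsupport k := by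
  have hsub : tsupport (slExpr q k) ⊆ tsupport k := by
    refine closure_minimal (fun x hx => ?_) (isClosed_tsupport _)
    by_contra hcon
    refine hx ?_
    rw [slExpr, image_eq_zero_of_notMem_tsupport hcon,
      IsTest.deriv_eq_zero fun h => hcon (IsTest.tsupport_deriv_subset h)]
    simp
  refine ⟨⟨contDiff_iff_contDiffAt.2 fun x => ?_, hk.compact.of_isClosed_subset
    (isClosed_tsupport _) hsub⟩, hsub⟩
  refine hk.deriv.deriv.contDiff.contDiffAt.neg.add ?_
  by_cases hx : x ∈ tsupport k
  · exact (hq.contDiffAt (Ici_mem_nhds (hk0 hx))).mul hk.contDiff.contDiffAt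
  · refine (contDiffAt_const (c := (0 : ℝ))).congr_of_eventuallyEq ?_
    filter_upwards [(isClosed_tsupport k).isOpen_compl.mem_nhds hx] with y hy
    rw [image_eq_zero_of_notMem_tsupport hy, mul_zero]

theorem IsTest.apply_slExpr (hq : ContinuousOn q (Ici 0))
    (hB : IsFriedrichsInverse (sturmLiouvilleOp q) B) (hk : IsTest k) (hk0 : tsupport k ⊆ Ioi 0) :
    B (realL2 (slExpr q k)) = realL2 k := by
  refine hB.eq_of_mem_graph ?_
  rw [sturmLiouvilleOp_graph]
  exact hk.mem_sturmLiouvilleGraph hq (IsTest.apply_zero_of_tsupport hk0)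
    (IsTest.deriv_zero_of_tsupport hk0)

/-- Apply the differential expression twice. Data in the range of `B²` generate waves to which the
pointwise uniqueness theorems apply. -/
theorem IsTest.exists_realL2_eq (hq : ContDiffOn ℝ (⊤ : ℕ∞) q (Ici 0))
    (hB : IsFriedrichsInverse (sturmLiouvilleOp q) B) (hk : IsTest k) (hk0 : tsupport k ⊆ Ioi 0) :
    ∃ z, realL2 k = B (B z) := by
  obtain ⟨h1, h2⟩ := hk.slExpr_of_tsupport hq hk0
  refine ⟨realL2 (slExpr q (slExpr q k)), ?_⟩
  rw [h1.apply_slExpr hq.continuousOn hB (h2.trans hk0), hk.apply_slExpr hq.continuousOn hB hk0]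

namespace IsEvaluation

variable (he : IsEvaluation q B e e')

include he

theorem eq_zero_of_ae {r : HalfLineL2} {V : Set ℝ} (hV : IsOpen V) (hV0 : V ⊆ Ioi 0)
    (h : ∀ᵐ x ∂volume.restrict (Ioi (0 : ℝ)), x ∈ V → B r x = 0) {x : ℝ} (hx : x ∈ V) :
    e r x = 0 := by
  refine Measure.eqOn_open_of_ae_eq (μ := volume) (g := 0) ?_ hV (he.continuous r).continuousOn
    continuousOn_const hx
  filter_upwards [ae_restrict_of_ae_restrict_of_subset hV0 h,
    ae_restrict_of_ae_restrict_of_subset hV0 (he.ae_eq r), ae_restrict_mem hV.measurableSet]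
    with x h1 h2 h3
  rw [← h2, h1 h3, Pi.zero_apply]

theorem mem_L2On_compl {r : HalfLineL2} {V : Set ℝ} (hV : MeasurableSet V)
    (h : ∀ x, 0 < x → x ∈ V → e r x = 0) : B r ∈ L2On Vᶜ := by
  rw [mem_L2On_iff hV.compl]
  filter_upwards [he.ae_eq r, ae_restrict_mem measurableSet_Ioi] with x hx h0 hxV
  rw [hx, h x h0 (not_not.1 hxV)]

theorem deriv_eq_zero {r : HalfLineL2} {V : Set ℝ} (hV : IsOpen V) (h : ∀ x ∈ V, e r x = 0)
    {x : ℝ} (hx : x ∈ V) : e' r x = 0 := by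
  have h1 : HasDerivAt (fun _ : ℝ => (0 : ℂ)) (e' r x) x := by
    refine (he.hasDerivAt r x).congr_of_eventuallyEq ?_
    filter_upwards [hV.mem_nhds hx] with y hy using (h y hy).symm
  exact h1.unique (hasDerivAt_const x 0)

/-- Finite speed: outside the `t`-neighborhood of `U`, the initial velocity vanishes on the whole
interval of radius `t` about the point. -/
theorem sineOf_mem_L2On_thickening (hB : 0 ≤ B) (hq : ContinuousOn q (Ici 0)) {z : HalfLineL2}
    {U : Set ℝ} (hU : MeasurableSet U) (hz : B (B z) ∈ L2On U) {t : ℝ} (ht : 0 ≤ t) :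
    sineOf B t (B (B z)) ∈ L2On (Metric.thickening t (U ∩ Ioi 0)) := by
  rcases ht.eq_or_lt with rfl | ht
  · rw [sineOf_zero]
    exact (L2On _).toSubmodule.zero_mem
  rw [← compl_compl (Metric.thickening t (U ∩ Ioi 0)), ← apply_sineOf hB]
  refine he.mem_L2On_compl Metric.isOpen_thickening.measurableSet.compl fun x hx hxU => ?_
  rw [mem_L2On_iff hU] at hz
  have h0 : ∀ y, 0 < y → |y - x| < t → e (B z) y = 0 := fun y hy hyx => by
    refine he.eq_zero_of_ae (V := Metric.ball x t ∩ Ioi 0) (Metric.isOpen_ball.inter isOpen_Ioi)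
      inter_subset_right ?_ ⟨hyx, hy⟩
    filter_upwards [hz] with u hu hu'
    refine hu fun huU => hxU (Metric.mem_thickening_iff.2 ⟨u, ⟨huU, hu'.2⟩, ?_⟩)
    rw [dist_comm]
    exact hu'.1
  -- The interval may cross the boundary. For `y < 0` the mirror point `-y` is closer to `x > 0`
  -- than `y` is, so oddness reduces to the previous case.
  have h1 : ∀ y, |y - x| < t → e (B z) y = 0 := fun y hyx => by
    rcases lt_trichotomy y 0 with hy | hy | hy
    · rw [← neg_neg y, he.apply_neg, h0 (-y) (by linarith), neg_zero]
      rw [abs_lt] at hyx ⊢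
      constructor <;> linarith
    · rw [hy, he.apply_zero]
    · exact h0 y hy hyx
  -- The domain of dependence is open, which gives only times `s < t`; the time `t` follows by
  -- continuity.
  have hc : Continuous fun s => e (sineOf B s (B z)) x := continuous_iff_continuousAt.2 fun s =>
    (he.hasDerivAt_wave hB (hasDerivAt_id s) (hasDerivAt_const s x)).continuousAt
  have h2 : EqOn (fun s => e (sineOf B s (B z)) x) 0 (Ico 0 t) := fun s hs =>
    he.wave_eq_zero hB hq h1 hs.1 (by simpa using hs.2)
  have h3 := h2.closure hc continuous_const
  rw [closure_Ico ht.ne] at h3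
  exact h3 (right_mem_Icc.2 ht.le)

-- Reduction to mollified vectors: they lie in the range of `B²`, approximate `w` after division by
-- `ε⁶`, and may be controlled on a neighborhood smaller by `6ε`. Letting `ε → 0` exhausts the open
-- neighborhood.
omit he in
theorem mem_L2On_compl_thickening (hB : 0 ≤ B) (hd : DenseRange B)
    (he : IsEvaluation q B e e') {A : Set ℝ} {t : ℝ} {w : HalfLineL2}
    (h : ∀ ε : ℝ, 0 < ε → ∀ z, (sineOf B ε ^ 6) w = B (B z) → ∀ x, 0 < x →
      x ∈ Metric.thickening (t - 6 * ε) A → e (B z) x = 0) :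
    w ∈ L2On (Metric.thickening t A)ᶜ := by
  have h1 : ∀ n : ℕ, w ∈ L2On (Metric.thickening (t - 6 * (n + 1 : ℝ)⁻¹) A)ᶜ := fun n => by
    refine (L2On _).isClosed.mem_of_tendsto (tendsto_inv_smul_sineOf_pow hB hd 6 w) ?_
    have hn : (0 : ℝ) < (n + 1 : ℝ)⁻¹ := by positivity
    filter_upwards [Ioo_mem_nhdsGT hn] with ε hε
    obtain ⟨z, hz⟩ := exists_sineOf_pow_eq hB ε w
    rw [hz, ← Complex.coe_smul]
    refine (L2On _).toSubmodule.smul_mem _ ?_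
    refine he.mem_L2On_compl Metric.isOpen_thickening.measurableSet fun x hx hxA => ?_
    exact h ε hε.1 z hz x hx (Metric.thickening_mono (by linarith [hε.2]) A hxA)
  have hm : ∀ s, MeasurableSet (Metric.thickening s A)ᶜ := fun s =>
    Metric.isOpen_thickening.measurableSet.compl
  simp only [mem_L2On_iff (hm _), mem_compl_iff, not_not, Metric.mem_thickening_iff] at h1 ⊢
  filter_upwards [ae_all_iff.2 h1] with x hx
  rintro ⟨u, hu, hux⟩
  obtain ⟨n, hn⟩ := exists_nat_one_div_lt (show 0 < (t - dist x u) / 6 by linarith)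
  refine hx n ⟨u, hu, ?_⟩
  rw [one_div] at hn
  linarith

/-- Unique continuation: a wave that does not touch `U` on the time interval `(-t, t)` has zero
velocity at time `0` in the `t`-neighborhood of `U`. -/
theorem mem_L2On_compl_of_forall_sineOf (hB : 0 ≤ B) (hd : DenseRange B)
    (hq : ContinuousOn q (Ici 0)) {U : Set ℝ} (hU : IsOpen U) (hU0 : U ⊆ Ioi 0) {t : ℝ}
    {w : HalfLineL2} (h : ∀ τ : ℝ, |τ| < t → sineOf B τ w ∈ L2On Uᶜ) :
    w ∈ L2On (Metric.thickening t U)ᶜ := by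
  refine mem_L2On_compl_thickening hB hd he fun ε hε z hz x hx hxU => ?_
  have h1 : ∀ τ : ℝ, |τ| < t - 6 * ε → ∀ u ∈ U, e (sineOf B τ (B z)) u = 0 := fun τ hτ u hu => by
    refine he.eq_zero_of_ae hU hU0 ?_ hu
    have hmem : B (sineOf B τ (B z)) ∈ L2On Uᶜ := by
      rw [apply_sineOf hB, ← hz, ← L2On_orthogonal hU.measurableSet]
      intro g hg
      have h2 : ∀ τ : ℝ, |τ| < t → inner ℂ g (sineOf B τ w) = τ * 0 := fun τ hτ => by
        have := h τ hτ
        rw [← L2On_orthogonal hU.measurableSet] at this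
        rw [this g hg, mul_zero]
      have h3 := inner_sineOf_apply_sineOf_pow hB h2 hε.le 6 τ (by exact_mod_cast hτ)
      rw [mul_zero, mul_zero] at h3
      exact h3
    rw [mem_L2On_iff hU.measurableSet.compl] at hmem
    simpa using hmem
  obtain ⟨u, hu, hux⟩ := Metric.mem_thickening_iff.1 hxU
  exact he.eq_zero_of_cauchy_data hB hq (fun τ hτ => h1 τ hτ u hu)
    (fun τ hτ => he.deriv_eq_zero hU (h1 τ hτ) hu) hux

end IsEvaluation

/-- Test functions supported in `U` span `L₂(U)` topologically and lie in the range of `B²`, so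
finite speed extends from them to all of `L₂(U)`. -/
theorem sineOf_apply_mem_L2On_thickening (hq : ContDiffOn ℝ (⊤ : ℕ∞) q (Ici 0))
    (hB : IsFriedrichsInverse (sturmLiouvilleOp q) B) {U : Set ℝ} (hU : IsOpen U) {t : ℝ}
    (ht : 0 ≤ t) {g : HalfLineL2} (hg : g ∈ L2On U) :
    sineOf B t g ∈ L2On (Metric.thickening t (U ∩ Ioi 0)) := by
  obtain ⟨e, e', he⟩ := exists_isEvaluation hq.continuousOn hB
  refine L2On_le_of_realL2_mem (K := (L2On _).comap (sineOf B t)) hU (fun k hk hk0 hkU => ?_) hg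
  obtain ⟨z, hz⟩ := hk.exists_realL2_eq hq hB hk0
  rw [ClosedSubmodule.mem_comap, hz]
  refine he.sineOf_mem_L2On_thickening hB.nonneg hq.continuousOn hU.measurableSet ?_ ht
  rw [← hz, mem_L2On_iff hU.measurableSet]
  filter_upwards [coeFn_realL2 hk.memLp] with x hx hxU
  rw [hx, image_eq_zero_of_notMem_tsupport fun h => hxU (hkU h), Complex.ofReal_zero]

/-- The wave isotony on the subspaces `L₂(U)` with an open set `U` is given by the metric
neighborhoods. -/
theorem waveIsotony_L2On (hq : ContDiffOn ℝ (⊤ : ℕ∞) q (Ici 0))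
    (hB : IsFriedrichsInverse (sturmLiouvilleOp q)
      (boundedInverse (friedrichs (sturmLiouvilleOp q)))) {U : Set ℝ} (hU : IsOpen U) {t : ℝ≥0}
    (ht : 0 < t) : waveIsotony (sturmLiouvilleOp q) t (L2On U) =
      L2On (Metric.thickening t (U ∩ Ioi 0)) := by
  rw [waveIsotony, if_neg ht.ne']
  have ht' : (0 : ℝ) < t := ht
  have hU' : IsOpen (U ∩ Ioi 0) := hU.inter isOpen_Ioi
  have hmT : MeasurableSet (Metric.thickening (t : ℝ) (U ∩ Ioi 0)) :=
    Metric.isOpen_thickening.measurableSet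
  refine le_antisymm (closedSpan_le.2 ?_) (le_of_orthogonal_le fun w hw => ?_)
  · rintro v ⟨g, hg, -, rfl⟩
    rw [intervalIntegral.integral_of_le ht'.le]
    refine integral_mem _ ?_
    filter_upwards [ae_restrict_mem measurableSet_Ioc] with s hs
    rw [sineOp_eq]
    refine L2On_mono (Metric.isOpen_thickening.measurableSet) hmT (Eventually.of_forall ?_)
      (sineOf_apply_mem_L2On_thickening hq hB hU (sub_nonneg.2 hs.2) (hg s))
    exact Metric.thickening_mono (by linarith [hs.1]) _
  · obtain ⟨e, e', he⟩ := exists_isEvaluation hq.continuousOn hB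
    rw [L2On_orthogonal hmT]
    refine he.mem_L2On_compl_of_forall_sineOf hB.nonneg hB.denseRange hq.continuousOn hU'
      inter_subset_right ?_
    set B := boundedInverse (friedrichs (sturmLiouvilleOp q)) with hBdef
    -- Orthogonality to all states with controls in `L₂(U)` means that the wave with initial
    -- velocity `w` does not meet `U` before time `t`; negative times follow since the sine family
    -- is odd.
    have key : ∀ τ ∈ Ioo 0 (t : ℝ), sineOf B τ w ∈ L2On (U ∩ Ioi 0)ᶜ := by
      intro τ hτ
      have heq : L2On (U ∩ Ioi 0) = L2On U := L2On_congr hU'.measurableSet hU.measurableSet (by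
        filter_upwards [ae_restrict_mem measurableSet_Ioi] with x hx
        exact and_iff_left hx)
      rw [← L2On_orthogonal hU'.measurableSet, heq]
      intro g hg
      rw [← inner_sineOf]
      -- The control `c(s) g` uses the overlap with `w` itself as amplitude, so orthogonality
      -- becomes `∫ |c|² = 0`, and `c` vanishes by continuity.
      set c : ℝ → ℂ := fun s => inner ℂ (sineOf B (t - s) g) w with hc
      have hS : Continuous fun s => sineOf B (t - s) g :=
        ((continuous_sineOf hB.nonneg).comp (continuous_const.sub continuous_id)).clm_apply
          continuous_const
      have hcc : Continuous c := hS.inner continuous_const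
      have h1 : inner ℂ (∫ s in (0 : ℝ)..t, sineOp (friedrichs (sturmLiouvilleOp q)) (t - s)
          (c s • g)) w = 0 := by
        refine hw _ (subset_closedSpan _ ⟨fun s => c s • g, fun s => (L2On U).toSubmodule.smul_mem _ hg,
          fun R => ?_, rfl⟩)
        have hcont : Continuous fun s => c s • g := hcc.smul continuous_const
        obtain ⟨C, hC⟩ := isCompact_Icc.exists_bound_of_continuousOn
          (hcont.continuousOn (s := Icc 0 R))
        refine MemLp.of_bound hcont.aestronglyMeasurable C ?_
        filter_upwards [ae_restrict_mem measurableSet_Ioc] with s hs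
        exact hC s (Ioc_subset_Icc_self hs)
      rw [← inner_conj_symm, map_eq_zero, intervalIntegral.integral_of_le ht'.le,
        ← integral_inner] at h1
      · have h2 : ∀ s, inner ℂ w (sineOp (friedrichs (sturmLiouvilleOp q)) (t - s) (c s • g)) =
            ((‖c s‖ ^ 2 : ℝ) : ℂ) := fun s => by
          rw [sineOp_eq, map_smul, inner_smul_right, ← inner_conj_symm w]
          change c s * (starRingEnd ℂ) (c s) = _
          rw [Complex.mul_conj, Complex.normSq_eq_norm_sq]
        simp only [h2] at h1
        have hi : IntegrableOn (fun s => ‖c s‖ ^ 2) (Ioc 0 (t : ℝ)) :=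
          (hcc.norm.pow 2).integrableOn_Icc.mono_set Ioc_subset_Icc_self
        rw [integral_complex_ofReal, Complex.ofReal_eq_zero, setIntegral_eq_zero_iff_of_nonneg_ae
          (Eventually.of_forall fun s => sq_nonneg _) hi] at h1
        have h3 : EqOn (fun s => ‖c s‖ ^ 2) 0 (Ioo 0 (t : ℝ)) :=
          Measure.eqOn_open_of_ae_eq (ae_restrict_of_ae_restrict_of_subset Ioo_subset_Ioc_self h1)
            isOpen_Ioo (hcc.norm.pow 2).continuousOn continuousOn_const
        have h4 := h3 (show (t : ℝ) - τ ∈ Ioo 0 (t : ℝ) from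
          ⟨by linarith [hτ.2], by linarith [hτ.1]⟩)
        simp only [Pi.zero_apply, ne_eq, OfNat.ofNat_ne_zero, not_false_eq_true, pow_eq_zero_iff,
          norm_eq_zero, hc, sub_sub_cancel] at h4
        exact h4
      · have : Continuous fun s => sineOp (friedrichs (sturmLiouvilleOp q)) (t - s) (c s • g) := by
          simp only [map_smul, sineOp_eq]
          exact hcc.smul hS
        exact this.integrableOn_Icc.mono_set Ioc_subset_Icc_self
    intro τ hτ
    rcases lt_trichotomy τ 0 with h0 | h0 | h0
    · rw [abs_of_neg h0] at hτ
      have := key (-τ) ⟨by linarith, hτ⟩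
      rw [sineOf_neg] at this
      have h2 := (L2On (U ∩ Ioi 0)ᶜ).toSubmodule.neg_mem this
      simpa using h2
    · rw [h0, sineOf_zero]
      exact (L2On _).toSubmodule.zero_mem
    · rw [abs_of_pos h0] at hτ
      exact key τ ⟨h0, hτ⟩

end Propagation

end WaveSpectrum

namespace WaveSpectrum

/-! ### Duhamel integrals with smooth time profile -/

section Duhamel

variable {k : ℝ → ℝ}

theorem IsTest.comp_sub_left (hk : IsTest k) (t : ℝ) : IsTest fun σ => k (t - σ) :=
  ⟨hk.contDiff.comp (contDiff_const.sub contDiff_id),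
    hk.compact.comp_homeomorph (Homeomorph.subLeft t)⟩

variable {H : Type*} [NormedAddCommGroup H] [InnerProductSpace ℂ H] [CompleteSpace H]
  {B : H →L[ℂ] H}

/-- The solution of `w'' + L w = k'' φ` for `k` vanishing near `-∞`, for `B = L⁻¹` and with `k`
instead of `k''`. -/
noncomputable def duhamel (B : H →L[ℂ] H) (φ : H) (k : ℝ → ℝ) (t : ℝ) : H :=
  ∫ σ in Ioi (0 : ℝ), k (t - σ) • sineOf B σ φ

theorem duhamel_eq_zero {φ : H} {t : ℝ} (h : ∀ s, s < t → k s = 0) : duhamel B φ k t = 0 := by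
  refine integral_eq_zero_of_ae ?_
  filter_upwards [ae_restrict_mem measurableSet_Ioi] with σ hσ
  rw [h _ (by linarith [show (0 : ℝ) < σ from hσ]), zero_smul]
  rfl

variable (hB : 0 ≤ B) (φ : H)

include hB

theorem continuous_sineOf_apply : Continuous fun σ => sineOf B σ φ :=
  (continuous_sineOf hB).clm_apply continuous_const

theorem integrable_duhamel (hk : IsTest k) (t : ℝ) :
    Integrable fun σ => k (t - σ) • sineOf B σ φ :=
  ((hk.comp_sub_left t).continuous.smul (continuous_sineOf_apply hB φ)).integrable_of_hasCompactSupport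
    (hk.comp_sub_left t).compact.smul_right

-- Convolution form, from which smoothness in time and the rule that derivatives fall on `k` are
-- inherited.
omit hB in
open scoped Convolution in
theorem duhamel_eq_convolution : duhamel B φ k =
    ((Ioi (0 : ℝ)).indicator fun σ => sineOf B σ φ) ⋆[(ContinuousLinearMap.lsmul ℝ ℝ).flip] k := by
  ext t
  rw [duhamel, ← integral_indicator measurableSet_Ioi, convolution_def]
  congr 1
  ext σ
  by_cases h : σ ∈ Ioi (0 : ℝ)
  · rw [indicator_of_mem h, indicator_of_mem h]; rfl
  · rw [indicator_of_notMem h, indicator_of_notMem h]; simp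

theorem locallyIntegrable_indicator_sineOf :
    LocallyIntegrable ((Ioi (0 : ℝ)).indicator fun σ => sineOf B σ φ) :=
  (continuous_sineOf_apply hB φ).locallyIntegrable.indicator measurableSet_Ioi

theorem contDiff_duhamel (hk : IsTest k) : ContDiff ℝ (⊤ : ℕ∞) (duhamel B φ k) := by
  rw [duhamel_eq_convolution]
  exact hk.compact.contDiff_convolution_right _ (locallyIntegrable_indicator_sineOf hB φ)
    hk.contDiff

theorem hasDerivAt_duhamel (hk : IsTest k) (t : ℝ) :
    HasDerivAt (duhamel B φ k) (duhamel B φ (deriv k) t) t := by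
  rw [duhamel_eq_convolution, duhamel_eq_convolution]
  exact hk.compact.hasDerivAt_convolution_right _ (locallyIntegrable_indicator_sineOf hB φ)
    (hk.contDiff.of_le (by exact_mod_cast le_top)) t

/-- Two integrations by parts, packed into one antiderivative; its boundary value at `σ = 0` is
`-k(t) B φ` because the cosine family starts at `B`. In terms of `w = duhamel B φ k` this says `B
w'' = k B φ - w`, the wave equation with source `k φ` after applying `L⁻¹`. -/
theorem apply_duhamel (hk : IsTest k) (t : ℝ) :
    B (duhamel B φ (deriv (deriv k)) t) = k t • B φ - duhamel B φ k t := by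
  have h1 : B (duhamel B φ (deriv (deriv k)) t) =
      ∫ σ in Ioi (0 : ℝ), deriv (deriv k) (t - σ) • sineOf B σ (B φ) := by
    rw [duhamel, ← B.integral_comp_comm (integrable_duhamel hB φ hk.deriv.deriv t).integrableOn]
    congr 1
    ext σ
    rw [B.map_smul_of_tower, apply_sineOf hB]
  have hX : ∀ σ : ℝ, HasDerivAt (fun σ => t - σ) (-1) σ := fun σ => (hasDerivAt_id σ).const_sub t
  have hd : ∀ σ, HasDerivAt
      (fun σ => -(deriv k (t - σ) • sineOf B σ (B φ)) - k (t - σ) • cosineOf B σ φ)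
      (deriv (deriv k) (t - σ) • sineOf B σ (B φ) + k (t - σ) • sineOf B σ φ) σ := fun σ => by
    have e1 := (((hk.deriv.hasDerivAt (t - σ)).comp σ (hX σ)).smul
      (hasDerivAt_sineOf_apply hB σ φ)).neg.sub
      (((hk.hasDerivAt (t - σ)).comp σ (hX σ)).smul (hasDerivAt_cosineOf_apply hB σ φ))
    refine e1.congr_deriv ?_
    simp only [Function.comp]
    module
  have hi1 := (integrable_duhamel hB (B φ) hk.deriv.deriv t).integrableOn (s := Ioi (0 : ℝ))
  have hi2 := (integrable_duhamel hB φ hk t).integrableOn (s := Ioi (0 : ℝ))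
  obtain ⟨R1, hR1, hk1⟩ := hk.exists_bound_support
  obtain ⟨R2, hR2, hk2⟩ := hk.deriv.exists_bound_support
  have h2 := integral_Ioi_of_hasDerivAt_of_tendsto' (a := 0) (m := 0) (fun σ _ => hd σ)
    (hi1.add hi2) (by
      refine tendsto_const_nhds.congr' ?_
      filter_upwards [eventually_ge_atTop (t + R1), eventually_ge_atTop (t + R2)] with σ h1 h2
      rw [hk1 (t - σ) (by rw [abs_of_neg (by linarith)]; linarith),
        hk2 (t - σ) (by rw [abs_of_neg (by linarith)]; linarith)]
      simp)
  rw [integral_add hi1 hi2, ← h1] at h2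
  simp only [sub_zero, sineOf_zero, zero_apply, smul_zero, neg_zero, zero_sub,
    cosineOf_zero hB, neg_neg] at h2
  exact eq_sub_of_add_eq h2

end Duhamel

/-! ### Boundary-controlled waves in the abstract setting -/

section Abstract

variable {H : Type*} [NormedAddCommGroup H] [InnerProductSpace ℂ H] [CompleteSpace H]
  {L₀ : H →ₗ.[ℂ] H} {B : H →L[ℂ] H}

omit [CompleteSpace H] in
theorem iteratedDerivWithin_two_eq {u : ℝ → H} {s : Set ℝ} {x : ℝ} :
    iteratedDerivWithin 2 u s x = derivWithin (derivWithin u s) s x := by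
  rw [iteratedDerivWithin_succ]
  congr 1
  ext y
  rw [iteratedDerivWithin_one]

/-- A state of a wave is orthogonal to the data of waves of the unperturbed system that do not
reach the boundary. -/
theorem IsWave.inner_eq_zero (hB : IsFriedrichsInverse L₀ B) {h u : ℝ → H} (hu : IsWave L₀ h u)
    {T : ℝ} (hT : 0 < T) {z : H}
    (hz : ∀ τ ∈ Icc 0 T, (sineOf B τ (B (B z)), sineOf B τ (B z)) ∈ L₀.graph) :
    inner ℂ (B (B z)) (u T) = 0 := by
  have hu1 : ContDiffOn ℝ 1 (derivWithin u (Ici 0)) (Ici 0) :=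
    hu.smooth.derivWithin (uniqueDiffOn_Ici 0)
      (by rw [one_add_one_eq_two]; exact WithTop.coe_le_coe.2 (le_top : (2 : ℕ∞) ≤ ⊤))
  have hd1 : ∀ s, 0 < s → HasDerivAt u (derivWithin u (Ici 0) s) s := fun s hs =>
    ((hu.smooth.differentiableOn (by simp)) s hs.le).hasDerivWithinAt.hasDerivAt (Ici_mem_nhds hs)
  have hd2 : ∀ s, 0 < s → HasDerivAt (derivWithin u (Ici 0))
      (iteratedDerivWithin 2 u (Ici 0) s) s := fun s hs => by
    rw [iteratedDerivWithin_two_eq]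
    exact ((hu1.differentiableOn (by simp)) s hs.le).hasDerivWithinAt.hasDerivAt (Ici_mem_nhds hs)
  -- The pairing of `u` with the time-reversed free wave. Its derivative is `(v, u'') + (L₀ v, u)`,
  -- with `v` the free wave at time `T - s`; this is zero because `v` belongs to `Dom L₀` and no
  -- boundary term appears. At `s = T` it is the desired product, at `s = 0` it vanishes.
  set G : ℝ → ℂ := fun s => inner ℂ (sineOf B (T - s) (B (B z))) (derivWithin u (Ici 0) s) +
    inner ℂ (cosineOf B (T - s) (B z)) (u s) with hG
  have hX : ∀ s : ℝ, HasDerivAt (fun s => T - s) (-1) s := fun s => (hasDerivAt_id s).const_sub T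
  have hS : ∀ s, HasDerivAt (fun s => sineOf B (T - s) (B (B z)))
      ((-1 : ℝ) • cosineOf B (T - s) (B z)) s := fun s =>
    (hasDerivAt_sineOf_apply hB.nonneg (T - s) (B z)).scomp s (hX s)
  have hC : ∀ s, HasDerivAt (fun s => cosineOf B (T - s) (B z))
      ((-1 : ℝ) • -sineOf B (T - s) (B z)) s := fun s =>
    (hasDerivAt_cosineOf_apply hB.nonneg (T - s) (B z)).scomp s (hX s)
  have hGc : ContinuousOn G (Icc 0 T) := by
    refine ContinuousOn.add (ContinuousOn.inner ?_ ?_) (ContinuousOn.inner ?_ ?_)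
    · exact fun s _ => (hS s).continuousAt.continuousWithinAt
    · exact hu1.continuousOn.mono Icc_subset_Ici_self
    · exact fun s _ => (hC s).continuousAt.continuousWithinAt
    · exact hu.smooth.continuousOn.mono Icc_subset_Ici_self
  have hGd : ∀ s ∈ Ioc 0 T, HasDerivAt G 0 s := fun s hs => by
    obtain ⟨f, hf1, hf2⟩ := (LinearPMap.mem_graph_iff L₀).1
      (hz (T - s) ⟨by linarith [hs.2], by linarith [hs.1]⟩)
    have e1 := (mem_adjoint_graph_iff hB.dense).1 (hu.equation s hs.1) f
    simp only at hf1 hf2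
    rw [hf1, hf2, inner_neg_right] at e1
    refine (((hS s).inner ℂ (hd2 s hs.1)).add ((hC s).inner ℂ (hd1 s hs.1))).congr_deriv ?_
    simp only [neg_smul, one_smul, inner_neg_left, neg_neg, e1]
    ring
  have hconst : ∀ a ∈ Ioc 0 T, G a = G T := fun a ha => by
    refine (constant_of_has_deriv_right_zero (hGc.mono (Icc_subset_Icc_left ha.1.le))
      (fun s hs => (hGd s ⟨ha.1.trans_le hs.1, hs.2.le⟩).hasDerivWithinAt) T
      (right_mem_Icc.2 ha.2)).symm
  -- The equation for `u` holds only for positive times, so the value at `0` is reached by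
  -- continuity.
  have h0 : G 0 = G T := by
    refine EqOn.of_subset_closure (s := Ioc 0 T) (t := Icc 0 T) (g := fun _ => G T)
      (fun a ha => hconst a ha) hGc continuousOn_const Ioc_subset_Icc_self
      (by rw [closure_Ioc hT.ne]) (left_mem_Icc.2 hT.le)
  simp only [hG, hu.init, hu.init_deriv, sub_self, sineOf_zero, zero_apply,
    inner_zero_right, inner_zero_left, cosineOf_zero hB.nonneg, zero_add] at h0
  exact h0.symm

/-- The waves produced by the controls `a(t) φ`. -/
theorem isWave_duhamel (hB : IsFriedrichsInverse L₀ (boundedInverse (friedrichs L₀))) {φ : H}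
    (hφ : (φ, 0) ∈ L₀.adjoint.graph) {a : ℝ → ℝ} (ha : IsTest a) (ha0 : tsupport a ⊆ Ioi 0) :
    IsControl L₀ (fun t => a t • φ) ∧ IsWave L₀ (fun t => a t • φ) fun t =>
      duhamel (boundedInverse (friedrichs L₀)) φ (deriv (deriv a)) t - a t • φ := by
  set B := boundedInverse (friedrichs L₀) with hBdef
  have hφt : ∀ t : ℝ, (t • φ, 0) ∈ L₀.adjoint.graph := fun t => by
    have := L₀.adjoint.graph.smul_mem (t : ℂ) hφ
    rwa [Prod.smul_mk, smul_zero, Complex.coe_smul] at this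
  have hsupp : ∀ {b : ℝ → ℝ}, tsupport b ⊆ tsupport a → ∀ s, s ≤ 0 → b s = 0 := fun hb s hs =>
    image_eq_zero_of_notMem_tsupport fun h => absurd (ha0 (hb h)) (not_lt.2 hs)
  have s1 : tsupport (deriv a) ⊆ tsupport a := IsTest.tsupport_deriv_subset
  have s2 : tsupport (deriv (deriv a)) ⊆ tsupport a := IsTest.tsupport_deriv_subset.trans s1
  have s3 : tsupport (deriv (deriv (deriv a))) ⊆ tsupport a :=
    IsTest.tsupport_deriv_subset.trans s2
  have hu1 : ∀ t, HasDerivAt (fun t => duhamel B φ (deriv (deriv a)) t - a t • φ)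
      (duhamel B φ (deriv (deriv (deriv a))) t - deriv a t • φ) t := fun t =>
    (hasDerivAt_duhamel hB.nonneg φ ha.deriv.deriv t).sub ((ha.hasDerivAt t).smul_const φ)
  have hu2 : ∀ t, HasDerivAt (fun t => duhamel B φ (deriv (deriv (deriv a))) t - deriv a t • φ)
      (duhamel B φ (deriv (deriv (deriv (deriv a)))) t - deriv (deriv a) t • φ) t := fun t =>
    (hasDerivAt_duhamel hB.nonneg φ ha.deriv.deriv.deriv t).sub
      ((ha.deriv.hasDerivAt t).smul_const φ)
  have hdw : ∀ t ∈ Ici (0 : ℝ), derivWithin (fun t => duhamel B φ (deriv (deriv a)) t - a t • φ)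
      (Ici 0) t = duhamel B φ (deriv (deriv (deriv a))) t - deriv a t • φ := fun t ht =>
    (hu1 t).hasDerivWithinAt.derivWithin (uniqueDiffOn_Ici 0 t ht)
  -- The wave is `w - a φ` with `w'' + L w = a'' φ`. As `φ` is in `Ker L₀*`, one gets `L₀* u = L w =
  -- -u''`, and `L⁻¹ L₀* u - u = w - u = a φ`.
  have hgraph : ∀ t, (duhamel B φ (deriv (deriv a)) t - a t • φ,
      deriv (deriv a) t • φ - duhamel B φ (deriv (deriv (deriv (deriv a)))) t) ∈
        L₀.adjoint.graph := fun t => by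
    have h1 := hB.graph (deriv (deriv a) t • φ - duhamel B φ (deriv (deriv (deriv (deriv a)))) t)
    have h2 := L₀.adjoint.graph.sub_mem h1 (hφt (a t))
    rwa [map_sub, apply_duhamel hB.nonneg φ ha.deriv.deriv, B.map_smul_of_tower, sub_sub_cancel,
      Prod.mk_sub_mk, sub_zero] at h2
  refine ⟨⟨(ha.contDiff.smul contDiff_const).contDiffOn, fun t _ => hφt _, ?_⟩, ?_⟩
  · have h0 : (0 : ℝ) ∉ tsupport a := fun h => lt_irrefl (0 : ℝ) (ha0 h)
    obtain ⟨ε, hε, hb⟩ := Metric.isOpen_iff.1 (isClosed_tsupport a).isOpen_compl 0 h0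
    refine ⟨ε / 2, half_pos hε, fun t ht => ?_⟩
    have : t ∉ tsupport a := hb (by
      rw [Metric.mem_ball, Real.dist_0_eq_abs, abs_of_nonneg ht.1]
      linarith [ht.2])
    simp only
    rw [image_eq_zero_of_notMem_tsupport this, zero_smul]
  · refine ⟨?_, ?_, ?_, fun t ht => ?_, fun t ht => ?_⟩
    · exact ((contDiff_duhamel hB.nonneg φ ha.deriv.deriv).sub
        (ha.contDiff.smul contDiff_const)).contDiffOn
    · rw [duhamel_eq_zero fun s hs => hsupp s2 s hs.le, hsupp subset_rfl 0 le_rfl, zero_smul,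
        sub_zero]
    · rw [hdw 0 self_mem_Ici, duhamel_eq_zero fun s hs => hsupp s3 s hs.le, hsupp s1 0 le_rfl,
        zero_smul, sub_zero]
    · rw [iteratedDerivWithin_two_eq, derivWithin_congr hdw (hdw t ht.le),
        (hu2 t).hasDerivWithinAt.derivWithin (uniqueDiffOn_Ici 0 t ht.le), neg_sub]
      exact hgraph t
    · obtain ⟨f, hf1, hf2⟩ := (LinearPMap.mem_graph_iff _).1 (hgraph t)
      simp only at hf1 hf2
      refine ⟨hf1 ▸ f.2, ?_⟩
      have : (⟨_, hf1 ▸ f.2⟩ : L₀.adjoint.domain) = f := Subtype.ext hf1.symm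
      rw [boundaryOp, this, hf2, hf1, map_sub, apply_duhamel hB.nonneg φ ha.deriv.deriv,
        B.map_smul_of_tower]
      abel

end Abstract

end WaveSpectrum

namespace WaveSpectrum

/-! ### The reachable subspaces -/

section Reachable

theorem mem_orthogonal_closedSpan {H : Type*} [NormedAddCommGroup H] [InnerProductSpace ℂ H]
    {S : Set H} {w : H} (h : ∀ s ∈ S, inner ℂ s w = 0) : w ∈ (closedSpan S).orthogonal := by
  have h1 : closedSpan S ≤ (⊥ : ClosedSubmodule ℂ ℂ).comap (innerSL ℂ w) :=
    closedSpan_le.2 fun s hs => by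
      change inner ℂ w s = 0
      rw [← inner_conj_symm, h s hs, map_zero]
  intro v hv
  rw [← inner_conj_symm, show inner ℂ w v = 0 from h1 hv, map_zero]

variable {q : ℝ → ℝ} {B : HalfLineL2 →L[ℂ] HalfLineL2} {e e' : HalfLineL2 →ₗ[ℂ] (ℝ → ℂ)}

/-- The value at `0` is already zero in the range of `B`. Green's formula with `χ(0) = 1` identifies
`e' r 0` with the slope of the `H²` representative, so both conditions of the minimal domain hold.
-/
theorem IsEvaluation.mem_graph_of_deriv_eq_zero (he : IsEvaluation q B e e')
    (hq : ContinuousOn q (Ici 0)) (hB : IsFriedrichsInverse (sturmLiouvilleOp q) B)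
    {r : HalfLineL2} (h : e' r 0 = 0) : (B r, r) ∈ (sturmLiouvilleOp q).graph := by
  obtain ⟨f, f', f'', hf⟩ := exists_isRegular hq (hB.graph r)
  have h0 := hf.apply_zero hq hB
  obtain ⟨χ, hχ, hχ1, -⟩ := exists_isTest_eq_mul one_pos
  have h1 := hf.integral_green hχ hq
  rw [he.green χ hχ, h, h0, hχ1 0 (by simp), smul_zero, smul_zero, one_smul, neg_zero, zero_sub,
    eq_comm, neg_eq_zero] at h1
  rw [sturmLiouvilleOp_graph]
  exact ⟨f, f', f'', hf.isH2Loc, h0, h1, hf.fst, hf.snd⟩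

theorem ae_mem_thickening_iff (T : ℝ) : ∀ᵐ x ∂volume.restrict (Ioi (0 : ℝ)),
    (x ∈ Metric.thickening T {(0 : ℝ)} ↔ x ∈ (Ioi T)ᶜ) := by
  filter_upwards [ae_restrict_mem measurableSet_Ioi,
    ae_restrict_of_ae (Measure.ae_ne volume T)] with x (hx : 0 < x) hxT
  rw [Metric.thickening_singleton, Metric.mem_ball, Real.dist_0_eq_abs, abs_of_pos hx, mem_compl_iff,
    mem_Ioi, not_lt]
  exact ⟨le_of_lt, fun h => lt_of_le_of_ne h hxT⟩

/-- By duality: a free wave whose initial velocity is a test function supported beyond `T` does not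
reach the boundary up to time `T`, so it stays in the minimal domain and its initial velocity is
orthogonal to `u(T)`. -/
theorem reachableSet_subset (hq : ContDiffOn ℝ (⊤ : ℕ∞) q (Ici 0))
    (hB : IsFriedrichsInverse (sturmLiouvilleOp q) B) (T : ℝ≥0) :
    reachableSet (sturmLiouvilleOp q) T ⊆ L2On (Metric.thickening T {(0 : ℝ)}) := by
  obtain ⟨e, e', he⟩ := exists_isEvaluation hq.continuousOn hB
  rintro y ⟨h, u, -, hu, rfl⟩
  rcases (zero_le (a := T)).eq_or_lt with rfl | hT
  · rw [NNReal.coe_zero, hu.init]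
    exact (L2On _).toSubmodule.zero_mem
  have hT' : (0 : ℝ) < T := hT
  rw [L2On_congr Metric.isOpen_thickening.measurableSet measurableSet_Ioi.compl
    (ae_mem_thickening_iff T), ← L2On_orthogonal measurableSet_Ioi]
  have hle : L2On (Ioi (T : ℝ)) ≤ (closedSpan {u T}).orthogonal := by
    refine L2On_le_of_realL2_mem isOpen_Ioi fun k hk hk0 hkT => ?_
    have horth : inner ℂ (realL2 k) (u T) = 0 := by
      obtain ⟨z, hz⟩ := hk.exists_realL2_eq hq hB hk0
      rw [hz]
      refine hu.inner_eq_zero hB hT' fun τ hτ => ?_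
      rw [← apply_sineOf hB.nonneg]
      refine he.mem_graph_of_deriv_eq_zero hq.continuousOn hB ?_
      -- The gap `δ` between `T` and the support makes the wave vanish in a whole neighborhood of
      -- `0` up to time `T`, which is needed for its slope at `0`.
      obtain ⟨δ, hδ, hb⟩ := Metric.isOpen_iff.1 (isClosed_tsupport k).isOpen_compl (T : ℝ)
        fun h => lt_irrefl (T : ℝ) (hkT h)
      have hkδ : ∀ x, |x| < T + δ → k x = 0 := fun x hx => by
        refine image_eq_zero_of_notMem_tsupport fun hxk => ?_
        have h1 : (T : ℝ) < x := hkT hxk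
        refine hb ?_ hxk
        rw [Metric.mem_ball, Real.dist_eq, abs_of_pos (by linarith)]
        linarith [le_abs_self x]
      have hz0 : ∀ x ∈ Ioo 0 (T + δ), e (B z) x = 0 := fun x hx => by
        refine he.eq_zero_of_ae isOpen_Ioo (fun x hx => hx.1) ?_ hx
        rw [← hz]
        filter_upwards [coeFn_realL2 hk.memLp] with y hy hy'
        rw [hy, hkδ y (by rw [abs_of_pos hy'.1]; exact hy'.2), Complex.ofReal_zero]
      have hz1 : ∀ x, |x - 0| < T + δ → e (B z) x = 0 := fun x hx => by
        rw [sub_zero] at hx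
        rcases lt_trichotomy x 0 with h0 | h0 | h0
        · rw [abs_of_neg h0] at hx
          rw [← neg_neg x, he.apply_neg, hz0 (-x) ⟨by linarith, hx⟩, neg_zero]
        · rw [h0, he.apply_zero]
        · rw [abs_of_pos h0] at hx
          exact hz0 x ⟨h0, hx⟩
      refine he.deriv_eq_zero (V := Metric.ball 0 δ) Metric.isOpen_ball (fun x hx => ?_)
        (Metric.mem_ball_self hδ)
      refine he.wave_eq_zero hB.nonneg hq.continuousOn hz1 hτ.1 ?_
      rw [Metric.mem_ball, Real.dist_eq] at hx
      linarith [hτ.2]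
    refine mem_orthogonal_closedSpan fun v hv => ?_
    rw [mem_singleton_iff.1 hv, ← inner_conj_symm, horth, map_zero]
  refine ClosedSubmodule.orthogonal_le hle ?_
  rw [ClosedSubmodule.orthogonal_orthogonal_eq]
  exact subset_closedSpan _ rfl

/-- Use the time-reversed control `b(T - t) φ`. Since `b(0) = 0`, the term `-a φ` of the wave
disappears at time `T` and only the Duhamel integral remains. So `σ ↦ (y, S_σ φ)`, with `S_σ` the
sine operator, has zero second derivative on `(0, T)`. -/
theorem integral_deriv_deriv_smul_inner_eq_zero {H : Type*} [NormedAddCommGroup H]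
    [InnerProductSpace ℂ H] [CompleteSpace H] {L₀ : H →ₗ.[ℂ] H}
    (hB : IsFriedrichsInverse L₀ (boundedInverse (friedrichs L₀))) {φ y : H}
    (hφ : (φ, 0) ∈ L₀.adjoint.graph) {T : ℝ≥0} (hy : y ∈ (reachableSubspace L₀ T).orthogonal)
    {b : ℝ → ℝ} (hb : IsTest b) (hbT : tsupport b ⊆ Ioo 0 (T : ℝ)) :
    ∫ σ, deriv (deriv b) σ • inner ℂ y (sineOf (boundedInverse (friedrichs L₀)) σ φ) = 0 := by
  set B := boundedInverse (friedrichs L₀)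
  have ha := hb.comp_sub_left T
  have hda : ∀ {k : ℝ → ℝ}, IsTest k → (deriv fun t => k (T - t)) = fun t => -deriv k (T - t) :=
    fun hk => by
      ext t
      have := ((hk.hasDerivAt (T - t)).comp t ((hasDerivAt_id t).const_sub (T : ℝ)))
      refine this.deriv.trans ?_
      ring
  have hdda : (deriv (deriv fun t => b (T - t))) = fun t => deriv (deriv b) (T - t) := by
    rw [hda hb]
    ext t
    have h1 : HasDerivAt (fun t => deriv b (T - t)) (-deriv (deriv b) (T - t)) t := by
      have := (hb.deriv.hasDerivAt (T - t)).comp t ((hasDerivAt_id t).const_sub (T : ℝ))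
      refine this.congr_deriv ?_
      ring
    exact h1.neg.deriv.trans (neg_neg _)
  have ha0 : tsupport (fun t => b (T - t)) ⊆ Ioi 0 := fun t ht => by
    have : T - t ∈ tsupport b := by
      have h1 := tsupport_comp_eq_preimage b (Homeomorph.subLeft (T : ℝ))
      have h2 : t ∈ tsupport (b ∘ Homeomorph.subLeft (T : ℝ)) := ht
      rw [h1] at h2
      exact h2
    have h3 := (hbT this).2
    rw [mem_Ioi]
    linarith
  obtain ⟨hc, hw⟩ := isWave_duhamel hB hφ ha ha0
  have h1 := hy _ (subset_closedSpan _ ⟨_, _, hc, hw, rfl⟩)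
  have hb0 : b 0 = 0 := image_eq_zero_of_notMem_tsupport fun h => lt_irrefl (0 : ℝ) (hbT h).1
  have h2 : duhamel B φ (fun t => deriv (deriv b) (T - t)) T =
      ∫ σ in Ioi (0 : ℝ), deriv (deriv b) σ • sineOf B σ φ := by
    simp only [duhamel, sub_sub_cancel]
  have hi : Integrable (fun σ => deriv (deriv b) σ • sineOf B σ φ)
      (volume.restrict (Ioi (0 : ℝ))) :=
    ((hb.deriv.deriv.continuous.smul (continuous_sineOf_apply hB.nonneg
      φ)).integrable_of_hasCompactSupport hb.deriv.deriv.compact.smul_right).integrableOn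
  simp only [sub_self, hb0, zero_smul, sub_zero, hdda] at h1
  rw [h2, ← inner_conj_symm, map_eq_zero, ← integral_inner hi] at h1
  rw [← setIntegral_eq_integral_of_forall_compl_eq_zero (s := Ioi (0 : ℝ)), ← h1]
  · congr 1
    ext σ
    rw [← Complex.coe_smul, ← Complex.coe_smul, inner_smul_right, smul_eq_mul]
  · intro σ hσ
    rw [IsTest.deriv_eq_zero fun h => hσ (hbT (IsTest.tsupport_deriv_subset h)).1, zero_smul]

/-- The controllability of the system with boundary control. -/
theorem L2On_le_reachableSubspace (hq : ContDiffOn ℝ (⊤ : ℕ∞) q (Ici 0))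
    (hB : IsFriedrichsInverse (sturmLiouvilleOp q)
      (boundedInverse (friedrichs (sturmLiouvilleOp q)))) (T : ℝ≥0) :
    L2On (Metric.thickening T {(0 : ℝ)}) ≤ reachableSubspace (sturmLiouvilleOp q) T := by
  obtain ⟨e, e', he⟩ := exists_isEvaluation hq.continuousOn hB
  rcases (zero_le (a := T)).eq_or_lt with rfl | hT
  · rw [NNReal.coe_zero, Metric.thickening_of_nonpos le_rfl, L2On_empty]
    exact bot_le
  have hT' : (0 : ℝ) < T := hT
  refine le_of_orthogonal_le fun y hy => ?_
  rw [L2On_orthogonal Metric.isOpen_thickening.measurableSet]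
  set B := boundedInverse (friedrichs (sturmLiouvilleOp q)) with hBdef
  obtain ⟨χ, hχ, hχ1, -⟩ := exists_isTest_eq_mul one_pos
  -- Both terms have the same image under `L₀*`, so `φ` is in its kernel; by Green's formula,
  -- pairing with `φ` reads off the slope of `B r` at `0`.
  set φ := realL2 χ - B (realL2 (slExpr q χ)) with hφdef
  have hφ : (φ, 0) ∈ (sturmLiouvilleOp q).adjoint.graph := by
    have := (sturmLiouvilleOp q).adjoint.graph.sub_mem (hχ.mem_adjoint_graph hq.continuousOn)
      (hB.graph (realL2 (slExpr q χ)))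
    rwa [Prod.mk_sub_mk, sub_self] at this
  have hφe : ∀ r, inner ℂ φ r = e' r 0 := fun r => by
    have := he.green χ hχ r
    rw [hχ1 0 (by simp), one_smul] at this
    rw [hφdef, inner_sub_left, hB.inner_left_eq]
    linear_combination -this
  set p' : ℝ → ℂ := fun σ => inner ℂ y (sineOf B σ φ) with hp'
  have hpc' : Continuous p' := continuous_const.inner (continuous_sineOf_apply hB.nonneg φ)
  -- The pairing is affine in time and zero at time `0`, so a linear term `σ β` may remain.
  obtain ⟨α, β, hαβ⟩ := ae_eq_affine_of_integral_deriv_deriv_smul_eq_zero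
    (isOpen_Ioo (a := 0) (b := (T : ℝ))) ordConnected_Ioo hpc'.locallyIntegrable fun b hb hbT =>
      integral_deriv_deriv_smul_inner_eq_zero hB hφ hy hb hbT
  have h1 : EqOn p' (fun σ => α + σ * β) (Icc 0 (T : ℝ)) := by
    have hca : Continuous fun σ : ℝ => α + σ * β := by fun_prop
    have h2 : EqOn p' (fun σ => α + σ * β) (Ioo 0 (T : ℝ)) :=
      Measure.eqOn_open_of_ae_eq (μ := volume) ((ae_restrict_iff' measurableSet_Ioo).2 hαβ)
        isOpen_Ioo hpc'.continuousOn hca.continuousOn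
    have h3 := h2.closure hpc' hca
    rwa [closure_Ioo hT'.ne] at h3
  have hα : α = 0 := by
    have := h1 (left_mem_Icc.2 hT'.le)
    simpa [hp', sineOf_zero] using this.symm
  have h2 : ∀ τ : ℝ, |τ| < T → inner ℂ φ (sineOf B τ y) = τ * (starRingEnd ℂ) β := by
    have h3 : ∀ τ ∈ Icc 0 (T : ℝ), inner ℂ φ (sineOf B τ y) = τ * (starRingEnd ℂ) β := by
      intro τ hτ
      have := h1 hτ
      simp only [hp', hα, zero_add] at this
      rw [← inner_sineOf, ← inner_conj_symm, this, map_mul, Complex.conj_ofReal]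
    intro τ hτ
    rcases le_total 0 τ with h0 | h0
    · exact h3 τ ⟨h0, (le_abs_self τ).trans hτ.le⟩
    · have := h3 (-τ) ⟨by linarith, (neg_le_abs τ).trans hτ.le⟩
      rw [sineOf_neg, neg_apply, inner_neg_right, Complex.ofReal_neg, neg_mul, neg_inj] at this
      exact this
  refine IsEvaluation.mem_L2On_compl_thickening hB.nonneg hB.denseRange he
    fun ε hε z hz x hx hxT => ?_
  rw [Metric.thickening_singleton, Metric.mem_ball, Real.dist_eq] at hxT
  refine he.eq_zero_of_cauchy_data hB.nonneg hq.continuousOn (fun t _ => he.apply_zero _)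
    (fun t ht => ?_) hxT
  have h3 := inner_sineOf_apply_sineOf_pow hB.nonneg h2 hε.le 6
  rw [hz] at h3
  have hev : ∀ {t : ℝ}, |t| < T - 6 * ε → ∀ᶠ s in 𝓝 t, |s| < T - 6 * ε := fun ht =>
    continuous_abs.continuousAt.eventually_lt_const ht
  have hd1 : ∀ t, HasDerivAt (fun t => inner ℂ φ (sineOf B t (B (B z))))
      (inner ℂ φ (cosineOf B t (B z))) t := fun t => by
    have := ((innerSL ℂ φ).restrictScalars ℝ).hasFDerivAt.comp_hasDerivAt t
      (hasDerivAt_sineOf_apply hB.nonneg t (B z))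
    exact this
  have hd2 : ∀ t, HasDerivAt (fun t => inner ℂ φ (cosineOf B t (B z)))
      (inner ℂ φ (-sineOf B t (B z))) t := fun t => by
    have := ((innerSL ℂ φ).restrictScalars ℝ).hasFDerivAt.comp_hasDerivAt t
      (hasDerivAt_cosineOf_apply hB.nonneg t (B z))
    exact this
  -- After mollification the pairing can be differentiated twice, which removes the linear term. The
  -- outcome is zero slope at `x = 0`; with the Dirichlet condition these are zero Cauchy data on
  -- the boundary.
  have h4 : ∀ t : ℝ, |t| < T - 6 * ε → inner ℂ φ (cosineOf B t (B z)) =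
      ε ^ 6 * (starRingEnd ℂ) β := fun t ht => by
    have h5 : HasDerivAt (fun t : ℝ => (t : ℂ) * (ε ^ 6 * (starRingEnd ℂ) β))
        (1 * (ε ^ 6 * (starRingEnd ℂ) β)) t := (Complex.ofRealCLM.hasDerivAt (x := t)).mul_const _
    rw [one_mul] at h5
    refine (hd1 t).unique (h5.congr_of_eventuallyEq ?_)
    filter_upwards [hev ht] with s hs
    exact h3 s (by exact_mod_cast hs)
  have h5 : inner ℂ φ (-sineOf B t (B z)) = 0 := by
    refine (hd2 t).unique ((hasDerivAt_const t (ε ^ 6 * (starRingEnd ℂ) β)).congr_of_eventuallyEq ?_)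
    filter_upwards [hev ht] with s hs using h4 s hs
  rw [inner_neg_right, neg_eq_zero, hφe] at h5
  exact h5

theorem reachableSubspace_eq (hq : ContDiffOn ℝ (⊤ : ℕ∞) q (Ici 0))
    (hB : IsFriedrichsInverse (sturmLiouvilleOp q)
      (boundedInverse (friedrichs (sturmLiouvilleOp q)))) (T : ℝ≥0) :
    reachableSubspace (sturmLiouvilleOp q) T = L2On (Metric.thickening T {(0 : ℝ)}) :=
  le_antisymm (closedSpan_le.2 (reachableSet_subset hq hB T)) (L2On_le_reachableSubspace hq hB T)

end Reachable

end WaveSpectrum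

namespace WaveSpectrum

/-! ### The wave lattice and its atoms -/

section Lattice

theorem not_ae_notMem_Ioo {a b : ℝ} (ha : 0 ≤ a) (hab : a < b) :
    ¬ ∀ᵐ x ∂volume.restrict (Ioi (0 : ℝ)), x ∉ Ioo a b := by
  intro h
  rw [ae_restrict_iff' measurableSet_Ioi] at h
  have h1 : volume (Ioo a b) = 0 := by
    refine measure_mono_null (fun x hx => ?_) h
    exact fun h2 => h2 (ha.trans_lt hx.1) hx
  rw [Real.volume_Ioo, ENNReal.ofReal_eq_zero] at h1
  linarith

theorem Ioo_subset_halfLineBall (x r : ℝ≥0) : Ioo (x : ℝ) (x + r) ⊆ halfLineBall x r := by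
  intro s hs
  refine ⟨x.2.trans hs.1.le, ?_⟩
  rw [abs_of_pos (sub_pos.2 hs.1)]
  linarith [hs.2]

theorem pointAtom_zero_right (x : ℝ≥0) : pointAtom x 0 = ⊥ := by
  rw [pointAtom, L2On_eq_bot_iff (measurableSet_halfLineBall x 0)]
  exact Eventually.of_forall fun s hs => (abs_nonneg (s - x)).not_gt (by simpa using hs.2)

theorem pointAtom_ne_bot_of_pos (x : ℝ≥0) {r : ℝ≥0} (hr : 0 < r) : pointAtom x r ≠ ⊥ := by
  intro h
  rw [pointAtom, L2On_eq_bot_iff (measurableSet_halfLineBall x r)] at h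
  refine not_ae_notMem_Ioo x.2 (lt_add_of_pos_right (x : ℝ) (NNReal.coe_pos.2 hr)) ?_
  exact h.mono fun s hs h => hs (Ioo_subset_halfLineBall x r h)

theorem pointAtom_ne_bot (x : ℝ≥0) : pointAtom x ≠ ⊥ := fun h =>
  pointAtom_ne_bot_of_pos x one_pos (congrFun h 1)

/-- At `t` equal to half the distance of distinct points, the two neighborhoods are disjoint and of
positive measure. -/
theorem eq_of_pointAtom_le {x x' : ℝ≥0} (h : pointAtom x' ≤ pointAtom x) : x' = x := by
  by_contra hne
  have hd : 0 < |(x' : ℝ) - x| := abs_pos.2 (sub_ne_zero.2 fun h => hne (NNReal.coe_injective h))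
  set t : ℝ≥0 := ⟨|(x' : ℝ) - x| / 2, by positivity⟩ with ht
  have ht' : (t : ℝ) = |(x' : ℝ) - x| / 2 := rfl
  have h1 := (L2On_le_iff (measurableSet_halfLineBall x' t) (measurableSet_halfLineBall x t)).1 (h t)
  refine not_ae_notMem_Ioo x'.2 (lt_add_of_pos_right (x' : ℝ) (ht' ▸ half_pos hd)) ?_
  refine h1.mono fun s hs h => ?_
  have h2 := (Ioo_subset_halfLineBall x' t h).2
  have h3 := (hs (Ioo_subset_halfLineBall x' t h)).2
  have h4 := abs_sub_le (x' : ℝ) s x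
  rw [abs_sub_comm (x' : ℝ) s] at h4
  linarith

theorem pointAtom_injective : Function.Injective pointAtom := fun _ _ h =>
  eq_of_pointAtom_le h.le

variable {q : ℝ → ℝ} (hq : ContDiffOn ℝ (⊤ : ℕ∞) q (Ici 0))
  (hB : IsFriedrichsInverse (sturmLiouvilleOp q)
    (boundedInverse (friedrichs (sturmLiouvilleOp q))))

/-- The null boundary is what makes complements work: the complement of `U` and its interior differ
only by a part of the boundary, so the orthogonal complement is again carried by an open set. -/
theorem isSubspaceLattice_L2On :
    IsSubspaceLattice {A | ∃ U : Set ℝ, IsOpen U ∧ volume (frontier U) = 0 ∧ A = L2On U} where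
  bot_mem := ⟨∅, isOpen_empty, by simp, L2On_empty.symm⟩
  top_mem := ⟨univ, isOpen_univ, by simp, L2On_univ.symm⟩
  sup_mem := by
    rintro _ ⟨U, hU, hU0, rfl⟩ _ ⟨V, hV, hV0, rfl⟩
    refine ⟨U ∪ V, hU.union hV, measure_mono_null (frontier_union_subset U V) ?_,
      (L2On_union hU.measurableSet hV.measurableSet).symm⟩
    exact measure_union_null (measure_mono_null inter_subset_left hU0)
      (measure_mono_null inter_subset_right hV0)
  inf_mem := by
    rintro _ ⟨U, hU, hU0, rfl⟩ _ ⟨V, hV, hV0, rfl⟩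
    refine ⟨U ∩ V, hU.inter hV, measure_mono_null (frontier_inter_subset U V) ?_,
      (L2On_inter hU.measurableSet hV.measurableSet).symm⟩
    exact measure_union_null (measure_mono_null inter_subset_left hU0)
      (measure_mono_null inter_subset_right hV0)
  compl_mem := by
    rintro _ ⟨U, hU, hU0, rfl⟩
    refine ⟨interior Uᶜ, isOpen_interior, measure_mono_null frontier_interior_subset ?_, ?_⟩
    · rwa [frontier_compl]
    · rw [L2On_orthogonal hU.measurableSet]
      refine L2On_congr hU.measurableSet.compl isOpen_interior.measurableSet ?_
      have h0 : ∀ᵐ x : ℝ, x ∉ frontier U := measure_eq_zero_iff_ae_notMem.1 hU0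
      filter_upwards [ae_restrict_of_ae h0] with x hx
      refine ⟨fun h => ?_, fun h => interior_subset h⟩
      by_contra h'
      rw [← frontier_compl] at hx
      exact hx ⟨subset_closure h, h'⟩

include hq hB

theorem exists_isOpen_of_mem_waveLattice {A : ClosedSubmodule ℂ HalfLineL2}
    (hA : A ∈ waveLattice (sturmLiouvilleOp q)) : ∃ U : Set ℝ, IsOpen U ∧ A = L2On U := by
  suffices h : A ∈ {A | ∃ U : Set ℝ, IsOpen U ∧ volume (frontier U) = 0 ∧ A = L2On U} by
    obtain ⟨U, hU, -, h⟩ := h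
    exact ⟨U, hU, h⟩
  refine mem_sInter.1 hA _ ⟨isSubspaceLattice_L2On, ?_, fun T => ?_⟩
  · rintro t _ ⟨U, hU, hU0, rfl⟩
    rcases eq_or_ne t 0 with rfl | ht
    · exact ⟨U, hU, hU0, if_pos rfl⟩
    · exact ⟨_, Metric.isOpen_thickening, volume_frontier_thickening _ _,
        waveIsotony_L2On hq hB hU (pos_iff_ne_zero.2 ht)⟩
  · exact ⟨_, Metric.isOpen_thickening, volume_frontier_thickening _ _,
      reachableSubspace_eq hq hB T⟩

/-- The interval is cut out of one reachable subspace by the complement of another. -/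
theorem L2On_Ioo_mem_waveLattice (x δ : ℝ≥0) :
    L2On (Ioo (x : ℝ) (x + δ)) ∈ waveLattice (sturmLiouvilleOp q) := by
  rintro 𝔏 ⟨h1, -, h2⟩
  have h3 := h1.inf_mem _ (h2 (x + δ)) _ (h1.compl_mem _ (h2 x))
  have hm : ∀ T : ℝ, MeasurableSet (Metric.thickening T {(0 : ℝ)}) := fun T =>
    Metric.isOpen_thickening.measurableSet
  rw [reachableSubspace_eq hq hB, reachableSubspace_eq hq hB, L2On_orthogonal (hm _),
    ← L2On_inter (hm _) (hm _).compl] at h3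
  convert h3 using 1
  refine L2On_congr measurableSet_Ioo ((hm _).inter (hm _).compl) ?_
  filter_upwards [ae_mem_thickening_iff (x : ℝ), ae_mem_thickening_iff ((x + δ : ℝ≥0) : ℝ),
    ae_restrict_of_ae (Measure.ae_ne volume ((x + δ : ℝ≥0) : ℝ))] with s e1 e2 e3
  rw [mem_inter_iff, mem_compl_iff, e1, e2, mem_compl_iff, mem_compl_iff, mem_Ioi, mem_Ioi, mem_Ioo,
    not_not, not_lt, NNReal.coe_add]
  rw [NNReal.coe_add] at e3
  exact ⟨fun h => ⟨h.2.le, h.1⟩, fun h => ⟨h.2, lt_of_le_of_ne h.1 e3⟩⟩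

/-- The neighborhoods of the shrinking intervals `(x, x + 1/(n + 1))` converge to `{x}^t` except
possibly at the null set `|s - x| = t`, and convergence of sets gives strong convergence of
projections. -/
theorem pointAtom_mem_waveFunctions (x : ℝ≥0) :
    pointAtom x ∈ waveFunctions (sturmLiouvilleOp q) := by
  set δ : ℕ → ℝ≥0 := fun n => 1 / ((n : ℝ≥0) + 1) with hδ
  have hδ0 : ∀ n, (0 : ℝ) < δ n := fun n => by
    rw [NNReal.coe_pos]
    positivity
  have hδt : Tendsto (fun n => (δ n : ℝ)) atTop (𝓝 0) := by
    have := tendsto_one_div_add_atTop_nhds_zero_nat (𝕜 := ℝ)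
    simpa [hδ] using this
  refine ⟨fun n => L2On (Ioo (x : ℝ) (x + δ n)), fun n => L2On_Ioo_mem_waveLattice hq hB x (δ n),
    fun t y => ?_⟩
  rcases eq_or_ne t 0 with rfl | ht
  -- At `t = 0` the isotony is the identity, and every point eventually leaves the open intervals,
  -- so the limit is `0`.
  · simp only [waveIsotony, if_true]
    refine tendsto_starProjection_L2On (fun n => measurableSet_Ioo)
      (measurableSet_halfLineBall x 0) (Eventually.of_forall fun s => ?_) y
    have h1 : s ∉ halfLineBall x 0 := fun h => (abs_nonneg (s - x)).not_gt (by simpa using h.2)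
    rcases le_or_gt s x with h | h
    · exact Eventually.of_forall fun n => iff_of_false (fun h' => h.not_gt h'.1) h1
    · filter_upwards [hδt.eventually_lt_const (sub_pos.2 h)] with n hn
      exact iff_of_false (fun h' => by linarith [h'.2]) h1
  · have ht' : 0 < t := pos_iff_ne_zero.2 ht
    simp only [waveIsotony_L2On hq hB isOpen_Ioo ht']
    refine tendsto_starProjection_L2On (fun n => Metric.isOpen_thickening.measurableSet)
      (measurableSet_halfLineBall x t) ?_ y
    filter_upwards [ae_restrict_mem measurableSet_Ioi,
      ae_restrict_of_ae (Measure.ae_ne volume ((x : ℝ) + t)),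
      ae_restrict_of_ae (Measure.ae_ne volume ((x : ℝ) - t))] with s (hs : 0 < s) h1 h2
    rcases lt_or_ge |s - x| t with h | h
    · refine Eventually.of_forall fun n => iff_of_true ?_ ⟨hs.le, h⟩
      rw [Metric.mem_thickening_iff]
      set η := min (δ n : ℝ) (t - |s - x|) / 2 with hη
      have h3 : 0 < min (δ n : ℝ) (t - |s - x|) := lt_min (hδ0 n) (sub_pos.2 h)
      have h4 := min_le_left (δ n : ℝ) (t - |s - x|)
      have h5 := min_le_right (δ n : ℝ) (t - |s - x|)
      refine ⟨x + η, ⟨⟨by linarith, by linarith⟩, ?_⟩, ?_⟩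
      · have := x.2
        exact add_pos_of_nonneg_of_pos this (by linarith)
      · rw [Real.dist_eq, show s - (x + η) = s - x - η by ring]
        refine (abs_sub _ _).trans_lt ?_
        rw [abs_of_pos (show 0 < η by linarith)]
        linarith
    · have h' : (t : ℝ) < |s - x| := by
        refine lt_of_le_of_ne h fun h3 => ?_
        rcases abs_cases (s - x) with h4 | h4
        · exact h1 (by linarith [h4.1])
        · exact h2 (by linarith [h4.1])
      filter_upwards [hδt.eventually_lt_const (sub_pos.2 h')] with n hn
      refine iff_of_false (fun h3 => ?_) fun h3 => h.not_gt h3.2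
      obtain ⟨u, hu, hsu⟩ := Metric.mem_thickening_iff.1 h3
      rw [Real.dist_eq] at hsu
      have h4 := abs_sub_le s u x
      rw [abs_of_pos (sub_pos.2 hu.1.1)] at h4
      linarith [hu.1.2]

/-- Compactness: if `f` is a nonzero limit, the sets `U n` meet a fixed interval `[0, R]` infinitely
often, and points chosen there accumulate at some `x`. Each point of `{x}^t` then eventually lies in
the `t`-neighborhoods along the subsequence, so the limiting projection fixes `L₂({x}^t)`. -/
theorem exists_pointAtom_le {f : ℝ≥0 → ClosedSubmodule ℂ HalfLineL2}
    (hf : f ∈ waveFunctions (sturmLiouvilleOp q)) (hf0 : f ≠ ⊥) : ∃ x, pointAtom x ≤ f := by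
  obtain ⟨A, hA, hlim⟩ := hf
  choose U hU hAU using fun n => exists_isOpen_of_mem_waveLattice hq hB (hA n)
  obtain rfl : A = fun n => L2On (U n) := funext hAU
  clear hAU hA
  have hlim' : ∀ t : ℝ≥0, 0 < t → ∀ y : HalfLineL2, Tendsto (fun n =>
      (L2On (Metric.thickening t (U n ∩ Ioi 0))).toSubmodule.starProjection y) atTop
      (𝓝 ((f t).toSubmodule.starProjection y)) := fun t ht y =>
    (hlim t y).congr fun n => by simp only [waveIsotony_L2On hq hB (hU n) ht]
  -- Otherwise the sets escape to infinity, every point eventually leaves their neighborhoods, and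
  -- the limit is `0` at all times.
  have hR : ∃ R : ℝ, ∃ᶠ n in atTop, (U n ∩ Ioi 0 ∩ Iic R).Nonempty := by
    by_contra! hcon
    refine hf0 (funext fun t => ?_)
    rw [Pi.bot_apply, ← le_bot_iff]
    intro y hy
    have hV : ∀ s : ℝ≥0, ∀ᵐ ξ ∂volume.restrict (Ioi (0 : ℝ)), ∀ᶠ n in atTop,
        (ξ ∈ Metric.thickening s (U n ∩ Ioi 0) ↔ ξ ∈ (∅ : Set ℝ)) := fun s => by
      refine Eventually.of_forall fun ξ => ?_
      have h1 := hcon (ξ + s)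
      filter_upwards [h1] with n hn
      refine iff_of_false (fun h => ?_) (notMem_empty ξ)
      obtain ⟨u, hu, hd⟩ := Metric.mem_thickening_iff.1 h
      refine (hn ▸ notMem_empty u : u ∉ U n ∩ Ioi 0 ∩ Iic (ξ + s)) ⟨hu, ?_⟩
      rw [Real.dist_eq] at hd
      have := (abs_lt.1 hd).1
      exact mem_Iic.2 (by linarith)
    have hy0 : Tendsto (fun n => (waveIsotony (sturmLiouvilleOp q) t
        (L2On (U n))).toSubmodule.starProjection y) atTop
        (𝓝 ((L2On ∅).toSubmodule.starProjection y)) := by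
      rcases eq_or_ne t 0 with rfl | ht
      -- At `t = 0` the sets themselves appear; they are contained in their neighborhoods of radius
      -- `1`, already known to escape.
      · simp only [waveIsotony, if_true]
        refine tendsto_starProjection_L2On (fun n => (hU n).measurableSet) MeasurableSet.empty ?_ y
        filter_upwards [hV 1, ae_restrict_mem measurableSet_Ioi] with ξ h1 h2
        filter_upwards [h1] with n hn
        refine iff_of_false (fun h => ?_) (notMem_empty ξ)
        exact hn.1 (Metric.self_subset_thickening (by simp) _ ⟨h, h2⟩)
      · simp only [waveIsotony_L2On hq hB (hU _) (pos_iff_ne_zero.2 ht)]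
        exact tendsto_starProjection_L2On (fun n => Metric.isOpen_thickening.measurableSet)
          MeasurableSet.empty (hV t) y
    have h2 := tendsto_nhds_unique (hlim t y) hy0
    rw [Submodule.starProjection_eq_self_iff.2 hy] at h2
    rw [h2, ← L2On_empty]
    exact Submodule.starProjection_apply_mem _ _
  obtain ⟨R, hR⟩ := hR
  obtain ⟨φ, hφ, hne⟩ := extraction_of_frequently_atTop hR
  choose u hu using hne
  obtain ⟨x, hx, ψ, hψ, hux⟩ := (isCompact_Icc (a := (0 : ℝ)) (b := R)).tendsto_subseq
    (fun n => show u n ∈ Icc 0 R from ⟨le_of_lt (hu n).1.2, (hu n).2⟩)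
  lift x to ℝ≥0 using hx.1
  refine ⟨x, fun t => ?_⟩
  rcases eq_or_ne t 0 with rfl | ht
  · rw [pointAtom_zero_right]
    exact bot_le
  intro y hy
  have h1 := (hlim' t (pos_iff_ne_zero.2 ht) y).comp (hφ.comp hψ).tendsto_atTop
  have h2 : Tendsto ((fun n => (L2On (Metric.thickening t
      (U n ∩ Ioi 0))).toSubmodule.starProjection y) ∘ (φ ∘ ψ)) atTop (𝓝 y) := by
    refine tendsto_of_ae_tendsto (f₀ := y) (g := y)
      (fun n => coeFn_starProjection_L2On Metric.isOpen_thickening.measurableSet y)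
      EventuallyEq.rfl (fun n => Eventually.of_forall fun ξ => ?_) ?_
    · by_cases h : ξ ∈ Metric.thickening (t : ℝ) (U ((φ ∘ ψ) n) ∩ Ioi 0)
      · rw [indicator_of_mem h, sub_self, norm_zero]
        positivity
      · rw [indicator_of_notMem h, zero_sub, norm_neg]
    · filter_upwards [(mem_L2On_iff (measurableSet_halfLineBall _ t)).1 hy] with ξ h3
      by_cases h : ξ ∈ halfLineBall x t
      · have h4 : ∀ᶠ n in atTop, |ξ - u (ψ n)| < t :=
          (tendsto_const_nhds.sub hux).abs.eventually_lt_const h.2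
        refine tendsto_const_nhds.congr' ?_
        filter_upwards [h4] with n hn
        rw [indicator_of_mem]
        exact Metric.mem_thickening_iff.2 ⟨u (ψ n), (hu (ψ n)).1, hn⟩
      · rw [h3 h]
        refine tendsto_const_nhds.congr fun n => ?_
        by_cases h' : ξ ∈ Metric.thickening (t : ℝ) (U ((φ ∘ ψ) n) ∩ Ioi 0)
        · rw [indicator_of_mem h', h3 h]
        · rw [indicator_of_notMem h']
  have h3 := tendsto_nhds_unique h1 h2
  rw [← h3]
  exact Submodule.starProjection_apply_mem _ _

/-- Every nonzero wave function dominates a point atom, and point atoms are wave functions that are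
pairwise incomparable; such a family is exactly the set of minimal elements. -/
theorem mem_waveSpectrum_iff {f : ℝ≥0 → ClosedSubmodule ℂ HalfLineL2} :
    f ∈ waveSpectrum (sturmLiouvilleOp q) ↔ ∃ x, pointAtom x = f := by
  constructor
  · rintro ⟨⟨hf, hf0⟩, hmin⟩
    obtain ⟨x, hx⟩ := exists_pointAtom_le hq hB hf hf0
    exact ⟨x, le_antisymm hx (hmin ⟨pointAtom_mem_waveFunctions hq hB x, pointAtom_ne_bot x⟩ hx)⟩
  · rintro ⟨x, rfl⟩
    refine ⟨⟨pointAtom_mem_waveFunctions hq hB x, pointAtom_ne_bot x⟩, fun f hf hle => ?_⟩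
    obtain ⟨x', hx'⟩ := exists_pointAtom_le hq hB hf.1 hf.2
    obtain rfl := eq_of_pointAtom_le (hx'.trans hle)
    exact hx'

end Lattice

end WaveSpectrum

namespace WaveSpectrum

/-! ### Balls, measure and boundary in the coordinate -/

section Coordinate

/-- The image of a ball of the wave spectrum in the half-line. -/
def coordBall (x r : ℝ≥0) : Set ℝ≥0 := {x' | |(x' : ℝ) - x| < r ∨ x' = 0 ∧ r = x}

theorem edist_lt_coe_iff {x x' r : ℝ≥0} : edist x x' < r ↔ |(x' : ℝ) - x| < r := by
  rw [edist_comm, edist_dist, NNReal.dist_eq, ENNReal.ofReal_lt_iff_lt_toReal (abs_nonneg _)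
    ENNReal.coe_ne_top, ENNReal.coe_toReal]

theorem coordBall_of_ne {x r : ℝ≥0} (h : r ≠ x) : coordBall x r = {x' | edist x x' < r} := by
  ext x'
  rw [mem_ofPred_eq, edist_lt_coe_iff]
  exact or_iff_left fun h' => h h'.2

theorem coordBall_self (x : ℝ≥0) : coordBall x x = {x' | edist x x' < x} ∪ {0} := by
  ext x'
  rw [mem_union, mem_ofPred_eq, edist_lt_coe_iff, mem_singleton_iff]
  exact or_congr Iff.rfl (and_iff_left rfl)

theorem coordBall_zero {r : ℝ≥0} (hr : 0 < r) : coordBall 0 r = Iio r := by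
  ext x'
  rw [coordBall_of_ne hr.ne', mem_ofPred_eq, edist_lt_coe_iff, NNReal.coe_zero, sub_zero,
    NNReal.abs_eq]
  exact NNReal.coe_lt_coe

/-- In the exceptional case `r = x` the metric ball is `(0, 2x)`, and adding `0` gives `[0, 2x)`,
which is open in the half-line. -/
theorem isOpen_coordBall {x r : ℝ≥0} (hr : 0 < r) : IsOpen (coordBall x r) := by
  have hb : IsOpen {x' | edist x x' < r} := isOpen_lt (by fun_prop) continuous_const
  rcases eq_or_ne r x with rfl | h
  · have : coordBall r r = {x' | edist r x' < r} ∪ Iio r := by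
      rw [coordBall_self]
      ext x'
      rw [mem_union, mem_union, mem_singleton_iff, mem_ofPred_eq, edist_lt_coe_iff, mem_Iio,
        ← NNReal.coe_lt_coe, abs_lt]
      refine ⟨Or.imp_right fun h => by rw [h]; exact_mod_cast hr, ?_⟩
      rintro (h | h)
      · exact Or.inl h
      · rcases eq_or_ne x' 0 with h0 | h0
        · exact Or.inr h0
        · have : (0 : ℝ) < x' := NNReal.coe_pos.2 (pos_iff_ne_zero.2 h0)
          exact Or.inl ⟨by linarith, by linarith⟩
    rw [this]
    exact hb.union isOpen_Iio
  · rwa [coordBall_of_ne h]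

theorem isTopologicalBasis_coordBall :
    TopologicalSpace.IsTopologicalBasis {B | ∃ x r : ℝ≥0, 0 < r ∧ B = coordBall x r} := by
  refine TopologicalSpace.isTopologicalBasis_of_isOpen_of_nhds ?_ fun a u ha hu => ?_
  · rintro _ ⟨x, r, hr, rfl⟩
    exact isOpen_coordBall hr
  · obtain ⟨ε, hε, hsub⟩ := EMetric.isOpen_iff.1 hu a ha
    obtain ⟨ρ, hρ, hρε⟩ := ENNReal.lt_iff_exists_nnreal_btwn.1 hε
    have hρ0 : 0 < ρ := by exact_mod_cast hρ
    -- The exceptional radius `r = a` is avoided by halving, so that the ball is an honest metric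
    -- ball.
    obtain ⟨r, hr, hrρ, hra⟩ : ∃ r : ℝ≥0, 0 < r ∧ r ≤ ρ ∧ r ≠ a := by
      rcases eq_or_ne ρ a with rfl | h
      · exact ⟨ρ / 2, half_pos hρ0, half_le_self hρ0.le, (half_lt_self hρ0).ne⟩
      · exact ⟨ρ, hρ0, le_rfl, h⟩
    refine ⟨_, ⟨a, r, hr, rfl⟩, ?_, fun y hy => hsub ?_⟩
    · rw [coordBall_of_ne hra, mem_ofPred_eq, edist_self]
      exact_mod_cast hr
    · rw [coordBall_of_ne hra, mem_ofPred_eq, edist_comm] at hy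
      exact hy.trans_le ((ENNReal.coe_le_coe.2 hrρ).trans hρε.le)

theorem volume_halfLineBall (x r : ℝ≥0) :
    volume (halfLineBall x r) = ((r + min r x : ℝ≥0) : ℝ≥0∞) := by
  have hx := x.coe_nonneg
  rcases le_or_gt r x with h | h
  · have h' : (r : ℝ) ≤ x := h
    have e : halfLineBall x r = Ioo ((x : ℝ) - r) (x + r) := by
      ext s
      simp only [halfLineBall, mem_ofPred_eq, abs_lt, mem_Ioo]
      constructor
      · rintro ⟨h1, h2, h3⟩
        constructor <;> linarith
      · rintro ⟨h1, h2⟩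
        refine ⟨by linarith, by linarith, by linarith⟩
    rw [e, Real.volume_Ioo, min_eq_left h, ENNReal.ofReal, ENNReal.coe_inj,
      show (x : ℝ) + r - (x - r) = ((r + r : ℝ≥0) : ℝ) by push_cast; ring, Real.toNNReal_coe]
  · have h' : (x : ℝ) < r := h
    have e : halfLineBall x r = Ico 0 ((x : ℝ) + r) := by
      ext s
      simp only [halfLineBall, mem_ofPred_eq, abs_lt, mem_Ico]
      constructor
      · rintro ⟨h1, h2, h3⟩
        exact ⟨h1, by linarith⟩
      · rintro ⟨h1, h2⟩
        refine ⟨h1, by linarith, by linarith⟩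
    rw [e, Real.volume_Ico, min_eq_right h.le, ENNReal.ofReal, ENNReal.coe_inj, sub_zero,
      show (x : ℝ) + r = ((r + x : ℝ≥0) : ℝ) by push_cast; ring, Real.toNNReal_coe]

/-- Lebesgue measure on `(0, ∞)` transported to `ℝ≥0`; the exceptional point `0` has measure zero.
-/
theorem exists_measure_coordBall : ∃ μ : Measure ℝ≥0, ∀ x r : ℝ≥0, 0 < r →
    μ (coordBall x r) = ((r + min r x : ℝ≥0) : ℝ≥0∞) := by
  refine ⟨(volume.restrict (Ioi (0 : ℝ))).map Real.toNNReal, fun x r hr => ?_⟩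
  rw [Measure.map_apply measurable_real_toNNReal (isOpen_coordBall hr).measurableSet,
    ← volume_halfLineBall]
  have h1 : volume (halfLineBall x r) = volume.restrict (Ioi (0 : ℝ)) (halfLineBall x r) := by
    rw [Measure.restrict_congr_set Ioi_ae_eq_Ici, Measure.restrict_apply (measurableSet_halfLineBall x r),
      inter_eq_left.2 fun s hs => hs.1]
  rw [h1]
  refine measure_congr ?_
  filter_upwards [ae_restrict_mem measurableSet_Ioi] with s (hs : 0 < s)
  refine propext ?_
  change _ ∨ _ ↔ _ ∧ _
  rw [Real.coe_toNNReal s hs.le, Real.toNNReal_eq_zero, and_iff_right hs.le]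
  exact or_iff_left fun h => h.1.not_gt hs

/-- Balls about `0` are the intervals `[0, r)`, whose differences `[a, b)` determine a locally
finite measure. -/
theorem measure_ext_of_coordBall {μ μ' : Measure ℝ≥0}
    (h : ∀ x r : ℝ≥0, 0 < r → μ (coordBall x r) = ((r + min r x : ℝ≥0) : ℝ≥0∞))
    (h' : ∀ x r : ℝ≥0, 0 < r → μ' (coordBall x r) = ((r + min r x : ℝ≥0) : ℝ≥0∞)) : μ = μ' := by
  have key : ∀ μ : Measure ℝ≥0, (∀ x r : ℝ≥0, 0 < r →
      μ (coordBall x r) = ((r + min r x : ℝ≥0) : ℝ≥0∞)) →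
      ∀ a : ℝ≥0, μ (Iio a) = a := by
    intro μ h a
    rcases eq_or_ne a 0 with rfl | ha
    · simp
    · have ha' := pos_iff_ne_zero.2 ha
      rw [← coordBall_zero ha', h 0 a ha', min_eq_right zero_le, add_zero]
  have hIco : ∀ μ : Measure ℝ≥0, (∀ a : ℝ≥0, μ (Iio a) = a) →
      ∀ a b : ℝ≥0, a < b → μ (Ico a b) = b - a := by
    intro μ h a b hab
    have e : Ico a b = Iio b \ Iio a := by
      ext s
      simp only [mem_Ico, Set.mem_sdiff, mem_Iio, not_lt]
      exact and_comm
    rw [e, measure_sdiff (Iio_subset_Iio hab.le) measurableSet_Iio.nullMeasurableSet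
      (by rw [h]; exact ENNReal.coe_ne_top), h, h]
  refine Measure.ext_of_Ico' μ μ' (fun a b hab => ?_) fun a b hab => ?_
  · rw [hIco μ (key μ h) a b hab]
    exact ENNReal.sub_ne_top ENNReal.coe_ne_top
  · rw [hIco μ (key μ h) a b hab, hIco μ' (key μ' h') a b hab]

theorem existsUnique_measure_preimage_coordBall {X : Type*} [TopologicalSpace X]
    [MeasurableSpace X] [BorelSpace X] (e : X ≃ₜ ℝ≥0) :
    ∃! ν : Measure X, ∀ (ω : X) (r : ℝ≥0), 0 < r →
      ν (e ⁻¹' coordBall (e ω) r) = ((r + min r (e ω) : ℝ≥0) : ℝ≥0∞) := by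
  obtain ⟨μ, hμ⟩ := exists_measure_coordBall
  refine ⟨μ.map e.symm, fun ω r hr => ?_, fun ν hν => ?_⟩
  · rw [Measure.map_apply e.symm.continuous.measurable
      ((isOpen_coordBall hr).preimage e.continuous).measurableSet, ← preimage_comp,
      e.self_comp_symm, preimage_id, hμ _ _ hr]
  · have h1 : ν.map e = μ := by
      refine measure_ext_of_coordBall (fun x r hr => ?_) hμ
      rw [Measure.map_apply e.continuous.measurable (isOpen_coordBall hr).measurableSet]
      simpa using hν (e.symm x) r hr
    rw [← h1, Measure.map_map e.symm.continuous.measurable e.continuous.measurable,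
      e.symm_comp_self, Measure.map_id]

theorem pointAtom_le_iff {x x' r t : ℝ≥0} : pointAtom x' t ≤ pointAtom x r ↔
    ∀ᵐ s : ℝ ∂volume.restrict (Ioi (0 : ℝ)), |s - x'| < t → |s - x| < r := by
  rw [pointAtom, pointAtom,
    L2On_le_iff (measurableSet_halfLineBall x' t) (measurableSet_halfLineBall x r)]
  refine eventually_congr ?_
  filter_upwards [ae_restrict_mem measurableSet_Ioi] with s (hs : 0 < s)
  exact imp_congr (and_iff_right hs.le) (and_iff_right hs.le)

/-- Only `|x' - x| = r` is delicate. A small neighborhood of `x'` sticks out of the ball on the far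
side, unless that side lies outside the half-line: this happens exactly for `x' = 0` and `r = x`,
when `(0, r)` already lies in `(0, 2x)`. -/
theorem exists_pointAtom_le_iff {x x' r : ℝ≥0} (hr : 0 < r) :
    (∃ t : ℝ≥0, 0 < t ∧ pointAtom x' t ≤ pointAtom x r) ↔ x' ∈ coordBall x r := by
  constructor
  · rintro ⟨t, ht, hle⟩
    rw [pointAtom_le_iff] at hle
    have ht' : (0 : ℝ) < t := ht
    by_contra hcon
    obtain ⟨h1, h2⟩ := not_or.1 hcon
    rw [not_lt, le_abs] at h1
    have hx' := x'.coe_nonneg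
    rcases h1 with h1 | h1
    · refine not_ae_notMem_Ioo hx' (lt_add_of_pos_right (x' : ℝ) ht') ?_
      refine hle.mono fun s hs h => ?_
      have h3 := abs_lt.1 (hs (by rw [abs_of_pos (sub_pos.2 h.1)]; linarith [h.2]))
      linarith [h.1]
    -- To the left of the ball: if `x' < x - r`, points just right of `x'` are missed; if `x' = x -
    -- r`, points just left of `x'` are missed, and these exist because `x' > 0`.
    · rcases (show (x' : ℝ) ≤ x - r by linarith).lt_or_eq with h3 | h3
      · refine not_ae_notMem_Ioo hx' (lt_min (lt_add_of_pos_right (x' : ℝ) ht') h3) ?_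
        refine hle.mono fun s hs h => ?_
        have h4 := h.2.trans_le (min_le_left _ _)
        have h5 := h.2.trans_le (min_le_right _ _)
        have h3 := abs_lt.1 (hs (by rw [abs_of_pos (sub_pos.2 h.1)]; linarith))
        linarith
      · have hx0 : (0 : ℝ) < x' := by
          refine lt_of_le_of_ne hx' fun h0 => h2 ⟨NNReal.coe_injective h0.symm, ?_⟩
          refine NNReal.coe_injective ?_
          change (0 : ℝ) = x' at h0
          linarith
        refine not_ae_notMem_Ioo (le_max_left (0 : ℝ) (x' - t))
          (max_lt hx0 (sub_lt_self (x' : ℝ) ht')) ?_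
        refine hle.mono fun s hs h => ?_
        have h4 := (le_max_right _ _).trans_lt h.1
        have h5 := abs_lt.1 (hs (by rw [abs_of_neg (sub_neg.2 h.2)]; linarith))
        linarith [h.2]
  · rintro (h | ⟨rfl, rfl⟩)
    · obtain ⟨t, ht⟩ : ∃ t : ℝ≥0, (t : ℝ) = r - |(x' : ℝ) - x| :=
        CanLift.prf _ (sub_pos.2 h).le
      refine ⟨t, NNReal.coe_pos.1 (ht ▸ sub_pos.2 h), ?_⟩
      rw [pointAtom_le_iff, ht]
      refine Eventually.of_forall fun s hs => ?_
      linarith [abs_sub_le s x' x]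
    · refine ⟨r, hr, ?_⟩
      rw [pointAtom_le_iff]
      filter_upwards [ae_restrict_mem measurableSet_Ioi] with s (hs : 0 < s)
      rw [NNReal.coe_zero, sub_zero, abs_of_pos hs, abs_lt]
      intro h
      constructor <;> linarith

/-- For `x > 0` the inclusion fails at `t = x`: the interval `(x, 2x)` is in the neighborhood of `x`
but not in that of `0`. -/
theorem pointAtom_le_thickening_iff {x : ℝ≥0} :
    (∀ t : ℝ≥0, 0 < t → pointAtom x t ≤ L2On (Metric.thickening t {(0 : ℝ)})) ↔ x = 0 := by
  have hm : ∀ t : ℝ, MeasurableSet (Metric.thickening t {(0 : ℝ)}) := fun t =>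
    Metric.isOpen_thickening.measurableSet
  constructor
  · intro h
    by_contra hx
    have hx0 : 0 < x := pos_iff_ne_zero.2 hx
    have h1 := (L2On_le_iff (measurableSet_halfLineBall x x) (hm x)).1 (h x hx0)
    refine not_ae_notMem_Ioo x.coe_nonneg (lt_add_of_pos_right (x : ℝ) (NNReal.coe_pos.2 hx0)) ?_
    refine h1.mono fun s hs h => ?_
    have h2 := hs (Ioo_subset_halfLineBall x x h)
    rw [Metric.thickening_singleton, Metric.mem_ball, Real.dist_0_eq_abs] at h2
    linarith [le_abs_self s, h.1]
  · rintro rfl t -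
    refine L2On_mono (measurableSet_halfLineBall 0 t) (hm t) (Eventually.of_forall fun s hs => ?_)
    rw [Metric.thickening_singleton, Metric.mem_ball, Real.dist_eq]
    exact hs.2

end Coordinate

end WaveSpectrum

/-! ### The proposition: transport from the half-line -/

open WaveSpectrum in
theorem proposition3 (q : ℝ → ℝ) (hq : ContDiffOn ℝ (⊤ : ℕ∞) q (Ici 0)) (hlp : IsLimitPoint q)
    (hpos : IsPositiveDefinite (sturmLiouvilleOp q)) :
    ∃ β : ℝ≥0 ≃ waveSpectrum (sturmLiouvilleOp q),
      (∀ x, (β x : ℝ≥0 → ClosedSubmodule ℂ HalfLineL2) = pointAtom x) ∧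
      (∀ (ω : waveSpectrum (sturmLiouvilleOp q)) (r : ℝ≥0), 0 < r → r ≠ β.symm ω →
        waveBall (sturmLiouvilleOp q) r ω = {ω' | eikonalDist ω.1 ω'.1 < r}) ∧
      (∀ (ω : waveSpectrum (sturmLiouvilleOp q)) (r : ℝ≥0), 0 < r → r = β.symm ω →
        waveBall (sturmLiouvilleOp q) r ω = {ω' | eikonalDist ω.1 ω'.1 < r} ∪ {β 0}) ∧
      (∃ d : MetricSpace (waveSpectrum (sturmLiouvilleOp q)),
        (∀ ω ω', d.toPseudoMetricSpace.edist ω ω' = eikonalDist ω.1 ω'.1) ∧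
        ballTopology (sturmLiouvilleOp q) =
          d.toPseudoMetricSpace.toUniformSpace.toTopologicalSpace) ∧
      @TopologicalSpace.IsTopologicalBasis _ (ballTopology (sturmLiouvilleOp q))
        (waveBalls (sturmLiouvilleOp q)) ∧
      (∃! ν : @Measure (waveSpectrum (sturmLiouvilleOp q))
          (@borel _ (ballTopology (sturmLiouvilleOp q))),
        ∀ (ω : waveSpectrum (sturmLiouvilleOp q)) (r : ℝ≥0), 0 < r →
          ν (waveBall (sturmLiouvilleOp q) r ω) = ((r + min r (β.symm ω) : ℝ≥0) : ℝ≥0∞)) ∧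
      (∀ x r : ℝ≥0, 0 < r → volume (halfLineBall x r) = ((r + min r x : ℝ≥0) : ℝ≥0∞)) ∧
      waveBoundary (sturmLiouvilleOp q) = {β 0} ∧
      (∀ ω : waveSpectrum (sturmLiouvilleOp q),
        eikonalDist ω.1 (β 0).1 = (β.symm ω : ℝ≥0∞)) ∧
      @IsHomeomorph (waveSpectrum (sturmLiouvilleOp q)) ℝ≥0
        (ballTopology (sturmLiouvilleOp q)) _
        (fun ω => (eikonalDist ω.1 (β 0).1).toNNReal) ∧
      (∀ ω ω' : waveSpectrum (sturmLiouvilleOp q), eikonalDist ω.1 ω'.1 =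
        edist (eikonalDist ω.1 (β 0).1).toNNReal (eikonalDist ω'.1 (β 0).1).toNNReal) := by
  have hB := isFriedrichsInverse (dense_sturmLiouvilleOp_domain hq.continuousOn) hpos
  have hmem : ∀ x, pointAtom x ∈ waveSpectrum (sturmLiouvilleOp q) := fun x =>
    (mem_waveSpectrum_iff hq hB).2 ⟨x, rfl⟩
  set β : ℝ≥0 ≃ waveSpectrum (sturmLiouvilleOp q) :=
    Equiv.ofBijective (fun x => ⟨pointAtom x, hmem x⟩)
      ⟨fun x y h => pointAtom_injective (congrArg Subtype.val h), fun ω => by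
        obtain ⟨x, hx⟩ := (mem_waveSpectrum_iff hq hB).1 ω.2
        exact ⟨x, Subtype.ext hx⟩⟩ with hβdef
  have hβ : ∀ x, (β x : ℝ≥0 → ClosedSubmodule ℂ HalfLineL2) = pointAtom x := fun x => rfl
  have hβ' : ∀ ω : waveSpectrum (sturmLiouvilleOp q), ω.1 = pointAtom (β.symm ω) := fun ω => by
    rw [← hβ, β.apply_symm_apply]
  have hdist : ∀ ω ω' : waveSpectrum (sturmLiouvilleOp q),
      eikonalDist ω.1 ω'.1 = edist (β.symm ω) (β.symm ω') := fun ω ω' => by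
    rw [hβ' ω, hβ' ω', eikonalDist_pointAtom]
  have hdist0 : ∀ ω : waveSpectrum (sturmLiouvilleOp q),
      eikonalDist ω.1 (β 0).1 = (β.symm ω : ℝ≥0∞) := fun ω => by
    rw [hdist, β.symm_apply_apply, edist_comm, edist_nndist, NNReal.nndist_zero_eq_val]
  have hball : ∀ (ω : waveSpectrum (sturmLiouvilleOp q)) (r : ℝ≥0), 0 < r →
      waveBall (sturmLiouvilleOp q) r ω = β.symm ⁻¹' coordBall (β.symm ω) r := by
    intro ω r hr
    ext ω'
    rw [mem_preimage, ← exists_pointAtom_le_iff hr, waveBall, mem_ofPred_eq, hβ' ω, hβ' ω']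
    exact exists_congr fun t => and_congr_right fun ht =>
      and_iff_right (pointAtom_ne_bot_of_pos _ ht)
  have hbasis := isTopologicalBasis_coordBall.induced β.symm
  have hballs : (preimage β.symm) '' {B | ∃ x r : ℝ≥0, 0 < r ∧ B = coordBall x r} =
      waveBalls (sturmLiouvilleOp q) := by
    ext B
    constructor
    · rintro ⟨_, ⟨x, r, hr, rfl⟩, rfl⟩
      exact ⟨β x, r, hr, by rw [hball _ _ hr, β.symm_apply_apply]⟩
    · rintro ⟨ω, r, hr, rfl⟩
      exact ⟨_, ⟨β.symm ω, r, hr, rfl⟩, (hball ω r hr).symm⟩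
  rw [hballs] at hbasis
  -- The balls are the preimages under the coordinate of a base of the topology of `ℝ≥0`, so the
  -- topology they generate is the induced one; the metric and the homeomorphism follow from this.
  have htop : ballTopology (sturmLiouvilleOp q) =
      TopologicalSpace.induced β.symm (inferInstance : TopologicalSpace ℝ≥0) :=
    (TopologicalSpace.IsTopologicalBasis.eq_generateFrom
      (t := TopologicalSpace.induced β.symm inferInstance) hbasis).symm
  let _ : TopologicalSpace (waveSpectrum (sturmLiouvilleOp q)) := ballTopology (sturmLiouvilleOp q)
  let e : waveSpectrum (sturmLiouvilleOp q) ≃ₜ ℝ≥0 := β.symm.toHomeomorphOfIsInducing ⟨htop⟩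
  have he : ⇑e = β.symm := rfl
  refine ⟨β, hβ, fun ω r hr hne => ?_, fun ω r hr heq => ?_,
    ⟨MetricSpace.induced β.symm β.symm.injective inferInstance, fun ω ω' => (hdist ω ω').symm, htop⟩,
    by rw [htop]; exact hbasis, ?_, fun x r _ => volume_halfLineBall x r, ?_, hdist0, ?_, ?_⟩
  · rw [hball ω r hr, coordBall_of_ne hne]
    ext ω'
    rw [mem_ofPred_eq, hdist]
    rfl
  · rw [hball ω r hr, ← heq, coordBall_self, preimage_union]
    congr 1
    · ext ω'
      rw [mem_ofPred_eq, hdist, ← heq]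
      rfl
    · ext ω'
      exact β.symm_apply_eq
  · let _ : MeasurableSpace (waveSpectrum (sturmLiouvilleOp q)) := borel _
    have _ : BorelSpace (waveSpectrum (sturmLiouvilleOp q)) := ⟨rfl⟩
    obtain ⟨ν, hν, huniq⟩ := existsUnique_measure_preimage_coordBall e
    refine ⟨ν, fun ω r hr => ?_, fun ν' hν' => huniq ν' fun ω r hr => ?_⟩
    · rw [hball ω r hr]
      exact hν ω r hr
    · rw [he, ← hball ω r hr]
      exact hν' ω r hr
  · ext ω
    rw [mem_singleton_iff, ← β.symm_apply_eq, waveBoundary, mem_ofPred_eq, hβ' ω]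
    simp only [reachableSubspace_eq hq hB]
    exact pointAtom_le_thickening_iff
  · have : (fun ω : waveSpectrum (sturmLiouvilleOp q) =>
        (eikonalDist ω.1 (β 0).1).toNNReal) = e := by
      ext ω
      rw [hdist0, ENNReal.toNNReal_coe, he]
    rw [this]
    exact e.isHomeomorph
  · intro ω ω'
    rw [hdist0, hdist0, ENNReal.toNNReal_coe, ENNReal.toNNReal_coe, hdist]
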